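/- **Setting.** For $n\ge 1$ order $\{0,1\}^n$ componentwise, put $|u|=\sum_i u_i$, and write $u\ge_k v$ if $u\ge v$ and $|u|-|v|=k$. The cube category $\underline 2^n$ has objects $\{0,1\}^n$ and a unique morphism $u\to v$ whenever $u\ge v$. The signed Burnside category $\mathcal B_\sigma$ is the weak 2-category of finite sets, signed correspondences $X\xleftarrow{s_A}A\xrightarrow{t_A}Y$ with a sign $\sigma_A\colon A\to\mathbb Z/2$ ($A$ finite, composition by fibre product, signs added), and bijections preserving source, target and sign. A strictly unitary 2-functor $F\colon\underline 2^n\to\mathcal B_\sigma$ consists of finite sets $F_u$, signed correspondences $F_{u,v}$ from $F_u$ to $F_v$ for $u\ge v$ with $F_{u,u}$ the identity, and maps of signed correspondences $F_{u,v,w}\colon F_{v,w}\circ F_{u,v}\to F_{u,w}$ for $u\ge v\ge w$ which are the unitors if $u=v$ or $v=w$ and are compatible with the associators. **Framed 1-flow categories.** A 1-flow category $\mathscr C$ has a finite set of objects with a grading $|\cdot|$ in $\mathbb Z$, for $|a|-|b|=1$ a finite set $\mathcal M(a,b)$, and for $|a|-|c|=2$ a compact 1-manifold $\mathcal M(a,c)$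 with $\partial\mathcal M(a,c)=\coprod_b\mathcal M(b,c)\times\mathcal M(a,b)$. Let $C^k(\mathscr C;\mathbb Z/2)$ be the $\mathbb Z/2$-valued functions on the objects of degree $k$, with $(\delta\varphi)(a)=\sum_c|\mathcal M(a,c)|\,\varphi(c)$, and $H^*(\mathscr C;\mathbb Z/2)$ its cohomology. A sign assignment gives each point $P$ of a $0$-dimensional moduli space a value $s(P)\in\mathbb Z/2$ such that $s(P_1)+s(Q_1)+s(P_2)+s(Q_2)=1$ whenever $(P_1,Q_1),(P_2,Q_2)$ bound an interval. A pre-framing gives each component of a $1$-dimensional moduli space a value $f\in\mathbb Z/2$. For $|a|=|d|+3$ let $\partial\mathcal M(a,d)$ be the union of all $\mathcal M(b,d)\times\mathcal M(a,b)$ ($|b|=|a|-1$) and $\mathcal M(c,d)\times\mathcal M(a,c)$ ($|c|=|a|-2$), glued along all $\mathcal M(c,d)\times\mathcal M(b,c)\times\mathcal M(a,b)$; it is a disjoint union of circles $K$. Put $\tilde f(K)=1+f(S)$ if $K=\{P\}\times S$ or $S\times\{Q\}$ for a circle component $S$, and otherwise $\tilde f(K)=\sum_{I\times\{Q\}\subset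 K}f(I)+\sum_{\{P\}\times J\subset K}(1+s(P)+f(J))$. Then $(\mathscr C,s,f)$ is framed (and $f$ is a frame assignment) if $\sum_K(1+\tilde f(K))=0$ for all such $a,d$. **The second Steenrod square of $(\mathscr C,s,f)$.** Let $\varphi\in C^k(\mathscr C;\mathbb Z/2)$ be a cocycle. Partition, for every $b$ with $|b|=k+1$, the set $\coprod_{\varphi(c)=1}\mathcal M(b,c)$ into ordered pairs. For $|a|=k+2$ let $\Gamma(a,\varphi)$ be the graph whose vertices are the pairs $(B,A)\in\mathcal M(b,c)\times\mathcal M(a,b)$ with $\varphi(c)=1$, with an edge for each interval component of $\mathcal M(a,c)$, $\varphi(c)=1$, joining its end points, and an edge between $(B_1,A)$ and $(B_2,A)$ for each chosen pair $(B_1,B_2)$, oriented from $(B_1,A)$ to $(B_2,A)$ if $s(B_1)=s(B_2)$. Its components are circles. Put $$\mathrm{sq}^\varphi(a)=|L|+\sum_K\bigl(1+F(K)+D(K)\bigr)\in\mathbb Z/2,$$ where $L$ is the set of circle components with framing value $0$ of the $\mathcal M(a,c)$ with $\varphi(c)=1$, $K$ runs over the components of $\Gamma(a,\varphi)$, $F(K)$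 is the sum of the framing values of the intervals in $K$, and $D(K)$ is the number of oriented edges of $K$ that point in a chosen direction of $K$. If every $\mathrm{sq}^\varphi$ is a cocycle and $[\varphi]\mapsto[\mathrm{sq}^\varphi]$ is a well-defined linear map $H^k(\mathscr C;\mathbb Z/2)\to H^{k+2}(\mathscr C;\mathbb Z/2)$, independent of the pairs and directions chosen, this map is the second Steenrod square. **The category $\mathscr C_F$.** The cube 1-flow category $\mathscr C(n)$ has object set $\{0,1\}^n$ with grading $|u|$, one point $C_{u,v}$ in $\mathcal M(u,v)$ for each $u\ge_1v$, one interval $C_{u,w}$ as $\mathcal M(u,w)$ for each $u\ge_2w$, with end points $(C_{v_i,w},C_{u,v_i})$ where $v_1\neq v_2$ are the two vertices strictly between $u$ and $w$, and all other moduli spaces empty. The 1-flow category $\mathscr C_F$ has object set $\coprod_uF_u$ with elements of $F_u$ in degree $|u|$; for $u\ge_1v$, $a\in F_u$, $b\in F_v$, $\mathcal M(a,b)$ is the set of elements of $F_{u,v}$ with source $a$ and target $b$; for $u\ge_2w$, $a\in F_u$, $c\in F_w$, $\mathcal M(a,c)$ has one interval $I_X$ for each $X\in F_{u,w}$ with source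 $a$ and target $c$, bounded by the two pairs $(B_i,A_i)=F_{u,v_i,w}^{-1}(X)$; all other moduli spaces are empty. Write $H^i(F;\mathbb Z/2)=H^i(\mathscr C_F;\mathbb Z/2)$. Given sign and frame assignments $s,f$ of $\mathscr C(n)$ and $\delta,\varepsilon\in\mathbb Z/2$, let $s_F(P)=s(C_{u,v})+\sigma(P)$ for $P\in F_{u,v}$, $u\ge_1 v$. For $X\in F_{u,w}$ let $(a,b,c,d)$ be the values of $s$ on $C_{v_1,w},C_{v_2,w},C_{u,v_2},C_{u,v_1}$ and $(a',b',c',d')$ those of $s_F$ on $B_1,B_2,A_2,A_1$, and let $f_F(I_X)=f(C_{u,w})+\theta$, where $\theta$ depends as follows on the set of those letters whose values differ: $$\emptyset:0,\quad ab:1,\quad cd:c+d,\quad ad:\delta+a,\quad bc:\delta+b,\quad ac:\delta+\varepsilon+b,\quad bd:\delta+\varepsilon+a,\quad abcd:a+b.$$ **Proposition.** Let $F\colon\underline 2^n\to\mathcal B_\sigma$ be a strictly unitary 2-functor and $\varepsilon\in\mathbb Z/2$. 1. For every sign assignment $s$ and frame assignment $f$ of $\mathscr C(n)$ and every $\delta\in\mathbb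 Z/2$, $(\mathscr C_F,s_F,f_F)$ is a framed 1-flow category. 2. For every $i\in\mathbb Z$ there is a unique linear map $$\mathrm{Sq}^2_\varepsilon\colon H^i(F;\mathbb Z/2)\to H^{i+2}(F;\mathbb Z/2)$$ which is the second Steenrod square of $(\mathscr C_F,s_F,f_F)$ for all choices of $s$, $f$ and $\delta$. In particular it does not depend on these choices. 3. These maps are non-zero in general: for each $\varepsilon\in\mathbb Z/2$ there are $n$, $F$ and $i$ with $\mathrm{Sq}^2_\varepsilon\neq0$ on $H^i(F;\mathbb Z/2)$. 4. They can depend on $\varepsilon$: there are $n$, $F$ and $i$ with $\mathrm{Sq}^2_0\neq\mathrm{Sq}^2_1$ on $H^i(F;\mathbb Z/2)$. -/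

import Mathlib

noncomputable section

/-! ### `1`-flow categories

Up to homeomorphism a compact `1`-manifold is a finite disjoint union of intervals and circles, so a
`1`-flow category is recorded by the finite sets of its objects, of the points of all its
`0`-dimensional moduli spaces, and of the interval and circle components of all its `1`-dimensional
moduli spaces, together with the identification of the boundary. -/

/-- A `1`-flow category. An element `P : Pt` is a point of `M(src P, tgt P)`; elements of `Itv` and
`Circ` are the interval and circle components of the `1`-dimensional moduli spaces
`M(itvSrc I, itvTgt I)` and `M(circSrc S, circTgt S)`. A composable pair `(B, A)`, that is, a point
of `M(b, c) × M(a, b)`, is a boundary point of `M(a, c)`; it lies on the interval `bdry (B, A)`, and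
every interval has exactly two boundary points. -/
structure OneFlowCat where
  Ob : Type
  Pt : Type
  Itv : Type
  Circ : Type
  [finite_Ob : Finite Ob]
  [finite_Pt : Finite Pt]
  [finite_Itv : Finite Itv]
  [finite_Circ : Finite Circ]
  gr : Ob → ℤ
  src : Pt → Ob
  tgt : Pt → Ob
  gr_src : ∀ P, gr (src P) = gr (tgt P) + 1
  itvSrc : Itv → Ob
  itvTgt : Itv → Ob
  gr_itvSrc : ∀ I, gr (itvSrc I) = gr (itvTgt I) + 2
  circSrc : Circ → Ob
  circTgt : Circ → Ob
  gr_circSrc : ∀ S, gr (circSrc S) = gr (circTgt S) + 2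
  bdry : {p : Pt × Pt // tgt p.2 = src p.1} → Itv
  itvSrc_bdry : ∀ p, itvSrc (bdry p) = src p.1.2
  itvTgt_bdry : ∀ p, itvTgt (bdry p) = tgt p.1.1
  bdry_two : ∀ I, ∃ p q, p ≠ q ∧ ∀ r, bdry r = I ↔ r = p ∨ r = q

namespace OneFlowCat

attribute [instance] finite_Ob finite_Pt finite_Itv finite_Circ

variable (C : OneFlowCat)

instance : Fintype C.Ob := Fintype.ofFinite _
instance : Fintype C.Pt := Fintype.ofFinite _
instance : Fintype C.Itv := Fintype.ofFinite _
instance : Fintype C.Circ := Fintype.ofFinite _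

/-- Composable pairs `(B, A)`, i.e. the points of all `M(b, c) × M(a, b)`. -/
abbrev Pair : Type := {p : C.Pt × C.Pt // C.tgt p.2 = C.src p.1}

/-! #### Cohomology -/

open Classical in
/-- The integer `[a : b] = ∑_{A ∈ M(a, b)} (-1)^{s(A)}`. -/
def incidence (s : C.Pt → ZMod 2) (a b : C.Ob) : ℤ :=
  ∑ P : C.Pt, if C.src P = a ∧ C.tgt P = b then (-1) ^ (s P).val else 0

open Classical in
/-- The coboundary with `ℤ/2` coefficients. Modulo `2` the signs do not matter, see
`coboundary_eq_incidence`. -/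
def coboundary : (C.Ob → ZMod 2) →ₗ[ZMod 2] (C.Ob → ZMod 2) where
  toFun φ a := ∑ P : C.Pt, if C.src P = a then φ (C.tgt P) else 0
  map_add' φ ψ := by
    funext a
    simp only [Pi.add_apply, ← Finset.sum_add_distrib]
    exact Finset.sum_congr rfl fun P _ => by split_ifs <;> simp
  map_smul' r φ := by
    funext a
    simp only [Pi.smul_apply, smul_eq_mul, RingHom.id_apply, Finset.mul_sum]
    exact Finset.sum_congr rfl fun P _ => by split_ifs <;> simp

/-- For every sign function, `coboundary` is the reduction mod `2` of the coboundary
`δ(b) = ∑_a [a : b] a`. -/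
theorem coboundary_eq_incidence (s : C.Pt → ZMod 2) (φ : C.Ob → ZMod 2) (a : C.Ob) :
    C.coboundary φ a = ∑ b : C.Ob, ((C.incidence s a b : ℤ) : ZMod 2) * φ b := by
  classical
  simp only [coboundary, LinearMap.coe_mk, AddHom.coe_mk, incidence, Int.cast_sum,
    Finset.sum_mul]
  rw [Finset.sum_comm]
  refine Finset.sum_congr rfl fun P _ => ?_
  have h1 : (-1 : ZMod 2) = 1 := by decide
  by_cases h : C.src P = a
  · simp [h, apply_ite (Int.cast : ℤ → ZMod 2), h1]
  · simp [h]

/-- The cochain group `C^k(C; ℤ/2)`, as the functions on objects supported in degree `k`. -/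
def cochains (k : ℤ) : Submodule (ZMod 2) (C.Ob → ZMod 2) where
  carrier := {φ | ∀ a, C.gr a ≠ k → φ a = 0}
  add_mem' hφ hψ a ha := by simp [hφ a ha, hψ a ha]
  zero_mem' _ _ := rfl
  smul_mem' r φ hφ a ha := by simp [hφ a ha]

def cocycles (k : ℤ) : Submodule (ZMod 2) (C.Ob → ZMod 2) :=
  C.cochains k ⊓ LinearMap.ker C.coboundary

def coboundaries (k : ℤ) : Submodule (ZMod 2) (C.Ob → ZMod 2) :=
  (C.cochains (k - 1)).map C.coboundary

theorem coboundary_coboundary (φ : C.Ob → ZMod 2) : C.coboundary (C.coboundary φ) = 0 := by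
  classical
  funext a
  have h1 : C.coboundary (C.coboundary φ) a =
      ∑ p : C.Pair, if C.src p.1.2 = a then φ (C.tgt p.1.1) else 0 := by
    simp only [coboundary, LinearMap.coe_mk, AddHom.coe_mk]
    rw [← Finset.sum_subtype (Finset.univ.filter fun p : C.Pt × C.Pt => C.tgt p.2 = C.src p.1)
      (p := fun p : C.Pt × C.Pt => C.tgt p.2 = C.src p.1) (by simp)
      (fun p => if C.src p.2 = a then φ (C.tgt p.1) else 0)]
    rw [Finset.sum_filter, Fintype.sum_prod_type, Finset.sum_comm]
    refine Finset.sum_congr rfl fun A _ => ?_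
    by_cases hA : C.src A = a
    · simp only [hA, if_true]
      exact Finset.sum_congr rfl fun B _ => by simp [eq_comm]
    · simp [hA]
  rw [h1, ← Finset.sum_fiberwise (s := Finset.univ) (g := C.bdry)]
  refine Finset.sum_eq_zero fun I _ => ?_
  obtain ⟨p, q, hpq, hr⟩ := C.bdry_two I
  have hf : (Finset.univ.filter fun r : C.Pair => C.bdry r = I) = {p, q} := by
    ext r; simp [hr]
  have hp : C.bdry p = I := (hr p).2 (Or.inl rfl)
  have hq : C.bdry q = I := (hr q).2 (Or.inr rfl)
  have e1 : C.src p.1.2 = C.src q.1.2 := by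
    rw [← C.itvSrc_bdry, ← C.itvSrc_bdry, hp, hq]
  have e2 : C.tgt p.1.1 = C.tgt q.1.1 := by
    rw [← C.itvTgt_bdry, ← C.itvTgt_bdry, hp, hq]
  rw [hf, Finset.sum_pair hpq, e1, e2]
  exact CharTwo.add_self_eq_zero _

/-- The cohomology group `H^k(C; ℤ/2)`. -/
abbrev H (k : ℤ) : Type :=
  C.cocycles k ⧸ (C.coboundaries k).submoduleOf (C.cocycles k)

/-- The class of a cocycle. -/
def H.mk {C : OneFlowCat} {k : ℤ} (φ : C.Ob → ZMod 2) (hφ : φ ∈ C.cocycles k) : C.H k :=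
  Submodule.Quotient.mk ⟨φ, hφ⟩

/-! #### Sign and frame assignments -/

/-- `s(P₁) + s(Q₁) + s(P₂) + s(Q₂) = 1` if `(P₁, Q₁)` and `(P₂, Q₂)` are the two boundary points of
an interval. -/
def IsSignAssignment (s : C.Pt → ZMod 2) : Prop :=
  ∀ p q : C.Pair, p ≠ q → C.bdry p = C.bdry q →
    s p.1.1 + s p.1.2 + s q.1.1 + s q.1.2 = 1

/-- A value in `ℤ/2` for every component of a `1`-dimensional moduli space. -/
structure PreFraming where
  itv : C.Itv → ZMod 2
  circ : C.Circ → ZMod 2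

/-- The corners `(P, B, A)` of `∂M(a, d)`, i.e. the points of all
`M(c, d) × M(b, c) × M(a, b)`. -/
abbrev Triple (a d : C.Ob) : Type :=
  {t : C.Pt × C.Pt × C.Pt // C.src t.2.2 = a ∧ C.tgt t.2.2 = C.src t.2.1 ∧
    C.tgt t.2.1 = C.src t.1 ∧ C.tgt t.1 = d}

variable {C} in
/-- The edge `I × {A}` of `∂M(a, d)` on which the corner `(P, B, A)` lies. -/
def Triple.lower {a d : C.Ob} (t : C.Triple a d) : C.Itv × C.Pt :=
  (C.bdry ⟨(t.1.1, t.1.2.1), t.2.2.2.1⟩, t.1.2.2)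

variable {C} in
/-- The edge `{P} × J` of `∂M(a, d)` on which the corner `(P, B, A)` lies. -/
def Triple.upper {a d : C.Ob} (t : C.Triple a d) : C.Pt × C.Itv :=
  (t.1.1, C.bdry ⟨(t.1.2.1, t.1.2.2), t.2.2.1⟩)

/-- The components of `∂M(a, d)` that are unions of intervals. -/
abbrev BdryComp (a d : C.Ob) : Type :=
  Quot fun t t' : C.Triple a d => t.lower = t'.lower ∨ t.upper = t'.upper

instance (a d : C.Ob) : Fintype (C.BdryComp a d) := Fintype.ofFinite _

variable {C} in
open Classical in
/-- The value `∑_{I × {A}} f(I) + ∑_{{P} × J} (1 + s(P) + f(J))` of a component of `∂M(a, d)` which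
is a union of intervals. -/
def bdryValue (s : C.Pt → ZMod 2) (f : C.PreFraming) {a d : C.Ob} (K : C.BdryComp a d) : ZMod 2 :=
  (∑ e : C.Itv × C.Pt with ∃ t : C.Triple a d, Quot.mk _ t = K ∧ t.lower = e, f.itv e.1) +
  ∑ e : C.Pt × C.Itv with ∃ t : C.Triple a d, Quot.mk _ t = K ∧ t.upper = e,
    (1 + s e.1 + f.itv e.2)

open Classical in
/-- The compatibility condition `∑_K (1 + f̃(K)) = 0`, where `K` runs over the components of
`∂M(a, d)`. The last two sums are over the circles `S × {A}` and `{P} × S`, where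
`f̃ = 1 + f(S)`. -/
def IsFraming (s : C.Pt → ZMod 2) (f : C.PreFraming) : Prop :=
  ∀ a d : C.Ob, C.gr a = C.gr d + 3 →
    (∑ K : C.BdryComp a d, (1 + bdryValue s f K)) +
    (∑ e : C.Circ × C.Pt with C.src e.2 = a ∧ C.tgt e.2 = C.circSrc e.1 ∧ C.circTgt e.1 = d,
      (1 + (1 + f.circ e.1))) +
    (∑ e : C.Pt × C.Circ with C.circSrc e.2 = a ∧ C.circTgt e.2 = C.src e.1 ∧ C.tgt e.1 = d,
      (1 + (1 + f.circ e.2))) = 0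

/-- `(C, s, f)` is a framed `1`-flow category. -/
def IsFramed (s : C.Pt → ZMod 2) (f : C.PreFraming) : Prop :=
  C.IsSignAssignment s ∧ C.IsFraming s f

/-! #### The second Steenrod square -/

/-- A combinatorial boundary matching for the cochain `φ`: for every object `b`, a partition of the
points of `∐_{φ(c) = 1} M(b, c)` into ordered pairs. The pairs are `(B, partner B)`, where `B` runs
through the points with `first B = true`. -/
structure Matching (φ : C.Ob → ZMod 2) where
  partner : {B : C.Pt // φ (C.tgt B) = 1} → {B : C.Pt // φ (C.tgt B) = 1}
  first : {B : C.Pt // φ (C.tgt B) = 1} → Bool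
  src_partner : ∀ B, C.src (partner B).1 = C.src B.1
  partner_partner : ∀ B, partner (partner B) = B
  first_partner : ∀ B, first (partner B) = !first B

/-- The vertices `(B, A)` of the special graph structure `Γ(a, φ)`. -/
abbrev Vert (φ : C.Ob → ZMod 2) (a : C.Ob) : Type :=
  {p : C.Pair // C.src p.1.2 = a ∧ φ (C.tgt p.1.1) = 1}

variable {C}

/-- The first coordinate `B` of the vertex `(B, A)`. -/
def Vert.lowerPt {φ : C.Ob → ZMod 2} {a : C.Ob} (v : C.Vert φ a) :
    {B : C.Pt // φ (C.tgt B) = 1} := ⟨v.1.1.1, v.2.2⟩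

/-- The second coordinate `A` of the vertex `(B, A)`. -/
def Vert.upperPt {φ : C.Ob → ZMod 2} {a : C.Ob} (v : C.Vert φ a) : C.Pt := v.1.1.2

/-- The interval on which the vertex lies; these intervals are the edges in `E'`. -/
def Vert.itv {φ : C.Ob → ZMod 2} {a : C.Ob} (v : C.Vert φ a) : C.Itv := C.bdry v.1

/-- The vertices `(B₁, A)` and `(B₂, A)` are joined by an edge outside `E'` if `B₁` and `B₂` are
matched. -/
def Matching.Joins {φ : C.Ob → ZMod 2} (m : C.Matching φ) {a : C.Ob} (v w : C.Vert φ a) : Prop :=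
  v.upperPt = w.upperPt ∧ m.partner v.lowerPt = w.lowerPt

/-- The components of `Γ(a, φ)` that contain a vertex. They are circles in which the edges of `E'`
and the edges given by the matching alternate. -/
abbrev Matching.Comp {φ : C.Ob → ZMod 2} (m : C.Matching φ) (a : C.Ob) : Type :=
  Quot fun v w : C.Vert φ a => v.itv = w.itv ∨ m.Joins v w

instance {φ : C.Ob → ZMod 2} (m : C.Matching φ) (a : C.Ob) : Fintype (m.Comp a) :=
  Fintype.ofFinite _

/-- A choice of a direction for every circle of the graphs `Γ(a, φ)`. As the two kinds of edges
alternate along a circle, a direction is determined by the set of those vertices which are left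
along the edge given by the matching; it contains exactly one endpoint of each edge. -/
structure Matching.Direction {φ : C.Ob → ZMod 2} (m : C.Matching φ) where
  leaves : ∀ {a : C.Ob}, C.Vert φ a → Bool
  leaves_itv : ∀ {a : C.Ob} (v w : C.Vert φ a), v ≠ w → v.itv = w.itv → leaves v ≠ leaves w
  leaves_joins : ∀ {a : C.Ob} (v w : C.Vert φ a), m.Joins v w → leaves v ≠ leaves w

open Classical in
/-- `F(K)`, the sum of the framing values of the intervals in the circle `K`. -/
def Matching.frameSum {φ : C.Ob → ZMod 2} (m : C.Matching φ) (f : C.PreFraming) {a : C.Ob}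
    (K : m.Comp a) : ZMod 2 :=
  ∑ I : C.Itv with ∃ v : C.Vert φ a, Quot.mk _ v = K ∧ v.itv = I, f.itv I

open Classical in
/-- `D(K)`, the number mod `2` of oriented edges in the circle `K` which point in the chosen
direction. The oriented edges go from `(B₁, A)` to `(B₂, A)`, where `(B₁, B₂)` is a pair of the
matching with `s(B₁) = s(B₂)`. -/
def Matching.dirCount {φ : C.Ob → ZMod 2} (m : C.Matching φ) (o : m.Direction)
    (s : C.Pt → ZMod 2) {a : C.Ob} (K : m.Comp a) : ZMod 2 :=
  ((Finset.univ.filter fun v : C.Vert φ a => Quot.mk _ v = K ∧ m.first v.lowerPt = true ∧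
    s v.lowerPt.1 = s (m.partner v.lowerPt).1 ∧ o.leaves v = true).card : ZMod 2)

open Classical in
/-- The cochain `sq^φ(a) = |L| + ∑_K (1 + F(K) + D(K))`. The loops in `L` are the circle components
of the moduli spaces `M(a, c)`, `φ(c) = 1`, with framing value `0`. -/
def sqCochain (s : C.Pt → ZMod 2) (f : C.PreFraming) {φ : C.Ob → ZMod 2} (m : C.Matching φ)
    (o : m.Direction) : C.Ob → ZMod 2 := fun a =>
  ((Finset.univ.filter fun S : C.Circ =>
    C.circSrc S = a ∧ φ (C.circTgt S) = 1 ∧ f.circ S = 0).card : ZMod 2) +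
  ∑ K : m.Comp a, (1 + m.frameSum f K + m.dirCount o s K)

/-- `T` is the second Steenrod square of `(C, s, f)` in degree `k`: it sends the class of each cocycle
`φ` to the class of `sq^φ`, whatever matching and directions are used; in particular `sq^φ` is always
a cocycle. -/
def IsSecondSteenrodSquare (s : C.Pt → ZMod 2) (f : C.PreFraming) {k : ℤ}
    (T : C.H k →ₗ[ZMod 2] C.H (k + 2)) : Prop :=
  ∀ (φ : C.Ob → ZMod 2) (hφ : φ ∈ C.cocycles k) (m : C.Matching φ) (o : m.Direction),
    ∃ h : sqCochain s f m o ∈ C.cocycles (k + 2), T (H.mk φ hφ) = H.mk (sqCochain s f m o) h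

end OneFlowCat

/-! ### The cube -/

/-- The objects `{0,1}^n` of the cube category, with the componentwise order. -/
abbrev CubeVertex (n : ℕ) : Type := Fin n → Bool

/-- The grading `|u| = ∑ uᵢ`. -/
def CubeVertex.weight {n : ℕ} (u : CubeVertex n) : ℕ := ∑ i, (u i).toNat

/-- The `k`-dimensional sub-cubes `C_{u,v}`, recorded as the pairs `(u, v)` with `u ≥ v` and
`|u| - |v| = k`. -/
abbrev SubCube (n k : ℕ) : Type :=
  {q : CubeVertex n × CubeVertex n // q.2 ≤ q.1 ∧ q.1.weight = q.2.weight + k}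

theorem CubeVertex.weight_eq_add {n : ℕ} {u v : CubeVertex n} (h : v ≤ u) :
    u.weight = v.weight + (Finset.univ.filter fun i => v i ≠ u i).card := by
  unfold CubeVertex.weight
  rw [Finset.card_filter, ← Finset.sum_add_distrib]
  refine Finset.sum_congr rfl fun i _ => ?_
  have := h i
  revert this
  cases u i <;> cases v i <;> simp

/-- If `u ≥ w` and `|u| - |w| = 2`, there are exactly two vertices strictly between them. -/
theorem CubeVertex.exists_two_between {n : ℕ} {u w : CubeVertex n} (h : w ≤ u)
    (hk : u.weight = w.weight + 2) :
    ∃ v₁ v₂ : CubeVertex n, v₁ ≠ v₂ ∧ ∀ v : CubeVertex n,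
      ((v ≤ u ∧ u.weight = v.weight + 1) ∧ (w ≤ v ∧ v.weight = w.weight + 1)) ↔
        v = v₁ ∨ v = v₂ := by
  classical
  have hc : (Finset.univ.filter fun i => w i ≠ u i).card = 2 := by
    have := CubeVertex.weight_eq_add h; omega
  obtain ⟨i, j, hij, hD⟩ := Finset.card_eq_two.1 hc
  have hmem : ∀ l, w l ≠ u l ↔ l = i ∨ l = j := by
    intro l
    have := congrArg (fun s => l ∈ s) hD
    simpa using this
  have hval : ∀ l, (l = i ∨ l = j) → w l = false ∧ u l = true := by
    intro l hl
    have h1 := (hmem l).2 hl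
    have h2 := h l
    revert h1 h2
    cases w l <;> cases u l <;> simp
  have hsame : ∀ l, l ≠ i → l ≠ j → w l = u l := by
    intro l h1 h2
    by_contra h3
    rcases (hmem l).1 h3 with h4 | h4 <;> contradiction
  have key : ∀ a b : Fin n, (a = i ∧ b = j ∨ a = j ∧ b = i) →
      ((Function.update w a true ≤ u ∧ u.weight =
        CubeVertex.weight (Function.update w a true) + 1) ∧
      (w ≤ Function.update w a true ∧
        CubeVertex.weight (Function.update w a true) = w.weight + 1)) := by
    intro a b hab
    have ha : a = i ∨ a = j := by tauto
    have l1 : w ≤ Function.update w a true := by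
      intro l
      by_cases hl : l = a
      · subst hl; simp [Bool.le_true]
      · simp [hl]
    have l2 : Function.update w a true ≤ u := by
      intro l
      by_cases hl : l = a
      · subst hl; simp [(hval l ha).2]
      · simpa [Function.update_of_ne hl] using h l
    have w1 : CubeVertex.weight (Function.update w a true) = w.weight + 1 := by
      rw [CubeVertex.weight_eq_add l1]
      have : (Finset.univ.filter fun l => w l ≠ Function.update w a true l) = {a} := by
        ext l
        by_cases hl : l = a
        · subst hl; simp [(hval l ha).1]
        · simp [hl]
      simp only [this, Finset.card_singleton]
    exact ⟨⟨l2, by omega⟩, l1, w1⟩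
  refine ⟨Function.update w i true, Function.update w j true, ?_, ?_⟩
  · intro he
    have := congrFun he i
    rw [Function.update_self, Function.update_of_ne hij, (hval i (Or.inl rfl)).1] at this
    exact Bool.noConfusion this
  · intro v
    constructor
    · rintro ⟨⟨hvu, -⟩, hwv, hw⟩
      have hc1 : (Finset.univ.filter fun l => w l ≠ v l).card = 1 := by
        have := CubeVertex.weight_eq_add hwv; omega
      obtain ⟨a, ha⟩ := Finset.card_eq_one.1 hc1
      have hm : ∀ l, w l ≠ v l ↔ l = a := by
        intro l
        have := congrArg (fun s => l ∈ s) ha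
        simpa using this
      have hva : w a ≠ v a := (hm a).2 rfl
      have hta : w a = false ∧ v a = true := by
        have h2 := hwv a
        revert hva h2
        cases w a <;> cases v a <;> simp
      have hau : w a ≠ u a := by
        have h3 := hvu a
        rw [hta.2] at h3
        rw [hta.1]
        intro h4
        rw [← h4] at h3
        exact absurd (h3 rfl) Bool.false_ne_true
      have hv : v = Function.update w a true := by
        funext l
        by_cases hl : l = a
        · subst hl; simp [hta.2]
        · rw [Function.update_of_ne hl]
          by_contra h5
          exact hl ((hm l).1 (Ne.symm h5))
      rcases (hmem a).1 hau with h6 | h6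
      · left; rw [hv, h6]
      · right; rw [hv, h6]
    · rintro (rfl | rfl)
      · exact key i j (Or.inl ⟨rfl, rfl⟩)
      · exact key j i (Or.inr ⟨rfl, rfl⟩)

/-- The composite of two edges of the cube. -/
def SubCube.comp {n : ℕ} {u v w : CubeVertex n} (h₁ : v ≤ u ∧ u.weight = v.weight + 1)
    (h₂ : w ≤ v ∧ v.weight = w.weight + 1) : SubCube n 2 :=
  ⟨(u, w), h₂.1.trans h₁.1, by dsimp only; omega⟩

/-- The `n`-dimensional cube `1`-flow category. -/
def cubeFlow (n : ℕ) : OneFlowCat where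
  Ob := CubeVertex n
  Pt := SubCube n 1
  Itv := SubCube n 2
  Circ := Empty
  gr u := u.weight
  src e := e.1.1
  tgt e := e.1.2
  gr_src e := by have := e.2.2; push_cast [this]; ring
  itvSrc q := q.1.1
  itvTgt q := q.1.2
  gr_itvSrc q := by have := q.2.2; push_cast [this]; ring
  circSrc := Empty.elim
  circTgt := Empty.elim
  gr_circSrc S := S.elim
  bdry p := ⟨(p.1.2.1.1, p.1.1.1.2), by
    have h : p.1.2.1.2 = p.1.1.1.1 := p.2
    have h₁ := p.1.2.2
    have h₂ := p.1.1.2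
    rw [h] at h₁
    exact ⟨h₂.1.trans h₁.1, by dsimp only at h₁ h₂ ⊢; omega⟩⟩
  itvSrc_bdry _ := rfl
  itvTgt_bdry _ := rfl
  bdry_two := by
    rintro ⟨⟨u, w⟩, h, hk⟩
    obtain ⟨v₁, v₂, hne, hv⟩ := CubeVertex.exists_two_between h hk
    have h1 := (hv v₁).2 (Or.inl rfl)
    have h2 := (hv v₂).2 (Or.inr rfl)
    refine ⟨⟨(⟨(v₁, w), h1.2⟩, ⟨(u, v₁), h1.1⟩), rfl⟩,
      ⟨(⟨(v₂, w), h2.2⟩, ⟨(u, v₂), h2.1⟩), rfl⟩, ?_, ?_⟩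
    · intro he
      exact hne (congrArg (fun p => p.1.1.1.1) he)
    · rintro ⟨⟨⟨⟨v, w'⟩, hB⟩, ⟨⟨u', v'⟩, hA⟩⟩, hvv⟩
      change v' = v at hvv
      subst hvv
      constructor
      · intro he
        have e1 : u' = u := congrArg (fun q => q.1.1) he
        have e2 : w' = w := congrArg (fun q => q.1.2) he
        subst e1 e2
        rcases (hv v').1 ⟨hA, hB⟩ with rfl | rfl
        · exact Or.inl rfl
        · exact Or.inr rfl
      · rintro (he | he)
        · have e1 : u' = u := congrArg (fun p => p.1.2.1.1) he
          have e2 : w' = w := congrArg (fun p => p.1.1.1.2) he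
          subst e1 e2
          rfl
        · have e1 : u' = u := congrArg (fun p => p.1.2.1.1) he
          have e2 : w' = w := congrArg (fun p => p.1.1.1.2) he
          subst e1 e2
          rfl

/-! ### The signed Burnside category -/

/-- A signed correspondence between the finite sets `X` and `Y`. -/
structure SignedCorr (X Y : Type) where
  carrier : Type
  [finite_carrier : Finite carrier]
  src : carrier → X
  tgt : carrier → Y
  sign : carrier → ZMod 2

namespace SignedCorr

attribute [instance] finite_carrier

/-- The composition `B ∘ A = {(b, a) | t(a) = s(b)}`. -/
def comp {X Y Z : Type} (B : SignedCorr Y Z) (A : SignedCorr X Y) : SignedCorr X Z where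
  carrier := {p : B.carrier × A.carrier // A.tgt p.2 = B.src p.1}
  src p := A.src p.1.2
  tgt p := B.tgt p.1.1
  sign p := B.sign p.1.1 + A.sign p.1.2

/-- The identity correspondence. -/
protected def id (X : Type) [Finite X] : SignedCorr X X where
  carrier := X
  src := _root_.id
  tgt := _root_.id
  sign _ := 0

/-- A map of signed correspondences: a bijection that preserves source, target and sign. -/
structure Map {X Y : Type} (A B : SignedCorr X Y) where
  toEquiv : A.carrier ≃ B.carrier
  src_eq : ∀ x, B.src (toEquiv x) = A.src x
  tgt_eq : ∀ x, B.tgt (toEquiv x) = A.tgt x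
  sign_eq : ∀ x, B.sign (toEquiv x) = A.sign x

/-- The associator `((c, b), a) ↦ (c, (b, a))`, as a function. -/
def assoc {W X Y Z : Type} (C : SignedCorr Y Z) (B : SignedCorr X Y) (A : SignedCorr W X)
    (p : ((C.comp B).comp A).carrier) : (C.comp (B.comp A)).carrier :=
  ⟨(p.1.1.1.1, ⟨(p.1.1.1.2, p.1.2), p.2⟩), p.1.1.2⟩

/-- The function `f × id` on composites. -/
def Map.whiskerRight {X Y Z : Type} {B B' : SignedCorr Y Z} (f : Map B B') (A : SignedCorr X Y)
    (p : (B.comp A).carrier) : (B'.comp A).carrier :=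
  ⟨(f.toEquiv p.1.1, p.1.2), p.2.trans (f.src_eq _).symm⟩

/-- The function `id × f` on composites. -/
def Map.whiskerLeft {X Y Z : Type} (B : SignedCorr Y Z) {A A' : SignedCorr X Y} (f : Map A A')
    (p : (B.comp A).carrier) : (B.comp A').carrier :=
  ⟨(p.1.1, f.toEquiv p.1.2), (f.tgt_eq _).trans p.2⟩

end SignedCorr

/-- A strictly unitary `2`-functor from the cube category `2^n` to the signed Burnside category:
finite sets `F_u`; signed correspondences `F_{u,v}` for `u ≥ v`, with `F_{u,u}` the identity; and maps
`F_{u,v,w} : F_{v,w} ∘ F_{u,v} → F_{u,w}` for `u ≥ v ≥ w`, which are the unitors if `v = w` or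
`u = v`, and are compatible with the associator for `u ≥ v ≥ w ≥ x`. -/
structure SignedCubeFunctor (n : ℕ) where
  obj : CubeVertex n → Type
  [finite_obj : ∀ u, Finite (obj u)]
  hom : ∀ {u v : CubeVertex n}, v ≤ u → SignedCorr (obj u) (obj v)
  hom_refl : ∀ u, hom (le_refl u) = SignedCorr.id (obj u)
  map : ∀ {u v w : CubeVertex n} (h₁ : v ≤ u) (h₂ : w ≤ v),
    SignedCorr.Map ((hom h₂).comp (hom h₁)) (hom (h₂.trans h₁))
  map_left_unitor : ∀ {u v : CubeVertex n} (h : v ≤ u)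
    (p : ((hom (le_refl v)).comp (hom h)).carrier), (map h (le_refl v)).toEquiv p = p.1.2
  map_right_unitor : ∀ {u v : CubeVertex n} (h : v ≤ u)
    (p : ((hom h).comp (hom (le_refl u))).carrier), (map (le_refl u) h).toEquiv p = p.1.1
  map_assoc : ∀ {u v w x : CubeVertex n} (h₁ : v ≤ u) (h₂ : w ≤ v) (h₃ : x ≤ w)
    (p : (((hom h₃).comp (hom h₂)).comp (hom h₁)).carrier),
    (map h₁ (h₃.trans h₂)).toEquiv ((map h₂ h₃).whiskerRight (hom h₁) p) =
      (map (h₂.trans h₁) h₃).toEquiv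
        ((map h₁ h₂).whiskerLeft (hom h₃) (SignedCorr.assoc _ _ _ p))

/-- The change of a frame assignment under a change of the sign assignment on a square
`u ≥ v₁, v₂ ≥ w`: the signs of the edges `C_{v₁,w}`, `C_{v₂,w}`, `C_{u,v₂}`, `C_{u,v₁}` change from
`a, b, c, d` to `a', b', c', d'`. As `a + b + c + d = 1 = a' + b' + c' + d'` for sign assignments, an
even number of signs is changed, so that the eight listed cases are the only ones. -/
def frameChange (δ ε a b c d a' b' c' d' : ZMod 2) : ZMod 2 :=
  if a = a' ∧ b = b' ∧ c = c' ∧ d = d' then 0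
  else if a ≠ a' ∧ b ≠ b' ∧ c = c' ∧ d = d' then 1
  else if a = a' ∧ b = b' ∧ c ≠ c' ∧ d ≠ d' then c + d
  else if a ≠ a' ∧ b = b' ∧ c = c' ∧ d ≠ d' then δ + a
  else if a = a' ∧ b ≠ b' ∧ c ≠ c' ∧ d = d' then δ + b
  else if a ≠ a' ∧ b = b' ∧ c ≠ c' ∧ d = d' then δ + ε + b
  else if a = a' ∧ b ≠ b' ∧ c = c' ∧ d ≠ d' then δ + ε + a
  else if a ≠ a' ∧ b ≠ b' ∧ c ≠ c' ∧ d ≠ d' then a + b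
  else 0

/-- The formula does not depend on which of the two middle vertices is called `v₁`. -/
theorem frameChange_symm (δ ε a b c d a' b' c' d' : ZMod 2) :
    frameChange δ ε a b c d a' b' c' d' = frameChange δ ε b a d c b' a' d' c' := by
  unfold frameChange
  have h1 : c + d = d + c := add_comm _ _
  have h2 : a + b = b + a := add_comm _ _
  by_cases e1 : a = a' <;> by_cases e2 : b = b' <;> by_cases e3 : c = c' <;>
    by_cases e4 : d = d' <;> simp [e1, e2, e3, e4, add_comm]

namespace SignedCubeFunctor

attribute [instance] finite_obj

variable {n : ℕ} (F : SignedCubeFunctor n)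

/-- The points over the edges of the cube: the elements of all `F_{u,v}` with `|u| - |v| = 1`. -/
abbrev FlowPt : Type := Σ e : SubCube n 1, (F.hom e.2.1).carrier

/-- The elements of all `F_{u,w}` with `|u| - |w| = 2`. -/
abbrev FlowItv : Type := Σ q : SubCube n 2, (F.hom q.2.1).carrier

def FlowPt.src {F : SignedCubeFunctor n} (P : F.FlowPt) : Σ u, F.obj u :=
  ⟨P.1.1.1, (F.hom P.1.2.1).src P.2⟩

def FlowPt.tgt {F : SignedCubeFunctor n} (P : F.FlowPt) : Σ u, F.obj u :=
  ⟨P.1.1.2, (F.hom P.1.2.1).tgt P.2⟩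

/-- A composable pair `(B, A)` with `A ∈ F_{u,v}` and `B ∈ F_{v,w}` is sent to
`F_{u,v,w}(B, A) ∈ F_{u,w}`, see `flowBdry_mk`. -/
def flowBdry : {p : F.FlowPt × F.FlowPt // p.2.tgt = p.1.src} → F.FlowItv
  | ⟨(⟨⟨(v', w), hB⟩, B⟩, ⟨⟨(u, v), hA⟩, A⟩), h⟩ =>
    have hv : v = v' := congrArg Sigma.fst h
    ⟨⟨(u, w), (hB.1.trans hv.ge).trans hA.1, by
        have h₁ := hA.2
        have h₂ := hB.2
        subst hv
        dsimp only at h₁ h₂ ⊢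
        omega⟩,
      (F.map hA.1 (hB.1.trans hv.ge)).toEquiv (by
        subst hv
        exact ⟨(B, A), eq_of_heq (Sigma.mk.inj h).2⟩)⟩

theorem flowBdry_mk {u v w : CubeVertex n} (hA : v ≤ u ∧ u.weight = v.weight + 1)
    (hB : w ≤ v ∧ v.weight = w.weight + 1) (A : (F.hom hA.1).carrier) (B : (F.hom hB.1).carrier)
    (h : (F.hom hA.1).tgt A = (F.hom hB.1).src B) :
    F.flowBdry ⟨(⟨⟨(v, w), hB⟩, B⟩, ⟨⟨(u, v), hA⟩, A⟩), Sigma.ext rfl (heq_of_eq h)⟩ =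
      ⟨SubCube.comp hA hB, (F.map hA.1 hB.1).toEquiv ⟨(B, A), h⟩⟩ := rfl

/-- The `1`-flow category `C_F`. Its objects are the elements of all `F_u`, the points of `M(a, b)`
with `a ∈ F_u`, `b ∈ F_v`, `|u| - |v| = 1`, are the elements of `F_{u,v}` over `a` and `b`, and the
components of `M(a, c)` with `a ∈ F_u`, `c ∈ F_w`, `|u| - |w| = 2`, are intervals, one for each
element of `F_{u,w}` over `a` and `c`. -/
def flow : OneFlowCat where
  Ob := Σ u, F.obj u
  Pt := F.FlowPt
  Itv := F.FlowItv
  Circ := Empty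
  gr x := x.1.weight
  src := FlowPt.src
  tgt := FlowPt.tgt
  gr_src P := by have := P.1.2.2; simp only [FlowPt.src, FlowPt.tgt]; push_cast [this]; ring
  itvSrc X := ⟨X.1.1.1, (F.hom X.1.2.1).src X.2⟩
  itvTgt X := ⟨X.1.1.2, (F.hom X.1.2.1).tgt X.2⟩
  gr_itvSrc X := by have := X.1.2.2; push_cast [this]; ring
  circSrc := Empty.elim
  circTgt := Empty.elim
  gr_circSrc S := S.elim
  bdry := F.flowBdry
  itvSrc_bdry := by
    rintro ⟨⟨⟨⟨⟨v', w⟩, hB⟩, B⟩, ⟨⟨⟨u, v⟩, hA⟩, A⟩⟩, h⟩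
    obtain rfl : v = v' := congrArg Sigma.fst h
    have h' := eq_of_heq (Sigma.mk.inj h).2
    exact congrArg (Sigma.mk u) ((F.map hA.1 hB.1).src_eq ⟨(B, A), h'⟩)
  itvTgt_bdry := by
    rintro ⟨⟨⟨⟨⟨v', w⟩, hB⟩, B⟩, ⟨⟨⟨u, v⟩, hA⟩, A⟩⟩, h⟩
    obtain rfl : v = v' := congrArg Sigma.fst h
    have h' := eq_of_heq (Sigma.mk.inj h).2
    exact congrArg (Sigma.mk w) ((F.map hA.1 hB.1).tgt_eq ⟨(B, A), h'⟩)
  bdry_two := by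
    rintro ⟨⟨⟨u, w⟩, hle, hk⟩, X⟩
    obtain ⟨v₁, v₂, hne, hv⟩ := CubeVertex.exists_two_between hle hk
    have ex : ∀ v, (h : (v ≤ u ∧ u.weight = v.weight + 1) ∧ (w ≤ v ∧ v.weight = w.weight + 1)) →
        ∃ p : {p : F.FlowPt × F.FlowPt // p.2.tgt = p.1.src}, p.1.1.1.1.1 = v ∧
          ∀ r, r.1.1.1.1.1 = v →
            (F.flowBdry r = ⟨⟨(u, w), hle, hk⟩, X⟩ ↔ r = p) := by
      intro v h
      obtain ⟨⟨⟨B, A⟩, hBA⟩, hX⟩ := (F.map h.1.1 h.2.1).toEquiv.surjective X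
      refine ⟨⟨(⟨⟨(v, w), h.2⟩, B⟩, ⟨⟨(u, v), h.1⟩, A⟩), Sigma.ext rfl (heq_of_eq hBA)⟩, rfl, ?_⟩
      rintro ⟨⟨⟨⟨⟨v', w'⟩, hB'⟩, B'⟩, ⟨⟨⟨u', v''⟩, hA'⟩, A'⟩⟩, h'⟩ hv'
      obtain rfl : v'' = v' := congrArg Sigma.fst h'
      change v'' = v at hv'
      subst hv'
      have h2 := eq_of_heq (Sigma.mk.inj h').2
      constructor
      · intro he
        have he' : (⟨SubCube.comp hA' hB', (F.map hA'.1 hB'.1).toEquiv ⟨(B', A'), h2⟩⟩ :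
          F.FlowItv) = ⟨⟨(u, w), hle, hk⟩, X⟩ := he
        obtain rfl : u' = u := congrArg (fun q : F.FlowItv => q.1.1.1) he'
        obtain rfl : w' = w := congrArg (fun q : F.FlowItv => q.1.1.2) he'
        have h3 := eq_of_heq (Sigma.mk.inj he').2
        have h4 := (F.map hA'.1 hB'.1).toEquiv.injective (h3.trans hX.symm)
        have h5 := congrArg Subtype.val h4
        obtain ⟨rfl, rfl⟩ := Prod.mk.inj h5
        rfl
      · intro he
        rw [he]
        exact Sigma.ext rfl (heq_of_eq hX)
    obtain ⟨p₁, hp₁, h₁⟩ := ex v₁ ((hv v₁).2 (Or.inl rfl))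
    obtain ⟨p₂, hp₂, h₂⟩ := ex v₂ ((hv v₂).2 (Or.inr rfl))
    refine ⟨p₁, p₂, ?_, ?_⟩
    · rintro rfl
      exact hne (hp₁.symm.trans hp₂)
    · intro r
      constructor
      · intro hr
        have hmid : r.1.1.1.1.1 = v₁ ∨ r.1.1.1.1.1 = v₂ := by
          obtain ⟨⟨⟨⟨⟨v', w'⟩, hB'⟩, B'⟩, ⟨⟨⟨u', v''⟩, hA'⟩, A'⟩⟩, h'⟩ := r
          obtain rfl : v'' = v' := congrArg Sigma.fst h'
          obtain rfl : u' = u := congrArg (fun q : F.FlowItv => q.1.1.1) hr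
          obtain rfl : w' = w := congrArg (fun q : F.FlowItv => q.1.1.2) hr
          exact (hv v'').1 ⟨hA', hB'⟩
        rcases hmid with hm | hm
        · exact Or.inl ((h₁ r hm).1 hr)
        · exact Or.inr ((h₂ r hm).1 hr)
      · rintro (rfl | rfl)
        · exact (h₁ _ hp₁).2 rfl
        · exact (h₂ _ hp₂).2 rfl

/-- The edge of the cube over which a point of `C_F` lies. -/
def flowEdge (P : F.flow.Pt) : (cubeFlow n).Pt := Sigma.fst (show F.FlowPt from P)

/-- The square of the cube over which an interval of `C_F` lies. -/
def flowSquare (X : F.flow.Itv) : (cubeFlow n).Itv := Sigma.fst (show F.FlowItv from X)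

/-- The sign `σ(P)` of an element `P` of `F_{u,v}`. -/
def corrSign (P : F.FlowPt) : ZMod 2 := (F.hom P.1.2.1).sign P.2

/-- The sign assignment `s_F(P) = s(C_{u,v}) + σ(P)` for `P ∈ F_{u,v}`. -/
def flowSign (s : (cubeFlow n).Pt → ZMod 2) (P : F.flow.Pt) : ZMod 2 :=
  s (F.flowEdge P) + F.corrSign P

/-- The value of `frameChange` on the square with `C_{v₁,w}`, `C_{v₂,w}`, `C_{u,v₂}`, `C_{u,v₁}`
below `B₁`, `B₂`, `A₂`, `A₁`, where `p = (B₁, A₁)` and `q = (B₂, A₂)`, when the signs change from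
those given by `s` to those given by `s_F`. -/
def pairChange (δ ε : ZMod 2) (s : (cubeFlow n).Pt → ZMod 2) (p q : F.flow.Pair) : ZMod 2 :=
  frameChange δ ε
    (s (F.flowEdge p.1.1)) (s (F.flowEdge q.1.1)) (s (F.flowEdge q.1.2)) (s (F.flowEdge p.1.2))
    (F.flowSign s p.1.1) (F.flowSign s q.1.1) (F.flowSign s q.1.2) (F.flowSign s p.1.2)

/-- One of the two boundary points of an interval. -/
def end₁ (X : F.flow.Itv) : F.flow.Pair := (F.flow.bdry_two X).choose

/-- The other boundary point of an interval. -/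
def end₂ (X : F.flow.Itv) : F.flow.Pair := (F.flow.bdry_two X).choose_spec.choose

/-- The framing `f_F` of `C_F`: the framing value of an interval over the square `C_{u,w}` is
obtained from `f(C_{u,w})` by `frameChange`. The order of the boundary points does not matter, see
`flowFrame_eq`. -/
def flowFrame (δ ε : ZMod 2) (s : (cubeFlow n).Pt → ZMod 2) (f : (cubeFlow n).PreFraming) :
    F.flow.PreFraming where
  itv X := f.itv (F.flowSquare X) + F.pairChange δ ε s (F.end₁ X) (F.end₂ X)
  circ := Empty.elim

theorem flowFrame_eq (δ ε : ZMod 2) (s : (cubeFlow n).Pt → ZMod 2) (f : (cubeFlow n).PreFraming)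
    (X : F.flow.Itv) (p q : F.flow.Pair) (hpq : p ≠ q) (hp : F.flow.bdry p = X)
    (hq : F.flow.bdry q = X) :
    (F.flowFrame δ ε s f).itv X = f.itv (F.flowSquare X) + F.pairChange δ ε s p q := by
  have h : ∀ r, F.flow.bdry r = X ↔ r = F.end₁ X ∨ r = F.end₂ X :=
    (F.flow.bdry_two X).choose_spec.choose_spec.2
  have hdef : (F.flowFrame δ ε s f).itv X =
      f.itv (F.flowSquare X) + F.pairChange δ ε s (F.end₁ X) (F.end₂ X) := rfl
  rw [hdef]
  rcases (h p).1 hp with h1 | h1 <;> rcases (h q).1 hq with h2 | h2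
  · exact absurd (h1.trans h2.symm) hpq
  · rw [h1, h2]
  · rw [h1, h2]
    exact congrArg _ (frameChange_symm _ _ _ _ _ _ _ _ _ _)
  · exact absurd (h1.trans h2.symm) hpq

/-- The cohomology group `H^i(F; ℤ/2)`. -/
abbrev H (i : ℤ) : Type := F.flow.H i

/-- `T` is the operation `Sq²_ε` on `H^i(F; ℤ/2)`: whatever sign assignment `s` and frame assignment
`f` of the cube, and whatever `δ`, are used to frame `C_F`, the second Steenrod square of
`(C_F, s_F, f_F)` is `T`. -/
def IsSqTwo (ε : ZMod 2) {i : ℤ} (T : F.H i →ₗ[ZMod 2] F.H (i + 2)) : Prop :=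
  ∀ (s : (cubeFlow n).Pt → ZMod 2) (f : (cubeFlow n).PreFraming), (cubeFlow n).IsFramed s f →
    ∀ δ : ZMod 2,
      OneFlowCat.IsSecondSteenrodSquare (F.flowSign s) (F.flowFrame δ ε s f) T

end SignedCubeFunctor

end

/-! The only non-local ingredient of the statement is the number of circles, in `Γ(a, φ)` and in
`∂M(a, d)`. It becomes a quadratic expression through parities of permutations. Let two fixed point
free involutions on a finite set share a two-colouring. List the points edge by edge for each
involution, every edge starting at the same colour; mod 2 the number of circles is read off from the
relative parity of these two lists (`IsPairing.card_components`). For tournaments χ, χ' the relative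
parity is Σ χχ' + Σ χ, and it is additive along an intermediate tournament (`tourPair_triangle`).
Inserting the lexicographic order of the corners between the two lists separates the contributions
of the two families of edges.

For `Γ(a, φ)` this gives `sqCochain_eq`: up to a coboundary, sq^φ is the value of a form `sqForm`,
which knows nothing of matchings and directions, at the lift of φ to {0,1}. The form lives on
integral cochains, because binomial coefficients occur in it. It is additive up to coboundaries
(`sqForm_add`), it is a coboundary on even cochains 2μ (`sqForm_two_mul`), and it is a coboundary on
the unreduced coboundary `totOf φ` of any mod 2 cochain (`sqForm_totOf`). The last identity is the
framing condition, summed over all d with φ(d) = 1, with its circles counted by the same device. If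
φ is a cocycle, `totOf φ` is even, and the last two identities compared say that the representative
is a cocycle. Additivity and vanishing on coboundaries follow from (x + y mod 2) + 2xy = x + y and
from `totOf ψ` = δψ + 2(...).

That C_F is framed has two sources. The boundaries ∂M(a, d) of C_F are disjoint copies of those of
the cube, so a framing of the cube pulls back (`isFramed_pull`). The table defining `frameChange` is
a polynomial, a sum of one term per corner (`frameChange_add`), and framings may be twisted along a
closed change of signs by terms of this shape (`IsFramed.twist`).

For the independence of the choices, the cube is acyclic, so any two framings of it differ by a
function t of the vertices and a function g of the edges (`CubeFlow.exists_gauge`). Such a change,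
and a change of δ, alters the representing cochain by a coboundary (`sqRep_gauge`). The parameter ε
survives as (1 + ε) times the square of the operation φ ↦ Σ σ(A) φ(t(A)) (`sqRep_flow`).

The examples are functors on the square with one object over each vertex and two arrows over each
edge. All mod 2 coboundaries vanish there, so it suffices to compare values of cochains at the top:
turning on a sign changes the value by 1, and a twisted composition law makes the ε-term equal to 1.
-/

noncomputable section

/-! ### Tournaments with values in `ℤ/2` -/

section Tournament

open scoped Classical

/-- A tournament on `V`: a `ℤ/2`-valued relation which holds for exactly one of `(x, y)`, `(y, x)`
if `x ≠ y`. -/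
structure IsTour {V : Type} (χ : V → V → ZMod 2) : Prop where
  self : ∀ x, χ x x = 0
  swap : ∀ x y, x ≠ y → χ x y + χ y x = 1

theorem ZMod.two_cases (a : ZMod 2) : a = 0 ∨ a = 1 := by
  revert a; decide

theorem ZMod.two_mul_self (a : ZMod 2) : a * a = a := by
  revert a; decide

theorem exists_isTour (V : Type) : ∃ χ : V → V → ZMod 2, IsTour χ := by
  let _ : LinearOrder V := linearOrderOfSTO WellOrderingRel
  refine ⟨fun x y => if x < y then 1 else 0, fun x => by simp, fun x y h => ?_⟩
  rcases lt_or_gt_of_ne h with h | h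
  · simp [h, h.not_gt]
  · simp [h, h.not_gt]

/-- The difference of two tournaments is symmetric with zero diagonal, so its sum over all pairs
vanishes mod 2. All comparisons of tournaments below rest on this. -/
theorem IsTour.add_symm {V : Type} {χ χ' : V → V → ZMod 2} (h : IsTour χ) (h' : IsTour χ') (x y : V) :
    χ x y + χ' x y = χ y x + χ' y x := by
  by_cases hxy : x = y
  · rw [hxy]
  · have h1 := h.swap x y hxy
    have h2 := h'.swap x y hxy
    grind

theorem IsTour.comp {V W : Type} {χ : V → V → ZMod 2} (h : IsTour χ) {g : W → V}
    (hg : Function.Injective g) : IsTour fun x y => χ (g x) (g y) :=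
  ⟨fun _ => h.self _, fun _ _ hxy => h.swap _ _ (hg.ne hxy)⟩

variable {V : Type} [Fintype V]

theorem sum_symm_eq_zero (u : V → V → ZMod 2) (h0 : ∀ x, u x x = 0)
    (hs : ∀ x y, u x y = u y x) : ∑ x, ∑ y, u x y = 0 := by
  rw [← Fintype.sum_prod_type']
  refine Finset.sum_involution (fun p _ => (p.2, p.1)) ?_ ?_ (by simp) (by simp)
  · rintro ⟨x, y⟩ -
    dsimp only
    rw [hs x y]; exact CharTwo.add_self_eq_zero _
  · rintro ⟨x, y⟩ - h1 h2
    obtain rfl : y = x := (Prod.mk.inj h2).1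
    exact h1 (h0 _)

/-- The pairing of two tournaments. -/
def tourPair (χ χ' : V → V → ZMod 2) : ZMod 2 := ∑ x, ∑ y, χ x y * χ' x y

theorem tourPair_comm (χ χ' : V → V → ZMod 2) : tourPair χ χ' = tourPair χ' χ :=
  Finset.sum_congr rfl fun _ _ => Finset.sum_congr rfl fun _ _ => mul_comm _ _

theorem tourPair_self (χ : V → V → ZMod 2) : tourPair χ χ = ∑ x, ∑ y, χ x y :=
  Finset.sum_congr rfl fun _ _ => Finset.sum_congr rfl fun _ _ => ZMod.two_mul_self _

theorem IsTour.sum_eq {χ χ' : V → V → ZMod 2} (h : IsTour χ) (h' : IsTour χ') :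
    ∑ x, ∑ y, χ x y = ∑ x, ∑ y, χ' x y := by
  have := sum_symm_eq_zero (fun x y => χ x y + χ' x y) (fun x => by simp [h.self, h'.self])
    (h.add_symm h')
  simp only [Finset.sum_add_distrib] at this
  exact CharTwo.add_eq_zero.1 this

/-- The product (χ₁ + χ₂)(χ₂ + χ₃) is symmetric with zero diagonal, so it sums to zero; expand it.
In other words the relative parity Σ χχ' + Σ χ is additive, which allows an intermediate order to be
inserted. -/
theorem tourPair_triangle {χ₁ χ₂ χ₃ : V → V → ZMod 2} (h₁ : IsTour χ₁) (h₂ : IsTour χ₂)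
    (h₃ : IsTour χ₃) :
    tourPair χ₁ χ₃ = tourPair χ₁ χ₂ + tourPair χ₂ χ₃ + ∑ x, ∑ y, χ₂ x y := by
  have := sum_symm_eq_zero (fun x y => (χ₁ x y + χ₂ x y) * (χ₂ x y + χ₃ x y))
    (fun x => by simp [h₁.self, h₂.self])
    (fun x y => by rw [h₁.add_symm h₂, h₂.add_symm h₃])
  simp only [add_mul, mul_add, Finset.sum_add_distrib, ZMod.two_mul_self] at this
  simp only [tourPair]
  grind

/-- The transposition only affects pairs that meet {a, b}. The contributions of a third point x
cancel, since χ(x, a) and χ(a, x) add up to 1, and what remains is χ(a, b) + χ(b, a). -/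
theorem tourPair_swap {χ : V → V → ZMod 2} (h : IsTour χ) {a b : V} (hab : a ≠ b) :
    tourPair χ (fun x y => χ (Equiv.swap a b x) (Equiv.swap a b y)) + ∑ x, ∑ y, χ x y = 1 := by
  set S := (Finset.univ.erase a).erase b with hS
  have hsum : ∀ G : V → ZMod 2, ∑ x, G x = G a + (G b + ∑ x ∈ S, G x) := by
    intro G
    rw [← Finset.add_sum_erase _ G (Finset.mem_univ a), ← Finset.add_sum_erase _ G
      (Finset.mem_erase.2 ⟨hab.symm, Finset.mem_univ b⟩)]
  have hmem : ∀ x ∈ S, x ≠ a ∧ x ≠ b := by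
    intro x hx; simp [hS] at hx; tauto
  have e : tourPair χ (fun x y => χ (Equiv.swap a b x) (Equiv.swap a b y)) + ∑ x, ∑ y, χ x y =
      ∑ x, ∑ y, χ x y * (χ (Equiv.swap a b x) (Equiv.swap a b y) + χ x y) := by
    simp only [tourPair, mul_add, Finset.sum_add_distrib, ZMod.two_mul_self]
  rw [e, hsum]
  simp only [hsum, Equiv.swap_apply_left, Equiv.swap_apply_right, h.self]
  have h0 : ∑ x ∈ S, ∑ y ∈ S, χ x y * (χ (Equiv.swap a b x) (Equiv.swap a b y) + χ x y) = 0 := by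
    refine Finset.sum_eq_zero fun x hx => Finset.sum_eq_zero fun y hy => ?_
    rw [Equiv.swap_apply_of_ne_of_ne (hmem x hx).1 (hmem x hx).2,
      Equiv.swap_apply_of_ne_of_ne (hmem y hy).1 (hmem y hy).2, CharTwo.add_self_eq_zero, mul_zero]
  simp only [Finset.sum_add_distrib, h0]
  have h1 : ∑ y ∈ S, χ a y * (χ b (Equiv.swap a b y) + χ a y) +
      ∑ y ∈ S, χ b y * (χ a (Equiv.swap a b y) + χ b y) +
      ∑ x ∈ S, χ x a * (χ (Equiv.swap a b x) b + χ x a) +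
      ∑ x ∈ S, χ x b * (χ (Equiv.swap a b x) a + χ x b) = 0 := by
    simp only [← Finset.sum_add_distrib]
    refine Finset.sum_eq_zero fun x hx => ?_
    rw [Equiv.swap_apply_of_ne_of_ne (hmem x hx).1 (hmem x hx).2]
    have := h.swap x a (hmem x hx).1
    have := h.swap x b (hmem x hx).2
    have := ZMod.two_mul_self (χ x a)
    have := ZMod.two_mul_self (χ x b)
    grind
  have h2 := h.swap a b hab
  have := ZMod.two_mul_self (χ a b)
  grind

/-- The isomorphism from `ℤˣ` to the additive group `ℤ/2`. -/
def unitsParity (u : ℤˣ) : ZMod 2 := if u = 1 then 0 else 1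

theorem unitsParity_neg_one_mul (u : ℤˣ) : unitsParity (-1 * u) = 1 + unitsParity u := by
  rcases Int.units_eq_one_or u with rfl | rfl <;> simp [unitsParity]; decide

theorem unitsParity_pow (n : ℕ) : unitsParity ((-1) ^ n) = n := by
  induction n with
  | zero => simp [unitsParity]
  | succ n ih => rw [pow_succ', unitsParity_neg_one_mul, ih]; push_cast; ring

/-- Induction over transpositions: by the triangle identity both sides change by 1 with each of
them. -/
theorem tourPair_perm {χ : V → V → ZMod 2} (h : IsTour χ) (g : Equiv.Perm V) :
    tourPair χ (fun x y => χ (g x) (g y)) + ∑ x, ∑ y, χ x y =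
      unitsParity (Equiv.Perm.sign g) := by
  induction g using Equiv.Perm.swap_induction_on with
  | one =>
    have : tourPair χ (fun x y => χ x y) = ∑ x, ∑ y, χ x y := tourPair_self χ
    simp [this, unitsParity, CharTwo.add_self_eq_zero]
  | swap_mul f a b hab ih =>
    have e1 : tourPair (fun x y => χ (f x) (f y))
        (fun x y => χ (Equiv.swap a b (f x)) (Equiv.swap a b (f y))) =
        tourPair χ (fun x y => χ (Equiv.swap a b x) (Equiv.swap a b y)) := by
      simp only [tourPair]
      rw [← Equiv.sum_comp f (fun x => ∑ y, χ x y * χ (Equiv.swap a b x) (Equiv.swap a b y))]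
      exact Finset.sum_congr rfl fun x _ => Equiv.sum_comp f fun y =>
        χ (f x) y * χ (Equiv.swap a b (f x)) (Equiv.swap a b y)
    have e2 := tourPair_triangle h (h.comp f.injective)
      (h.comp ((Equiv.swap a b).injective.comp f.injective))
    have e3 := tourPair_swap h hab
    have e4 := (h.comp f.injective).sum_eq h
    rw [Equiv.Perm.sign_mul, Equiv.Perm.sign_swap hab, unitsParity_neg_one_mul, ← ih]
    simp only [Equiv.Perm.mul_apply, Function.comp] at e2 ⊢
    rw [e2, e1]
    grind

instance (g : Equiv.Perm V) : Fintype (Quotient (Equiv.Perm.SameCycle.setoid g)) :=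
  Fintype.ofFinite _

/-- The parity of a permutation is the number of its non-trivial cycles plus the number of points
in them. -/
theorem card_orbits (g : Equiv.Perm V) :
    (Fintype.card (Quotient (Equiv.Perm.SameCycle.setoid g)) : ZMod 2) =
      Fintype.card V + unitsParity (Equiv.Perm.sign g) := by
  -- An orbit is encoded by its point if it is trivial and by its cycle factor otherwise, so that
  -- the count can be compared with the cycle type, from which the sign is known.
  let F : Quotient (Equiv.Perm.SameCycle.setoid g) → V ⊕ Equiv.Perm V := fun q =>
    if g q.out = q.out then Sum.inl q.out else Sum.inr (g.cycleOf q.out)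
  have hout : ∀ v : V, g.SameCycle (Quotient.mk (Equiv.Perm.SameCycle.setoid g) v).out v :=
    fun v => Quotient.exact (s := Equiv.Perm.SameCycle.setoid g) (Quotient.out_eq _)
  have hF : Function.Injective F := by
    intro q q' h
    rw [← Quotient.out_eq q, ← Quotient.out_eq q']
    apply Quotient.sound
    change g.SameCycle _ _
    by_cases h1 : g q.out = q.out <;> by_cases h2 : g q'.out = q'.out <;> simp [F, h1, h2] at h
    · rw [h]
    · have : q.out ∈ (g.cycleOf q'.out).support := by
        rw [← h, Equiv.Perm.mem_support_cycleOf_iff]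
        exact ⟨.refl _ _, Equiv.Perm.mem_support.2 h1⟩
      exact (Equiv.Perm.mem_support_cycleOf_iff.1 this).1.symm
  have himg : (Finset.univ.image F) =
      (Finset.univ.filter fun v => g v = v).disjSum g.cycleFactorsFinset := by
    ext z
    rcases z with v | c
    · simp only [Finset.mem_image, Finset.mem_univ, true_and, Finset.inl_mem_disjSum,
        Finset.mem_filter]
      constructor
      · rintro ⟨q, hq⟩
        by_cases h1 : g q.out = q.out <;> simp [F, h1] at hq
        exact hq ▸ h1
      · intro hv
        have h2 : (Quotient.mk (Equiv.Perm.SameCycle.setoid g) v).out = v :=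
          (((hout v).symm).eq_of_left hv).symm
        refine ⟨Quotient.mk _ v, ?_⟩
        simp only [F, h2, hv, if_true]
    · simp only [Finset.mem_image, Finset.mem_univ, true_and, Finset.inr_mem_disjSum]
      constructor
      · rintro ⟨q, hq⟩
        by_cases h1 : g q.out = q.out <;> simp [F, h1] at hq
        rw [← hq, Equiv.Perm.cycleOf_mem_cycleFactorsFinset_iff]
        exact Equiv.Perm.mem_support.2 h1
      · intro hc
        obtain ⟨v, hv⟩ := (Equiv.Perm.mem_cycleFactorsFinset_iff.1 hc).1.nonempty_support
        have h3 := Equiv.Perm.cycle_is_cycleOf hv hc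
        have h4 : g v ≠ v := Equiv.Perm.mem_support.1
          (Equiv.Perm.mem_cycleFactorsFinset_support_le hc hv)
        refine ⟨Quotient.mk _ v, ?_⟩
        have h5 : g (Quotient.mk (Equiv.Perm.SameCycle.setoid g) v).out ≠
            (Quotient.mk (Equiv.Perm.SameCycle.setoid g) v).out := by
          intro h
          have := (hout v).eq_of_left h
          rw [this] at h
          exact h4 h
        simp only [F, h5, if_false]
        rw [(hout v).cycleOf_eq, h3]
  have hcard : Fintype.card (Quotient (Equiv.Perm.SameCycle.setoid g)) =
      (Finset.univ.filter fun v => g v = v).card + g.cycleFactorsFinset.card := by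
    rw [← Finset.card_disjSum, ← himg, Finset.card_image_of_injective _ hF, Finset.card_univ]
  have hc2 : (Finset.univ.filter fun v => g v = v).card + g.support.card = Fintype.card V := by
    rw [← Finset.card_univ,
      ← Finset.card_filter_add_card_filter_not (s := Finset.univ) (fun v => g v = v)]
    rfl
  rw [Equiv.Perm.sign_of_cycleType, unitsParity_pow, Equiv.Perm.sum_cycleType,
    Equiv.Perm.cycleType_def, Multiset.card_map, hcard, ← hc2]
  push_cast
  have : g.cycleFactorsFinset.val.card = g.cycleFactorsFinset.card := rfl
  rw [this]
  grind

end Tournament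

end

noncomputable section

/-! ### Pairings and components of unions of two pairings -/

section Pairing

open scoped Classical

/-- The fibres of `e` have exactly two elements, and `o` takes different values on them. -/
structure IsPairing {V E : Type} (e : V → E) (o : V → ZMod 2) : Prop where
  exists_ne : ∀ v, ∃ w, w ≠ v ∧ e w = e v
  flip : ∀ v w, v ≠ w → e v = e w → o v + o w = 1

/-- The relation which orders first by `e` and then by `κ`. -/
def lexTour {V E : Type} (e : V → E) (ρ : E → E → ZMod 2) (κ : V → V → ZMod 2) :
    V → V → ZMod 2 :=
  fun x y => if e x = e y then κ x y else ρ (e x) (e y)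

theorem IsTour.lexTour {V E : Type} {e : V → E} {ρ : E → E → ZMod 2} {κ : V → V → ZMod 2}
    (hρ : IsTour ρ) (h0 : ∀ x, κ x x = 0) (hκ : ∀ x y, x ≠ y → e x = e y → κ x y + κ y x = 1) :
    IsTour (lexTour e ρ κ) := by
  refine ⟨fun x => by simp [_root_.lexTour, h0], fun x y hxy => ?_⟩
  by_cases h : e x = e y
  · simp [_root_.lexTour, h, hκ x y hxy h]
  · simp [_root_.lexTour, h, Ne.symm h, hρ.swap _ _ h]

/-- The tournament which orders first by `e` and then by `o`, the points with `o = 1` first. -/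
def edgeOrder {V E : Type} (e : V → E) (ρ : E → E → ZMod 2) (o : V → ZMod 2) :
    V → V → ZMod 2 :=
  _root_.lexTour e ρ fun x y => if x = y then 0 else o x

namespace IsPairing

variable {V E : Type} {e : V → E} {o : V → ZMod 2}

theorem isTour_edgeOrder (h : IsPairing e o) {ρ : E → E → ZMod 2} (hρ : IsTour ρ) :
    IsTour (edgeOrder e ρ o) :=
  hρ.lexTour (by simp) fun x y hxy he => by simp [hxy, hxy.symm, h.flip x y hxy he]

/-- The other element of a fibre. -/
def partner (h : IsPairing e o) (v : V) : V := (h.exists_ne v).choose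

theorem partner_ne (h : IsPairing e o) (v : V) : h.partner v ≠ v :=
  (h.exists_ne v).choose_spec.1

theorem apply_partner (h : IsPairing e o) (v : V) : e (h.partner v) = e v :=
  (h.exists_ne v).choose_spec.2

theorem sign_partner (h : IsPairing e o) (v : V) : o (h.partner v) = o v + 1 := by
  have := h.flip _ _ (h.partner_ne v) (h.apply_partner v)
  grind

theorem eq_of_sign_eq (h : IsPairing e o) {v w : V} (he : e v = e w) (ho : o v = o w) : v = w := by
  by_contra hne
  have := h.flip v w hne he
  rw [ho, CharTwo.add_self_eq_zero] at this
  exact absurd this (by decide)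

theorem eq_partner (h : IsPairing e o) {v w : V} (he : e w = e v) (hne : w ≠ v) :
    w = h.partner v := by
  refine h.eq_of_sign_eq (he.trans (h.apply_partner v).symm) ?_
  have := h.flip _ _ hne he
  rw [h.sign_partner]
  grind

theorem partner_partner (h : IsPairing e o) (v : V) : h.partner (h.partner v) = v :=
  (h.eq_partner (h.apply_partner v).symm (h.partner_ne v).symm).symm

theorem apply_eq_iff (h : IsPairing e o) {v w : V} : e v = e w ↔ w = v ∨ w = h.partner v := by
  constructor
  · intro he
    by_cases hw : w = v
    · exact Or.inl hw
    · exact Or.inr (h.eq_partner he.symm hw)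
  · rintro (rfl | rfl)
    · rfl
    · exact (h.apply_partner _).symm

/-- The permutation which exchanges the elements of each fibre. -/
def partnerPerm (h : IsPairing e o) : Equiv.Perm V :=
  Function.Involutive.toPerm h.partner h.partner_partner

theorem congr_fun {E' : Type} {e' : V → E'} (h : IsPairing e o)
    (hee : ∀ x y, e x = e y ↔ e' x = e' y) : IsPairing e' o :=
  ⟨fun v => (h.exists_ne v).imp fun _ hw => ⟨hw.1, (hee _ _).1 hw.2⟩,
    fun v w hvw he => h.flip v w hvw ((hee _ _).2 he)⟩

variable [Fintype V]

/-- The weight `o` selects one point in each fibre, so sums over points become sums over edges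
without naming the edges. -/
theorem sum_eq (h : IsPairing e o) (H : V → ZMod 2) :
    ∑ v, H v = ∑ v, o v * (H v + H (h.partner v)) := by
  have h1 : ∑ v, o v * H (h.partner v) = ∑ v, (o v + 1) * H v := by
    rw [← Equiv.sum_comp h.partnerPerm]
    refine Finset.sum_congr rfl fun v _ => ?_
    change o (h.partner v) * H (h.partner (h.partner v)) = _
    rw [h.partner_partner, h.sign_partner]
  simp only [mul_add, Finset.sum_add_distrib, h1, add_mul, one_mul]
  grind

theorem sum_eq_zero (h : IsPairing e o) (H : V → ZMod 2) (hH : ∀ v, H (h.partner v) = H v) :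
    ∑ v, H v = 0 := by
  rw [h.sum_eq]
  exact Finset.sum_eq_zero fun v _ => by rw [hH, CharTwo.add_self_eq_zero, mul_zero]

theorem sum_comp_eq_zero (h : IsPairing e o) (g : E → ZMod 2) : ∑ v, g (e v) = 0 :=
  h.sum_eq_zero _ fun v => by rw [h.apply_partner]

/-- Grouped by pairs of fibres, u is constant on each block, and the four values of χ from one fibre
to another have the same sum mod 2 as the four reversed values. The block sums are therefore
symmetric, and the diagonal blocks vanish. -/
theorem sum_mul_tour_eq_zero (h : IsPairing e o) {χ : V → V → ZMod 2} (hχ : IsTour χ)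
    (u : V → V → ZMod 2) (hs : ∀ x y, u x y = u y x) (he : ∀ x x' y, e x = e x' → u x y = u x' y)
    (h0 : ∀ x, u x x = 0) : ∑ x, ∑ y, u x y * χ x y = 0 := by
  have h1 : ∀ x y, u (h.partner x) y = u x y := fun x y => he _ _ _ (h.apply_partner x)
  have h2 : ∀ x y, u x (h.partner y) = u x y := fun x y => by rw [hs, h1, hs]
  have e1 : ∑ x, ∑ y, u x y * χ x y = ∑ x, ∑ y, o x * o y * u x y *
      (χ x y + χ (h.partner x) y + χ x (h.partner y) + χ (h.partner x) (h.partner y)) := by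
    rw [h.sum_eq]
    refine Finset.sum_congr rfl fun x _ => ?_
    rw [← Finset.sum_add_distrib, h.sum_eq, Finset.mul_sum]
    refine Finset.sum_congr rfl fun y _ => ?_
    simp only [h1, h2]
    ring
  rw [e1]
  refine sum_symm_eq_zero _ (fun x => by simp [h0]) fun x y => ?_
  by_cases hxy : e x = e y
  · rw [he x y y hxy, he y x x hxy.symm, h0, h0]; ring
  · have n1 : x ≠ y := fun hh => hxy (hh ▸ rfl)
    have n2 : h.partner x ≠ y := fun hh => hxy (hh ▸ (h.apply_partner x).symm)
    have n3 : x ≠ h.partner y := fun hh => hxy (hh ▸ (h.apply_partner y))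
    have n4 : h.partner x ≠ h.partner y := fun hh => hxy (by
      rw [← h.apply_partner x, hh, h.apply_partner])
    have := hχ.swap _ _ n1
    have := hχ.swap _ _ n2
    have := hχ.swap _ _ n3
    have := hχ.swap _ _ n4
    rw [hs y x]
    have e2 : (χ x y + χ (h.partner x) y + χ x (h.partner y) + χ (h.partner x) (h.partner y)) =
      (χ y x + χ (h.partner y) x + χ y (h.partner x) + χ (h.partner y) (h.partner x)) := by
      grind
    rw [e2]; ring

/-- Moving a whole edge past another one moves two points past two points, an even permutation.
Hence neither the order of the edges nor their names matter, only the order inside each edge. -/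
theorem tourPair_edgeOrder_congr (h : IsPairing e o) {E' : Type} {e' : V → E'}
    (hee : ∀ x y, e x = e y ↔ e' x = e' y) {ρ : E → E → ZMod 2} (hρ : IsTour ρ)
    {ρ' : E' → E' → ZMod 2} (hρ' : IsTour ρ') {χ : V → V → ZMod 2} (hχ : IsTour χ) :
    tourPair (edgeOrder e ρ o) χ = tourPair (edgeOrder e' ρ' o) χ := by
  have h' := h.congr_fun hee
  have t := h.isTour_edgeOrder hρ
  have t' := h'.isTour_edgeOrder hρ'
  have hz : ∀ x y, e x = e y → edgeOrder e ρ o x y + edgeOrder e' ρ' o x y = 0 := by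
    intro x y hxy
    simp only [edgeOrder, lexTour, hxy, (hee x y).1 hxy, if_true]
    exact CharTwo.add_self_eq_zero _
  have := h.sum_mul_tour_eq_zero hχ (fun x y => edgeOrder e ρ o x y + edgeOrder e' ρ' o x y)
    (fun x y => t.add_symm t' x y) ?_ (fun x => hz x x rfl)
  · simp only [add_mul, Finset.sum_add_distrib] at this
    exact CharTwo.add_eq_zero.1 this
  · intro x x' y hx
    by_cases hxy : e x = e y
    · rw [hz _ _ hxy, hz _ _ (hx.symm.trans hxy)]
    · have h2 : e x' ≠ e y := hx ▸ hxy
      have h3 : e' x = e' x' := (hee _ _).1 hx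
      have h4 : e' x' ≠ e' y := fun hh => h2 ((hee _ _).2 hh)
      simp only [edgeOrder, lexTour, hx, h3, h2, h4, if_false]

/-- The effect of changing the order of the two elements in the fibres. -/
theorem tourPair_edgeOrder_sign (h : IsPairing e o) {o' : V → ZMod 2} (h' : IsPairing e o')
    (ρ : E → E → ZMod 2) {χ : V → V → ZMod 2} (hχ : IsTour χ) :
    tourPair (edgeOrder e ρ o') χ =
      tourPair (edgeOrder e ρ o) χ + ∑ v, o v * (o v + o' v) := by
  have e1 : tourPair (edgeOrder e ρ o') χ + tourPair (edgeOrder e ρ o) χ =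
      ∑ x, (o x + o' x) * χ x (h.partner x) := by
    simp only [tourPair, ← Finset.sum_add_distrib]
    refine Finset.sum_congr rfl fun x _ => ?_
    -- The two orders differ only between the two ends of one edge.
    rw [Finset.sum_eq_single (h.partner x)]
    · simp only [edgeOrder, lexTour, h.apply_partner, if_true, (h.partner_ne x).symm, if_false]
      ring
    · intro y _ hy
      simp only [edgeOrder, lexTour]
      by_cases hxy : e x = e y
      · obtain rfl : y = x := (h.apply_eq_iff.1 hxy).resolve_right hy
        simp
      · simp only [hxy, if_false]; exact CharTwo.add_self_eq_zero _
    · simp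
  rw [h.sum_eq] at e1
  have e2 : ∀ x, o x * ((o x + o' x) * χ x (h.partner x) + (o (h.partner x) + o' (h.partner x)) *
      χ (h.partner x) (h.partner (h.partner x))) = o x * (o x + o' x) := by
    intro x
    have := hχ.swap _ _ (h.partner_ne x)
    have h1 := h.sign_partner x
    have h2 := h'.flip _ _ (h.partner_ne x) (h.apply_partner x)
    rw [h.partner_partner]
    grind
  simp only [e2] at e1
  grind

/-- The sum is the number of unordered pairs of points, m(2m - 1) for m edges, hence m mod 2. The
proof sums an edge order, in which other edges contribute evenly. -/
theorem sum_tour (h : IsPairing e o) {χ : V → V → ZMod 2} (hχ : IsTour χ) :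
    ∑ x, ∑ y, χ x y = ∑ v, o v := by
  obtain ⟨ρ, hρ⟩ := exists_isTour E
  rw [hχ.sum_eq (h.isTour_edgeOrder hρ)]
  refine Finset.sum_congr rfl fun x _ => ?_
  have e1 : ∀ y, edgeOrder e ρ o x y =
      (if e x = e y then 0 else ρ (e x) (e y)) + if y = h.partner x then o x else 0 := by
    intro y
    by_cases hxy : e x = e y
    · rcases h.apply_eq_iff.1 hxy with rfl | rfl
      · simp [edgeOrder, lexTour, (h.partner_ne y).symm]
      · simp [edgeOrder, lexTour, (h.partner_ne x).symm, h.apply_partner]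
    · have : y ≠ h.partner x := fun hh => hxy (hh ▸ (h.apply_partner x).symm)
      simp [edgeOrder, lexTour, hxy, this]
  simp only [e1, Finset.sum_add_distrib, Finset.sum_ite_eq', Finset.mem_univ, if_true]
  rw [h.sum_comp_eq_zero fun z => if e x = z then 0 else ρ (e x) z, zero_add]

/-- This converts sums over the edges of a component into sums over its vertices; summed over all
components, the components then disappear. -/
theorem sum_edges [Fintype E] (h : IsPairing e o) (P : V → Prop)
    (hP : ∀ v w, e v = e w → P v → P w) (g : E → ZMod 2) :
    ∑ x : E with ∃ v, P v ∧ e v = x, g x = ∑ v, if P v then o v * g (e v) else 0 := by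
  have e1 : (Finset.univ.filter fun x : E => ∃ v, P v ∧ e v = x) =
      (Finset.univ.filter fun v => P v ∧ o v = 1).image e := by
    ext x
    simp only [Finset.mem_filter, Finset.mem_univ, true_and, Finset.mem_image]
    constructor
    · rintro ⟨v, hv, rfl⟩
      rcases ZMod.two_cases (o v) with h0 | h1
      · exact ⟨h.partner v, ⟨hP _ _ (h.apply_partner v).symm hv, by rw [h.sign_partner, h0, zero_add]⟩,
          h.apply_partner v⟩
      · exact ⟨v, ⟨hv, h1⟩, rfl⟩
    · rintro ⟨v, hv, rfl⟩
      exact ⟨v, hv.1, rfl⟩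
  rw [e1, Finset.sum_image, Finset.sum_filter]
  · refine Finset.sum_congr rfl fun v _ => ?_
    by_cases hv : P v
    · rcases ZMod.two_cases (o v) with h0 | h1
      · simp [hv, h0]
      · simp [hv, h1]
    · simp [hv]
  · intro v hv w hw hvw
    simp at hv hw
    exact h.eq_of_sign_eq hvw (hv.2.trans hw.2.symm)

/-- The number of components of the union of two pairings. -/
theorem card_components {E₁ E₂ : Type} {e₁ : V → E₁} {e₂ : V → E₂} (h₁ : IsPairing e₁ o)
    (h₂ : IsPairing e₂ o) (r : V → V → Prop) [Fintype (Quot r)]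
    (hr : ∀ v w, r v w → e₁ v = e₁ w ∨ e₂ v = e₂ w)
    (hr' : ∀ v w, v ≠ w → e₁ v = e₁ w ∨ e₂ v = e₂ w → r v w)
    {ρ₁ : E₁ → E₁ → ZMod 2} (hρ₁ : IsTour ρ₁) {ρ₂ : E₂ → E₂ → ZMod 2} (hρ₂ : IsTour ρ₂) :
    (Fintype.card (Quot r) : ZMod 2) = tourPair (edgeOrder e₁ ρ₁ o) (edgeOrder e₂ ρ₂ o) := by
  obtain ⟨ρ, hρ⟩ := exists_isTour V
  set τ₁ := h₁.partner
  set τ₂ := h₂.partner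
  -- the elements of the edges on which `o` is `1`
  let r₁ : V → V := fun v => if o v = 1 then v else τ₁ v
  let r₂ : V → V := fun v => if o v = 1 then v else τ₂ v
  have hrep : ∀ {F : Type} {f : V → F} (hf : IsPairing f o) (x y : V), f x = f y ↔
      (if o x = 1 then x else hf.partner x) = (if o y = 1 then y else hf.partner y) := by
    intro F f hf x y
    constructor
    · intro hxy
      refine hf.eq_of_sign_eq ?_ ?_
      · split_ifs <;> simp [hf.apply_partner, hxy]
      · split_ifs with a b b
        · rw [a, b]
        · rw [a, hf.sign_partner, (ZMod.two_cases _).resolve_right b, zero_add]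
        · rw [b, hf.sign_partner, (ZMod.two_cases _).resolve_right a, zero_add]
        · rw [hf.sign_partner, hf.sign_partner, (ZMod.two_cases _).resolve_right b,
            (ZMod.two_cases _).resolve_right a]
    · intro hxy
      have := congrArg f hxy
      split_ifs at this <;> simpa [hf.apply_partner] using this
  have q₁ : IsPairing r₁ o := h₁.congr_fun (hrep h₁)
  have q₂ : IsPairing r₂ o := h₂.congr_fun (hrep h₂)
  rw [h₁.tourPair_edgeOrder_congr (hrep h₁) hρ₁ hρ (h₂.isTour_edgeOrder hρ₂), tourPair_comm,
    h₂.tourPair_edgeOrder_congr (hrep h₂) hρ₂ hρ (q₁.isTour_edgeOrder hρ)]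
  change _ = tourPair (edgeOrder r₂ ρ o) (edgeOrder r₁ ρ o)
  -- the permutation which carries the first pairing to the second
  let p : V → Prop := fun v => o v = 0
  have o1 : ∀ v, o (τ₁ v) = o v + 1 := h₁.sign_partner
  have o2 : ∀ v, o (τ₂ v) = o v + 1 := h₂.sign_partner
  have i1 : ∀ v, τ₁ (τ₁ v) = v := h₁.partner_partner
  have i2 : ∀ v, τ₂ (τ₂ v) = v := h₂.partner_partner
  let g : Equiv.Perm V :=
    { toFun := fun v => if o v = 1 then v else τ₂ (τ₁ v)
      invFun := fun v => if o v = 1 then v else τ₁ (τ₂ v)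
      left_inv := fun v => by
        rcases ZMod.two_cases (o v) with h0 | h0 <;> simp [h0, o1, o2, i1, i2]
      right_inv := fun v => by
        rcases ZMod.two_cases (o v) with h0 | h0 <;> simp [h0, o1, o2, i1, i2] }
  have g1 : ∀ v, o v = 1 → g v = v := fun v hv => by simp [g, hv]
  have g0 : ∀ v, o v = 0 → g v = τ₂ (τ₁ v) := fun v hv => by simp [g, hv]
  have og : ∀ v, o (g v) = o v := fun v => by
    rcases ZMod.two_cases (o v) with h0 | h0
    · rw [g0 v h0, o2, o1, h0]; decide
    · rw [g1 v h0]
  -- Edges are named by their end with `o = 1`. With these names g carries the list for the first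
  -- pairing to the list for the second, so the relative parity of the lists is the parity of g.
  have rg : ∀ v, r₂ (g v) = r₁ v := fun v => by
    rcases ZMod.two_cases (o v) with h0 | h0
    · simp only [r₂, r₁, og, h0]; simp [g0 v h0, i2]
    · simp only [r₂, r₁, h0, g1 v h0, if_true]
  have hΩ : edgeOrder r₁ ρ o = fun x y => edgeOrder r₂ ρ o (g x) (g y) := by
    funext x y
    simp only [edgeOrder, lexTour, rg, og, g.injective.eq_iff]
  have hs := tourPair_perm (q₂.isTour_edgeOrder hρ) g
  rw [← hΩ] at hs
  -- the orbits of the permutation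
  let X := {v : V // o v = 1}
  -- A point with `o = 1` is fixed by g. The points with `o = 0` in one component form a single
  -- orbit, since g advances them by one edge of each kind.
  have horb : Fintype.card (Quotient (Equiv.Perm.SameCycle.setoid g)) =
      Fintype.card X + Fintype.card (Quot r) := by
    rw [← Fintype.card_sum]
    have hr0 : ∀ v w, e₁ v = e₁ w ∨ e₂ v = e₂ w → Quot.mk r v = Quot.mk r w := fun v w hvw => by
      by_cases hne : v = w
      · rw [hne]
      · exact Quot.sound (hr' v w hne hvw)
    have mkg : ∀ v, (Quotient.mk (Equiv.Perm.SameCycle.setoid g) (g v)) = Quotient.mk _ v :=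
      fun v => Quotient.sound (s := Equiv.Perm.SameCycle.setoid g)
        (show g.SameCycle _ _ from (Equiv.Perm.sameCycle_apply_left.2 (.refl _ _)))
    let F : V → X ⊕ Quot r := fun v => if hv : o v = 1 then Sum.inl ⟨v, hv⟩ else Sum.inr (Quot.mk r v)
    have Fg : ∀ v, F (g v) = F v := fun v => by
      rcases ZMod.two_cases (o v) with h0 | h0
      · have h3 : o (g v) ≠ 1 := by rw [og, h0]; decide
        have h4 : o v ≠ 1 := by rw [h0]; decide
        simp only [F, h3, h4, dif_neg, not_false_eq_true]
        congr 1
        rw [g0 v h0, ← hr0 (τ₁ v) (τ₂ (τ₁ v)) (Or.inr (h₂.apply_partner _).symm),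
          ← hr0 v (τ₁ v) (Or.inl (h₁.apply_partner _).symm)]
      · rw [g1 v h0]
    have Fz : ∀ (i : ℤ) v, F ((g ^ i) v) = F v := by
      intro i
      induction i with
      | zero => simp
      | succ i ih => intro v; rw [zpow_add_one, Equiv.Perm.mul_apply, ih, Fg]
      | pred i ih =>
        intro v
        rw [zpow_sub_one, Equiv.Perm.mul_apply, ih, ← Fg (g⁻¹ v)]; simp
    let G : V → Quotient (Equiv.Perm.SameCycle.setoid g) := fun v =>
      if o v = 0 then Quotient.mk _ v else Quotient.mk _ (τ₂ v)
    have G1 : ∀ v, G (τ₁ v) = G v := by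
      have : ∀ v, o v = 0 → G (τ₁ v) = G v := fun v hv => by
        simp only [G, o1, hv, if_true]
        simp [← g0 v hv, mkg]
      intro v
      rcases ZMod.two_cases (o v) with h0 | h0
      · exact this v h0
      · have := this (τ₁ v) (by rw [o1, h0]; decide)
        rw [i1] at this; exact this.symm
    have G2 : ∀ v, G (τ₂ v) = G v := by
      intro v
      rcases ZMod.two_cases (o v) with h0 | h0
      · simp [G, o2, h0, i2]
      · simp only [G, o2, h0, CharTwo.add_self_eq_zero]
        simp
    refine Fintype.card_congr
      { toFun := Quotient.lift F fun v w (hvw : g.SameCycle v w) => by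
          obtain ⟨i, rfl⟩ := hvw; exact (Fz i v).symm
        invFun := Sum.elim (fun x => Quotient.mk _ x.1) (Quot.lift G fun v w hvw => by
          rcases hr v w hvw with h | h
          · rcases h₁.apply_eq_iff.1 h with rfl | rfl
            · rfl
            · exact (G1 v).symm
          · rcases h₂.apply_eq_iff.1 h with rfl | rfl
            · rfl
            · exact (G2 v).symm)
        left_inv := ?_
        right_inv := ?_ }
    · refine fun q => Quotient.inductionOn q fun v => ?_
      rcases ZMod.two_cases (o v) with h0 | h0
      · simp [F, h0, G]
      · simp [F, h0]
    · rintro (⟨v, hv⟩ | K)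
      · simp [F, hv]
      · induction K using Quot.ind with | _ v => ?_
        rcases ZMod.two_cases (o v) with h0 | h0
        · simp [F, G, h0]
        · simp only [Sum.elim_inr, G, h0]
          simp only [one_ne_zero, if_false, Quotient.lift_mk, F]
          rw [dif_neg (by rw [o2, h0]; decide)]
          rw [hr0 (τ₂ v) v (Or.inr (h₂.apply_partner _))]
  have hX : (Fintype.card X : ZMod 2) = ∑ v, o v := by
    rw [Fintype.card_subtype, Finset.card_filter, Nat.cast_sum]
    refine Finset.sum_congr rfl fun v _ => ?_
    rcases ZMod.two_cases (o v) with h0 | h0 <;> simp [h0]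
  -- In `card_orbits` the number of points is even, and the points with `o = 1` cancel against the
  -- sum of the tournament. Only the components and the pairing of the two orders remain.
  have hV : (Fintype.card V : ZMod 2) = 0 := by
    have := h₁.sum_comp_eq_zero fun _ => 1
    simpa using this
  have hT : ∑ x, ∑ y, edgeOrder r₂ ρ o x y = ∑ v, o v := q₂.sum_tour (q₂.isTour_edgeOrder hρ)
  have h7 := card_orbits g
  rw [horb, ← hs, hV, hT] at h7
  push_cast at h7
  rw [hX] at h7
  grind

end IsPairing

end Pairing

end

/-! ### Two-colourings of unions of two pairings -/

noncomputable section

section Pairing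

open scoped Classical

/-- The union of two pairings is a bipartite graph. -/
theorem IsPairing.exists_common {V E₁ E₂ : Type} {e₁ : V → E₁} {e₂ : V → E₂}
    {o₁ o₂ : V → ZMod 2} (h₁ : IsPairing e₁ o₁) (h₂ : IsPairing e₂ o₂) :
    ∃ o : V → ZMod 2, IsPairing e₁ o ∧ IsPairing e₂ o := by
  set τ₁ := h₁.partnerPerm with hτ₁
  set τ₂ := h₂.partnerPerm with hτ₂
  have i1 : ∀ v, τ₁ (τ₁ v) = v := h₁.partner_partner
  have i2 : ∀ v, τ₂ (τ₂ v) = v := h₂.partner_partner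
  have n1 : ∀ v, τ₁ v ≠ v := h₁.partner_ne
  have n2 : ∀ v, τ₂ v ≠ v := h₂.partner_ne
  set g := τ₂ * τ₁ with hg
  have gi : g⁻¹ = τ₁ * τ₂ := by
    rw [inv_eq_iff_mul_eq_one]
    ext v
    simp [hg, i1, i2]
  -- The involutions generate a dihedral group: τ₁ inverts the rotation g.
  have conj : ∀ (i : ℤ) v, τ₁ ((g ^ i) v) = (g ^ (-i)) (τ₁ v) := by
    intro i v
    have : SemiconjBy τ₁ g g⁻¹ := by
      rw [gi]
      ext v
      simp [hg]
    have := this.zpow_right i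
    rw [inv_zpow'] at this
    exact DFunLike.congr_fun this v
  have hsame : ∀ v w, g.SameCycle v w → g.SameCycle (τ₁ v) (τ₁ w) := by
    rintro v w ⟨i, rfl⟩
    exact ⟨-i, (conj i v).symm⟩
  -- If τ₁ v = g^i v, the dihedral relation yields a fixed point, namely g^j v of τ₁ for i = 2j and
  -- g^(j+1) v of τ₂ for i = 2j + 1. Neither involution has one.
  have hnot : ∀ v, ¬ g.SameCycle v (τ₁ v) := by
    rintro v ⟨i, hi⟩
    rcases Int.even_or_odd' i with ⟨j, rfl | rfl⟩
    · apply n1 ((g ^ j) v)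
      rw [conj, ← hi, ← Equiv.Perm.mul_apply, ← zpow_add]
      congr 2; ring
    · apply n2 ((g ^ (j + 1)) v)
      have e1 : ∀ w, τ₂ w = g (τ₁ w) := fun w => by simp [hg, i1]
      rw [e1, conj, ← hi, ← Equiv.Perm.mul_apply g, ← zpow_one_add, ← Equiv.Perm.mul_apply,
        ← zpow_add]
      congr 2; ring
  let r : V → V → Prop := fun v w => w = τ₁ v ∨ w = τ₂ v
  have h2 : ∀ v w, g.SameCycle (τ₁ v) w ↔ g.SameCycle (τ₂ v) w := by
    intro v w
    have : τ₂ v = g (τ₁ v) := by simp [hg, i1]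
    rw [this, Equiv.Perm.sameCycle_apply_left]
  have h2' : ∀ v w, g.SameCycle v w ↔ g.SameCycle (τ₁ (τ₂ v)) w := by
    intro v w
    rw [h2, i2]
  have hor : ∀ v w, Relation.EqvGen r v w → g.SameCycle v w ∨ g.SameCycle (τ₁ v) w := by
    intro v w hvw
    induction hvw with
    | rel v w h =>
      rcases h with rfl | rfl
      · exact Or.inr (.refl _ _)
      · exact Or.inr ((h2 _ _).2 (.refl _ _))
    | refl v => exact Or.inl (.refl _ _)
    | symm v w _ ih =>
      rcases ih with h | h
      · exact Or.inl h.symm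
      · exact Or.inr (by simpa [i1] using (hsame _ _ h).symm)
    | trans u v w _ _ ih1 ih2 =>
      rcases ih1 with h | h <;> rcases ih2 with h' | h'
      · exact Or.inl (h.trans h')
      · exact Or.inr ((hsame _ _ h).trans h')
      · exact Or.inr (h.trans h')
      · exact Or.inl (by simpa [i1] using (hsame _ _ h).trans h')
  -- A component consists of the two rotation orbits of v and τ₁ v; the one which contains the
  -- chosen representative of the component gets colour 1.
  let o : V → ZMod 2 := fun v => if g.SameCycle v (Quot.mk r v).out then 1 else 0
  have hout : ∀ v, g.SameCycle v (Quot.mk r v).out ∨ g.SameCycle (τ₁ v) (Quot.mk r v).out :=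
    fun v => hor _ _ (Quot.eqvGen_exact (Quot.out_eq (Quot.mk r v)).symm)
  have key : ∀ v w, (Quot.mk r v = Quot.mk r w) →
      (∀ u, g.SameCycle (τ₁ v) u ↔ g.SameCycle w u) → o v + o w = 1 := by
    intro v w hq hs
    simp only [o]
    rw [← hq]
    by_cases h : g.SameCycle v (Quot.mk r v).out
    · have : ¬ g.SameCycle w (Quot.mk r v).out := fun hh =>
        hnot v (h.trans ((hs _).2 hh).symm)
      simp [h, this]
    · have := (hs _).1 ((hout v).resolve_left h)
      simp [h, this]
  refine ⟨o, ⟨h₁.exists_ne, fun v w hne he => ?_⟩, ⟨h₂.exists_ne, fun v w hne he => ?_⟩⟩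
  · obtain rfl : w = τ₁ v := h₁.eq_partner he.symm hne.symm
    exact key _ _ (Quot.sound (Or.inl rfl)) fun u => Iff.rfl
  · obtain rfl : w = τ₂ v := h₂.eq_partner he.symm hne.symm
    exact key _ _ (Quot.sound (Or.inr rfl)) (h2 v)

end Pairing

end

noncomputable section

/-! ### Binomial coefficients modulo two -/

section Choose

/-- The binomial coefficient `n(n-1)/2` modulo `2`. -/
def choose2 (n : ℕ) : ZMod 2 := (n.choose 2 : ℕ)

theorem choose2_succ (n : ℕ) : choose2 (n + 1) = choose2 n + n := by
  simp only [choose2, Nat.choose_succ_succ' n 1, Nat.choose_one_right]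
  push_cast; ring

theorem choose2_add (n m : ℕ) : choose2 (n + m) = choose2 n + choose2 m + n * m := by
  induction m with
  | zero => simp [choose2]
  | succ m ih => rw [← add_assoc, choose2_succ, ih, choose2_succ]; push_cast; ring

theorem choose2_two_mul (n : ℕ) : choose2 (2 * n) = n := by
  rw [two_mul, choose2_add, ZMod.two_mul_self, CharTwo.add_self_eq_zero, zero_add]

theorem choose2_val (x : ZMod 2) : choose2 x.val = 0 := by
  revert x; decide

theorem choose2_card {V : Type} [Fintype V] {χ : V → V → ZMod 2} (h : IsTour χ) :
    ∑ x, ∑ y, χ x y = choose2 (Fintype.card V) := by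
  let e := Fintype.equivFin V
  have h' : IsTour fun x y : Fin (Fintype.card V) => if x < y then (1 : ZMod 2) else 0 :=
    ⟨fun x => by simp, fun x y hxy => by
      rcases lt_or_gt_of_ne hxy with h | h <;> simp [h, h.not_gt]⟩
  rw [h.sum_eq (h'.comp e.injective)]
  have key : ∀ n : ℕ, ∑ x : Fin n, ∑ y : Fin n, (if x < y then (1 : ZMod 2) else 0) =
      choose2 n := by
    intro n
    induction n with
    | zero => simp [choose2]
    | succ n ih =>
      rw [choose2_succ, ← ih]
      simp only [Fin.sum_univ_castSucc (n := n), Fin.castSucc_lt_castSucc_iff, Fin.castSucc_lt_last,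
        if_true, Finset.sum_add_distrib, lt_irrefl, if_false, (Fin.castSucc_lt_last _).not_gt]
      simp
  rw [← key, ← Equiv.sum_comp e]
  exact Finset.sum_congr rfl fun x _ => Equiv.sum_comp e fun y =>
    if e x < y then (1 : ZMod 2) else 0

end Choose

/-! ### A quadratic form computing the second Steenrod square -/

namespace OneFlowCat

open scoped Classical

variable (C : OneFlowCat)

/-- The points of the moduli spaces `M(a, b)` for fixed `a`. -/
abbrev Out (a : C.Ob) : Type := {A : C.Pt // C.src A = a}

/-- The composable pairs starting in `a`. -/
abbrev PairOver (a : C.Ob) : Type := {p : C.Pair // C.src p.1.2 = a}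

/-- The intervals of the moduli spaces `M(a, c)` for fixed `a`. -/
abbrev ItvOver (a : C.Ob) : Type := {I : C.Itv // C.itvSrc I = a}

/-- The bottom of a composable pair. -/
abbrev Pair.bot {C : OneFlowCat} (p : C.Pair) : C.Ob := C.tgt p.1.1

def pairOverEquiv (a : C.Ob) : C.PairOver a ≃ Σ A : C.Out a, C.Out (C.tgt A.1) where
  toFun p := ⟨⟨p.1.1.2, p.2⟩, ⟨p.1.1.1, p.1.2.symm⟩⟩
  invFun x := ⟨⟨(x.2.1, x.1.1), x.2.2.symm⟩, x.1.2⟩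
  left_inv _ := rfl
  right_inv _ := rfl

variable {C}

theorem sum_pairOver {a : C.Ob} (G : C.Pt → C.Pt → ZMod 2) :
    ∑ p : C.PairOver a, G p.1.1.1 p.1.1.2 =
      ∑ A : C.Out a, ∑ B : C.Out (C.tgt A.1), G B.1 A.1 := by
  rw [← Fintype.sum_sigma', ← Equiv.sum_comp (C.pairOverEquiv a)]
  rfl

/-- The coboundary with weights. -/
def wcob (w : C.Pt → ZMod 2) (φ : C.Ob → ZMod 2) (a : C.Ob) : ZMod 2 :=
  ∑ A : C.Out a, w A.1 * φ (C.tgt A.1)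

theorem coboundary_apply (φ : C.Ob → ZMod 2) (a : C.Ob) :
    C.coboundary φ a = ∑ A : C.Out a, φ (C.tgt A.1) := by
  simp only [coboundary, LinearMap.coe_mk, AddHom.coe_mk]
  rw [← Finset.sum_filter, Finset.sum_subtype (p := fun P => C.src P = a)]
  simp

/-- Through this formula sums over corners become iterated weighted coboundaries, which can then be
recognized as coboundaries. -/
theorem sum_pairOver_mul {a : C.Ob} (w w' : C.Pt → ZMod 2) (φ : C.Ob → ZMod 2) :
    ∑ p : C.PairOver a, w p.1.1.2 * w' p.1.1.1 * φ p.1.bot = wcob w (wcob w' φ) a := by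
  rw [sum_pairOver fun B A => w A * w' B * φ (C.tgt B)]
  simp only [wcob, Finset.mul_sum, mul_assoc]

variable (C) in
/-- A fixed tournament on the points of the `0`-dimensional moduli spaces. -/
def ptTour : C.Pt → C.Pt → ZMod 2 := (exists_isTour C.Pt).choose

variable (C) in
/-- A fixed tournament on the intervals of the `1`-dimensional moduli spaces. -/
def itvTour : C.Itv → C.Itv → ZMod 2 := (exists_isTour C.Itv).choose

theorem isTour_ptTour : IsTour C.ptTour := (exists_isTour C.Pt).choose_spec

theorem isTour_itvTour : IsTour C.itvTour := (exists_isTour C.Itv).choose_spec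

variable (C) in
/-- The tournament on pairs `(B, A)` which orders first by `A`. -/
def pairTour : C.Pair → C.Pair → ZMod 2 :=
  lexTour (fun p => p.1.2) C.ptTour fun p q => C.ptTour p.1.1 q.1.1

theorem isTour_pairTour : IsTour C.pairTour := by
  refine isTour_ptTour.lexTour (fun p => isTour_ptTour.self _) fun p q hpq h =>
    isTour_ptTour.swap _ _ fun h' => hpq (Subtype.ext (Prod.ext h' h))

theorem pairTour_apply (p q : C.Pair) : C.pairTour p q =
    (if p.1.2 = q.1.2 then C.ptTour p.1.1 q.1.1 else 0) + C.ptTour p.1.2 q.1.2 := by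
  by_cases h : p.1.2 = q.1.2
  · simp [pairTour, lexTour, h, isTour_ptTour.self]
  · simp [pairTour, lexTour, h]

/-- The sign of a composable pair. -/
def pairSign (s : C.Pt → ZMod 2) (p : C.Pair) : ZMod 2 := s p.1.1 + s p.1.2

theorem isPairing_bdry {s : C.Pt → ZMod 2} (hs : C.IsSignAssignment s) :
    IsPairing C.bdry (pairSign s) := by
  refine ⟨fun p => ?_, fun p q hpq h => ?_⟩
  · obtain ⟨q, q', hq, h⟩ := C.bdry_two (C.bdry p)
    by_cases hp : p = q
    · exact ⟨q', hp ▸ hq.symm, (h q').2 (Or.inr rfl)⟩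
    · exact ⟨q, fun h' => hp h'.symm, (h q).2 (Or.inl rfl)⟩
  · have := hs p q hpq h
    simp only [pairSign]
    grind

/-- The interval bounded by a pair over `a`, as an interval over `a`. -/
def bdryOver (a : C.Ob) (p : C.PairOver a) : C.ItvOver a :=
  ⟨C.bdry p.1, (C.itvSrc_bdry p.1).trans p.2⟩

theorem isPairing_bdryOver {s : C.Pt → ZMod 2} (hs : C.IsSignAssignment s) (a : C.Ob) :
    IsPairing (bdryOver a) fun p : C.PairOver a => pairSign s p.1 := by
  have h := isPairing_bdry hs
  refine ⟨fun p => ?_, fun p q hpq he => h.flip _ _ (fun h' => hpq (Subtype.ext h'))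
    (congrArg Subtype.val he)⟩
  have e : C.src (h.partner p.1).1.2 = a := by
    rw [← C.itvSrc_bdry, h.apply_partner, C.itvSrc_bdry, p.2]
  exact ⟨⟨h.partner p.1, e⟩, fun h' => h.partner_ne _ (congrArg Subtype.val h'),
    Subtype.ext (h.apply_partner _)⟩

/-- Exactly one end of each interval has sign 1. -/
theorem sum_itvOver {s : C.Pt → ZMod 2} (hs : C.IsSignAssignment s) (a : C.Ob)
    (g : C.ItvOver a → ZMod 2) :
    ∑ I, g I = ∑ p : C.PairOver a, pairSign s p.1 * g (bdryOver a p) := by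
  have := (isPairing_bdryOver hs a).sum_edges (fun _ => True) (fun _ _ _ h => h) g
  simp only [true_and, if_true] at this
  rw [← this]
  refine (Finset.sum_subset (Finset.subset_univ _) fun I _ hI => ?_).symm
  obtain ⟨p, q, -, h⟩ := C.bdry_two I.1
  have hp := (h p).2 (Or.inl rfl)
  refine absurd ?_ hI
  simp only [Finset.mem_filter, Finset.mem_univ, true_and]
  exact ⟨⟨p, by rw [← C.itvSrc_bdry, hp, I.2]⟩, Subtype.ext hp⟩

/-- The order of the pairs by intervals and signs. -/
def itvOrder (s : C.Pt → ZMod 2) : C.Pair → C.Pair → ZMod 2 :=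
  edgeOrder C.bdry C.itvTour (pairSign s)

/-- The weighted pairing of the two orders on composable pairs. -/
def orderForm (s : C.Pt → ZMod 2) (φ : C.Ob → ZMod 2) (a : C.Ob) : ZMod 2 :=
  ∑ p : C.PairOver a, ∑ q : C.PairOver a,
    φ p.1.bot * φ q.1.bot * (itvOrder s p.1 q.1 * C.pairTour p.1 q.1)

/-- The total weight of the points over `b`. -/
def tot (ν : C.Ob → ℕ) (b : C.Ob) : ℕ := ∑ B : C.Out b, ν (C.tgt B.1)

theorem cast_tot (ν : C.Ob → ℕ) (b : C.Ob) :
    (tot ν b : ZMod 2) = C.coboundary (fun c => (ν c : ZMod 2)) b := by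
  rw [coboundary_apply, tot]; push_cast; rfl

/-- The quadratic form which represents the second Steenrod square. -/
def sqForm (s : C.Pt → ZMod 2) (f : C.PreFraming) (ν : C.Ob → ℕ) (a : C.Ob) : ZMod 2 :=
  ∑ I : C.ItvOver a, (ν (C.itvTgt I.1) * f.itv I.1 + choose2 (ν (C.itvTgt I.1))) +
  orderForm s (fun c => (ν c : ZMod 2)) a +
  ∑ A : C.Out a, s A.1 * choose2 (tot ν (C.tgt A.1))

theorem bdryOver_bot {a : C.Ob} (p : C.PairOver a) : C.itvTgt (bdryOver a p).1 = p.1.bot :=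
  C.itvTgt_bdry _

theorem sum_bot_eq_zero {s : C.Pt → ZMod 2} (hs : C.IsSignAssignment s) (a : C.Ob)
    (φ : C.Ob → ZMod 2) : ∑ p : C.PairOver a, φ p.1.bot = 0 := by
  simp only [← bdryOver_bot]
  exact (isPairing_bdryOver hs a).sum_comp_eq_zero fun I => φ (C.itvTgt I.1)

/-- The two ends of any interval other than that of p lie on the same side of p and over the same
object, so they cancel. The partner of p is left. -/
theorem sum_itvOrder {s : C.Pt → ZMod 2} (hs : C.IsSignAssignment s) {a : C.Ob}
    (φ : C.Ob → ZMod 2) (p : C.PairOver a) :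
    ∑ q : C.PairOver a, φ q.1.bot * itvOrder s p.1 q.1 = φ p.1.bot * pairSign s p.1 := by
  have h := isPairing_bdryOver hs a
  have e1 : ∀ q : C.PairOver a, φ q.1.bot * itvOrder s p.1 q.1 =
      φ (C.itvTgt (bdryOver a q).1) *
        (if bdryOver a p = bdryOver a q then 0 else C.itvTour (C.bdry p.1) (bdryOver a q).1) +
      if q = h.partner p then φ p.1.bot * pairSign s p.1 else 0 := by
    intro q
    rw [bdryOver_bot]
    by_cases hpq : bdryOver a p = bdryOver a q
    · have hv : C.bdry p.1 = C.bdry q.1 := congrArg Subtype.val hpq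
      rcases h.apply_eq_iff.1 hpq with rfl | rfl
      · simp [itvOrder, edgeOrder, lexTour, (h.partner_ne _).symm]
      · have hne : p.1 ≠ (h.partner p).1 := fun hh => h.partner_ne p (Subtype.ext hh.symm)
        have hb : (h.partner p).1.bot = p.1.bot := by
          rw [← bdryOver_bot, ← bdryOver_bot, h.apply_partner]
        simp [itvOrder, edgeOrder, lexTour, hne, h.apply_partner, hv, hb]
    · have h1 : q ≠ h.partner p := fun hh => hpq (hh ▸ (h.apply_partner p).symm)
      have h2 : C.bdry p.1 ≠ C.bdry q.1 := fun hh => hpq (Subtype.ext hh)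
      simp [itvOrder, edgeOrder, lexTour, h1, h2, bdryOver]
  simp only [e1, Finset.sum_add_distrib, Finset.sum_ite_eq', Finset.mem_univ, if_true]
  rw [h.sum_comp_eq_zero fun I => φ (C.itvTgt I.1) *
    if bdryOver a p = I then 0 else C.itvTour (C.bdry p.1) I.1, zero_add]

/-- Pairs with the same upper point A are compared by their lower points, which gives a coboundary;
the other pairs are compared by A alone, so that only the coboundaries of φ and ψ enter. That second
part vanishes if one of the two is a cocycle. -/
theorem sum_pairTour (φ ψ : C.Ob → ZMod 2) (a : C.Ob) :
    ∑ p : C.PairOver a, ∑ q : C.PairOver a, φ p.1.bot * ψ q.1.bot * C.pairTour p.1 q.1 =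
      ∑ A : C.Out a, ∑ B : C.Out (C.tgt A.1), ∑ B' : C.Out (C.tgt A.1),
        φ (C.tgt B.1) * ψ (C.tgt B'.1) * C.ptTour B.1 B'.1 +
      ∑ A : C.Out a, ∑ A' : C.Out a,
        C.coboundary φ (C.tgt A.1) * C.coboundary ψ (C.tgt A'.1) * C.ptTour A.1 A'.1 := by
  have e1 : ∀ p : C.PairOver a,
      ∑ q : C.PairOver a, φ p.1.bot * ψ q.1.bot * C.pairTour p.1 q.1 =
      ∑ B' : C.Out (C.tgt p.1.1.2), φ p.1.bot * ψ (C.tgt B'.1) * C.ptTour p.1.1.1 B'.1 +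
      ∑ A' : C.Out a, φ p.1.bot * C.coboundary ψ (C.tgt A'.1) * C.ptTour p.1.1.2 A'.1 := by
    intro p
    simp only [pairTour_apply, mul_add, Finset.sum_add_distrib]
    rw [sum_pairOver fun B A => φ p.1.bot * ψ (C.tgt B) *
      if p.1.1.2 = A then C.ptTour p.1.1.1 B else 0,
      sum_pairOver fun B A => φ p.1.bot * ψ (C.tgt B) * C.ptTour p.1.1.2 A]
    congr 1
    · rw [Finset.sum_eq_single ⟨p.1.1.2, p.2⟩]
      · simp
      · intro A _ hA
        have : p.1.1.2 ≠ A.1 := fun h => hA (Subtype.ext h.symm)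
        simp [this]
      · simp
    · refine Finset.sum_congr rfl fun A _ => ?_
      rw [coboundary_apply, Finset.mul_sum, Finset.sum_mul]
  simp only [e1, Finset.sum_add_distrib]
  congr 1
  · have := sum_pairOver (a := a) fun B A => ∑ B' : C.Out (C.tgt A),
      φ (C.tgt B) * ψ (C.tgt B'.1) * C.ptTour B B'.1
    exact this
  · rw [sum_pairOver fun B A => ∑ A' : C.Out a,
      φ (C.tgt B) * C.coboundary ψ (C.tgt A'.1) * C.ptTour A A'.1]
    refine Finset.sum_congr rfl fun A _ => ?_
    rw [Finset.sum_comm]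
    refine Finset.sum_congr rfl fun A' _ => ?_
    rw [coboundary_apply φ, Finset.sum_mul, Finset.sum_mul]

theorem isTour_itvOrder {s : C.Pt → ZMod 2} (hs : C.IsSignAssignment s) : IsTour (itvOrder s) :=
  (isPairing_bdry hs).isTour_edgeOrder isTour_itvTour

/-- The polarization symmetrizes a product of two tournaments, and χχ' + (1 + χ)(1 + χ') = 1 + χ +
χ' off the diagonal. The constant sums to zero because corners come in pairs, and the sums of the
interval order are known from `sum_itvOrder`. -/
theorem orderForm_add {s : C.Pt → ZMod 2} (hs : C.IsSignAssignment s) (φ ψ : C.Ob → ZMod 2)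
    (a : C.Ob) :
    orderForm s (fun c => φ c + ψ c) a = orderForm s φ a + orderForm s ψ a +
      ∑ p : C.PairOver a, ∑ q : C.PairOver a, φ p.1.bot * ψ q.1.bot * C.pairTour p.1 q.1 +
      ∑ I : C.ItvOver a, φ (C.itvTgt I.1) * ψ (C.itvTgt I.1) := by
  set M : C.PairOver a → C.PairOver a → ZMod 2 :=
    fun p q => itvOrder s p.1 q.1 * C.pairTour p.1 q.1 with hM
  have e1 : orderForm s (fun c => φ c + ψ c) a = orderForm s φ a + orderForm s ψ a +
      ∑ p : C.PairOver a, ∑ q : C.PairOver a, φ p.1.bot * ψ q.1.bot * M p q +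
      ∑ p : C.PairOver a, ∑ q : C.PairOver a, ψ p.1.bot * φ q.1.bot * M p q := by
    simp only [orderForm, ← Finset.sum_add_distrib, hM]
    refine Finset.sum_congr rfl fun p _ => Finset.sum_congr rfl fun q _ => ?_
    ring
  have e2 : ∑ p : C.PairOver a, ∑ q : C.PairOver a, ψ p.1.bot * φ q.1.bot * M p q =
      ∑ p : C.PairOver a, ∑ q : C.PairOver a, φ p.1.bot * ψ q.1.bot * M q p := by
    rw [Finset.sum_comm]
    refine Finset.sum_congr rfl fun p _ => Finset.sum_congr rfl fun q _ => ?_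
    ring
  have e3 : ∀ p q : C.PairOver a, M p q + M q p =
      1 + itvOrder s p.1 q.1 + C.pairTour p.1 q.1 + if p = q then 1 else 0 := by
    intro p q
    by_cases hpq : p = q
    · subst hpq
      simp [hM, (isTour_itvOrder hs).self, isTour_pairTour.self]
      decide
    · have hpq' : p.1 ≠ q.1 := fun h => hpq (Subtype.ext h)
      have h1 := (isTour_itvOrder hs).swap _ _ hpq'
      have h2 := isTour_pairTour.swap _ _ hpq'
      simp only [hM, hpq, if_false]
      grind
  have e4 : ∑ p : C.PairOver a, ∑ q : C.PairOver a, φ p.1.bot * ψ q.1.bot * M p q +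
      ∑ p : C.PairOver a, ∑ q : C.PairOver a, φ p.1.bot * ψ q.1.bot * M q p =
      (∑ p : C.PairOver a, φ p.1.bot) * (∑ q : C.PairOver a, ψ q.1.bot) +
      ∑ p : C.PairOver a, φ p.1.bot * (∑ q : C.PairOver a, ψ q.1.bot * itvOrder s p.1 q.1) +
      ∑ p : C.PairOver a, ∑ q : C.PairOver a, φ p.1.bot * ψ q.1.bot * C.pairTour p.1 q.1 +
      ∑ p : C.PairOver a, φ p.1.bot * ψ p.1.bot := by
    have : ∀ p : C.PairOver a, φ p.1.bot * ψ p.1.bot =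
        ∑ q : C.PairOver a, φ p.1.bot * ψ q.1.bot * (if p = q then 1 else 0) := by
      intro p; simp
    rw [Finset.sum_mul_sum]
    simp only [this, Finset.mul_sum, ← Finset.sum_add_distrib]
    refine Finset.sum_congr rfl fun p _ => Finset.sum_congr rfl fun q _ => ?_
    rw [← mul_add, e3]; ring
  have e5 := sum_itvOver hs a fun I => φ (C.itvTgt I.1) * ψ (C.itvTgt I.1)
  simp only [bdryOver_bot] at e5
  simp only [sum_itvOrder hs] at e4
  rw [sum_bot_eq_zero hs, sum_bot_eq_zero hs a fun c => φ c * ψ c] at e4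
  have e6 : ∑ p : C.PairOver a, φ p.1.bot * (ψ p.1.bot * pairSign s p.1) =
      ∑ p : C.PairOver a, pairSign s p.1 * (φ p.1.bot * ψ p.1.bot) :=
    Finset.sum_congr rfl fun p _ => by ring
  rw [e1, e2, e5, ← e6]
  grind

theorem tot_add (ν μ : C.Ob → ℕ) (b : C.Ob) :
    tot (fun c => ν c + μ c) b = tot ν b + tot μ b := Finset.sum_add_distrib

theorem tot_two_mul (μ : C.Ob → ℕ) (b : C.Ob) : tot (fun c => 2 * μ c) b = 2 * tot μ b :=
  (Finset.mul_sum _ _ _).symm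

/-- The quadratic form is additive up to coboundaries. -/
theorem sqForm_add {s : C.Pt → ZMod 2} (hs : C.IsSignAssignment s) (f : C.PreFraming)
    (ν μ : C.Ob → ℕ) (hν : ∀ b, (tot ν b : ZMod 2) = 0) :
    ∃ h : C.Ob → ZMod 2, ∀ a, sqForm s f (fun c => ν c + μ c) a =
      sqForm s f ν a + sqForm s f μ a + C.coboundary h a := by
  -- The interval terms νμ of `orderForm_add` and of `choose2_add` cancel, and the product of the
  -- two totals vanishes as the total of ν is even. The part of `sum_pairTour` with equal upper
  -- points is what remains.
  refine ⟨fun b => ∑ B : C.Out b, ∑ B' : C.Out b,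
    ν (C.tgt B.1) * μ (C.tgt B'.1) * C.ptTour B.1 B'.1, fun a => ?_⟩
  have e1 := orderForm_add hs (fun c => (ν c : ZMod 2)) (fun c => (μ c : ZMod 2)) a
  have e2 := sum_pairTour (fun c => (ν c : ZMod 2)) (fun c => (μ c : ZMod 2)) a
  simp only [← cast_tot, hν, zero_mul, Finset.sum_const_zero, add_zero] at e2
  rw [e2] at e1
  simp only [sqForm, coboundary_apply, tot_add, choose2_add, hν, zero_mul, add_zero, Nat.cast_add,
    e1, add_mul, mul_add, Finset.sum_add_distrib]
  grind

/-- Mod 2 only the binomial terms survive, with choose2(2μ) = μ. The intervals give Σ (s(B) + s(A))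
μ over the corners, the last term of the form gives Σ s(A) μ, and Σ s(B) μ is an iterated
coboundary. -/
theorem sqForm_two_mul {s : C.Pt → ZMod 2} (hs : C.IsSignAssignment s) (f : C.PreFraming)
    (μ : C.Ob → ℕ) (a : C.Ob) :
    sqForm s f (fun c => 2 * μ c) a = C.coboundary (wcob s fun c => (μ c : ZMod 2)) a := by
  have h2 : (2 : ZMod 2) = 0 := rfl
  have e1 := sum_itvOver hs a fun I => (μ (C.itvTgt I.1) : ZMod 2)
  simp only [bdryOver_bot, pairSign, add_mul, Finset.sum_add_distrib] at e1
  have e2 := sum_pairOver (a := a) fun B A => s B * (μ (C.tgt B) : ZMod 2)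
  have e3 := sum_pairOver (a := a) fun B A => s A * (μ (C.tgt B) : ZMod 2)
  simp only [sqForm, orderForm, tot_two_mul, choose2_two_mul, Nat.cast_mul, Nat.cast_ofNat, h2,
    zero_mul, zero_add, Finset.sum_const_zero, add_zero, e1, e2, e3, cast_tot, coboundary_apply,
    wcob, Finset.mul_sum]
  clear h2
  grind

end OneFlowCat

end

noncomputable section

/-! ### Comparison of the quadratic form with the graphs `Γ(a, φ)` -/

namespace OneFlowCat

open scoped Classical

variable {C : OneFlowCat} {φ : C.Ob → ZMod 2} {a : C.Ob}

theorem edgeOrder_comp {V W E : Type} {e : V → E} {ρ : E → E → ZMod 2} {o : V → ZMod 2}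
    {g : W → V} (hg : Function.Injective g) (x y : W) :
    edgeOrder e ρ o (g x) (g y) = edgeOrder (fun w => e (g w)) ρ (fun w => o (g w)) x y := by
  simp only [edgeOrder, lexTour, hg.eq_iff]

theorem sum_vert (G : C.Pair → ZMod 2) :
    ∑ v : C.Vert φ a, G v.1 = ∑ p : C.PairOver a, φ p.1.bot * G p.1 := by
  rw [← Finset.sum_subtype (Finset.univ.filter fun p : C.Pair => C.src p.1.2 = a ∧
      φ (C.tgt p.1.1) = 1) (by simp) (f := G),
    ← Finset.sum_subtype (Finset.univ.filter fun p : C.Pair => C.src p.1.2 = a) (by simp)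
      (f := fun p => φ p.bot * G p), ← Finset.filter_filter, Finset.sum_filter]
  refine Finset.sum_congr rfl fun p _ => ?_
  rcases ZMod.two_cases (φ p.bot) with h | h <;> simp [h]

/-- The points of `∐_{φ(c) = 1} M(b, c)`. -/
abbrev Below (φ : C.Ob → ZMod 2) (b : C.Ob) : Type :=
  {B : {B : C.Pt // φ (C.tgt B) = 1} // C.src B.1 = b}

def vertEquiv (φ : C.Ob → ZMod 2) (a : C.Ob) :
    C.Vert φ a ≃ Σ A : C.Out a, Below φ (C.tgt A.1) where
  toFun v := ⟨⟨v.1.1.2, v.2.1⟩, ⟨⟨v.1.1.1, v.2.2⟩, v.1.2.symm⟩⟩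
  invFun x := ⟨⟨(x.2.1.1, x.1.1), x.2.2.symm⟩, x.1.2, x.2.1.2⟩
  left_inv _ := rfl
  right_inv _ := rfl

theorem sum_vert_below (G : {B : C.Pt // φ (C.tgt B) = 1} → C.Pt → ZMod 2) :
    ∑ v : C.Vert φ a, G v.lowerPt v.upperPt =
      ∑ A : C.Out a, ∑ B : Below φ (C.tgt A.1), G B.1 A.1 := by
  rw [← Fintype.sum_sigma', ← Equiv.sum_comp (vertEquiv φ a)]
  rfl

theorem card_below (φ : C.Ob → ZMod 2) (b : C.Ob) :
    Fintype.card (Below φ b) = tot (fun c => (φ c).val) b := by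
  let e : Below φ b ≃ {B : C.Out b // φ (C.tgt B.1) = 1} :=
    ⟨fun B => ⟨⟨B.1.1, B.2⟩, B.1.2⟩, fun B => ⟨⟨B.1.1, B.2⟩, B.1.2⟩, fun _ => rfl, fun _ => rfl⟩
  rw [Fintype.card_congr e, Fintype.card_subtype, Finset.card_filter, tot]
  refine Finset.sum_congr rfl fun B _ => ?_
  rcases ZMod.two_cases (φ (C.tgt B.1)) with h | h <;> simp [h]
  rfl

theorem isPairing_vert_itv {s : C.Pt → ZMod 2} (hs : C.IsSignAssignment s) :
    IsPairing (Vert.itv (φ := φ) (a := a)) fun v => pairSign s v.1 := by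
  have h := isPairing_bdry hs
  refine ⟨fun v => ?_, fun v w hvw he => h.flip _ _ (fun h' => hvw (Subtype.ext h')) he⟩
  have e1 : C.src (h.partner v.1).1.2 = a := by
    rw [← C.itvSrc_bdry, h.apply_partner, C.itvSrc_bdry, v.2.1]
  have e2 : φ (C.tgt (h.partner v.1).1.1) = 1 := by
    rw [← C.itvTgt_bdry, h.apply_partner, C.itvTgt_bdry, v.2.2]
  exact ⟨⟨h.partner v.1, e1, e2⟩, fun h' => h.partner_ne _ (congrArg Subtype.val h'),
    h.apply_partner _⟩

/-- This links the algebraic form to the geometry: it is the part of the circle count in `Γ(a, φ)`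
that sees the intervals only. -/
theorem orderForm_eq_tourPair (s : C.Pt → ZMod 2) :
    orderForm s φ a = tourPair
      (edgeOrder (Vert.itv (φ := φ) (a := a)) C.itvTour fun v => pairSign s v.1)
      fun v w => C.pairTour v.1 w.1 := by
  have e1 : ∀ v w : C.Vert φ a, edgeOrder (Vert.itv (φ := φ) (a := a)) C.itvTour
      (fun v => pairSign s v.1) v w = itvOrder s v.1 w.1 := fun v w =>
    (edgeOrder_comp Subtype.val_injective v w).symm
  simp only [tourPair, e1]
  rw [orderForm, sum_vert fun p => ∑ w : C.Vert φ a, itvOrder s p w.1 * C.pairTour p w.1]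
  refine Finset.sum_congr rfl fun p _ => ?_
  rw [sum_vert fun q => itvOrder s p.1 q * C.pairTour p.1 q, Finset.mul_sum]
  exact Finset.sum_congr rfl fun q _ => by ring

namespace Matching

variable (m : C.Matching φ)

/-- The first element of the pair of the matching which contains `B`. -/
def rep (B : {B : C.Pt // φ (C.tgt B) = 1}) : {B : C.Pt // φ (C.tgt B) = 1} :=
  if m.first B = true then B else m.partner B

/-- The indicator function of the first elements of the pairs. -/
def firstSign (B : {B : C.Pt // φ (C.tgt B) = 1}) : ZMod 2 := if m.first B = true then 1 else 0

theorem firstSign_partner (B : {B : C.Pt // φ (C.tgt B) = 1}) :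
    m.firstSign (m.partner B) = m.firstSign B + 1 := by
  simp only [firstSign, m.first_partner]
  cases m.first B <;> simp
  decide

theorem partner_ne (B : {B : C.Pt // φ (C.tgt B) = 1}) : m.partner B ≠ B := by
  intro h
  have := m.first_partner B
  rw [h] at this
  cases h' : m.first B <;> simp [h'] at this

theorem rep_eq_iff (B B' : {B : C.Pt // φ (C.tgt B) = 1}) :
    m.rep B = m.rep B' ↔ B' = B ∨ B' = m.partner B := by
  have h1 := m.first_partner B
  have h2 := m.partner_partner B
  have h3 := m.partner_partner B'
  have h4 := m.first_partner B'
  constructor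
  · intro h
    simp only [rep] at h
    split_ifs at h with a b b
    · exact Or.inl h.symm
    · right; rw [h, h3]
    · exact Or.inr h.symm
    · left; rw [← h3, ← h, h2]
  · rintro (rfl | rfl)
    · rfl
    · simp only [rep, h1, h2]
      cases m.first B <;> simp

/-- The edge of `Γ(a, φ)` outside of `E'` on which the vertex lies. -/
def edge (v : C.Vert φ a) : C.Pt × {B : C.Pt // φ (C.tgt B) = 1} :=
  (v.upperPt, m.rep v.lowerPt)

/-- The other end of the edge outside of `E'`. -/
def other (v : C.Vert φ a) : C.Vert φ a :=
  ⟨⟨((m.partner v.lowerPt).1, v.upperPt), v.1.2.trans (m.src_partner v.lowerPt).symm⟩, v.2.1,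
    (m.partner v.lowerPt).2⟩

theorem joins_other (v : C.Vert φ a) : m.Joins v (m.other v) := ⟨rfl, rfl⟩

theorem joins_iff {v w : C.Vert φ a} : m.Joins v w ↔ w = m.other v := by
  constructor
  · rintro ⟨h1, h2⟩
    have h3 : w.1.1.1 = (m.partner v.lowerPt).1 := congrArg Subtype.val h2.symm
    exact Subtype.ext (Subtype.ext (Prod.ext h3 h1.symm))
  · rintro rfl
    exact m.joins_other v

theorem edge_eq_iff (v w : C.Vert φ a) : m.edge v = m.edge w ↔ w = v ∨ m.Joins v w := by
  rw [edge, edge, Prod.mk.injEq, rep_eq_iff]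
  constructor
  · rintro ⟨h1, h2 | h2⟩
    · exact Or.inl (Subtype.ext (Subtype.ext (Prod.ext (congrArg Subtype.val h2) h1.symm)))
    · exact Or.inr ⟨h1, h2.symm⟩
  · rintro (rfl | h)
    · exact ⟨rfl, Or.inl rfl⟩
    · exact ⟨h.1, Or.inr h.2.symm⟩

theorem isPairing_edge {o : C.Vert φ a → ZMod 2} (ho : ∀ v w, m.Joins v w → o v + o w = 1) :
    IsPairing (m.edge (a := a)) o := by
  refine ⟨fun v => ⟨m.other v, fun h => ?_, ?_⟩, fun v w hvw h => ?_⟩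
  · have := congrArg Vert.lowerPt h
    exact m.partner_ne _ this
  · exact ((m.edge_eq_iff _ _).2 (Or.inr (m.joins_other v))).symm
  · exact ho v w (((m.edge_eq_iff _ _).1 h).resolve_left hvw.symm)

theorem isPairing_edge_first : IsPairing (m.edge (a := a)) fun v => m.firstSign v.lowerPt :=
  m.isPairing_edge fun v w h => by
    rw [← h.2, firstSign_partner, ← add_assoc, CharTwo.add_self_eq_zero, zero_add]

theorem isPairing_edge_first_partner (v : C.Vert φ a) :
    (m.isPairing_edge_first (a := a)).partner v = m.other v := by
  refine (IsPairing.eq_partner _ ((m.edge_eq_iff _ _).2 (Or.inr (m.joins_other v))).symm ?_).symm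
  exact fun h => m.partner_ne _ (congrArg Vert.lowerPt h)

/-- The tournament on pairs `(A, B)` which orders first by `A`. -/
def edgeTour (φ : C.Ob → ZMod 2) :
    C.Pt × {B : C.Pt // φ (C.tgt B) = 1} → C.Pt × {B : C.Pt // φ (C.tgt B) = 1} → ZMod 2 :=
  lexTour Prod.fst C.ptTour fun x y => C.ptTour x.2.1 y.2.1

theorem isTour_edgeTour : IsTour (edgeTour φ) :=
  isTour_ptTour.lexTour (fun _ => isTour_ptTour.self _) fun _ _ hxy h =>
    isTour_ptTour.swap _ _ fun h' => hxy (Prod.ext h (Subtype.ext h'))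

/-- For an even number 2m of points both sides are m, the number of matched pairs, whichever
matching is used. -/
theorem sum_firstSign (b : C.Ob) :
    ∑ B : Below φ b, m.firstSign B.1 = choose2 (tot (fun c => (φ c).val) b) := by
  have h : IsPairing (fun B : Below φ b => m.rep B.1) fun B => m.firstSign B.1 := by
    refine ⟨fun B => ⟨⟨m.partner B.1, (m.src_partner B.1).trans B.2⟩, fun h => m.partner_ne B.1
      (congrArg Subtype.val h), ((m.rep_eq_iff _ _).2 (Or.inr rfl)).symm⟩, fun B B' hB h => ?_⟩
    have := ((m.rep_eq_iff _ _).1 h).resolve_left fun h' => hB (Subtype.ext h'.symm)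
    rw [this, firstSign_partner, ← add_assoc, CharTwo.add_self_eq_zero, zero_add]
  obtain ⟨χ, hχ⟩ := exists_isTour (Below φ b)
  rw [← h.sum_tour hχ, choose2_card hχ, card_below]

/-- Both orders compare vertices with different upper points A by A alone. Such terms come in
multiples of the number of points below A, which is even for a cocycle. For equal A the vertices on
different edges contribute a function of the target of A, hence a coboundary, and only the
comparison of matched points depends on `o`. -/
theorem tourPair_edge (hφ : C.coboundary φ = 0) (o : C.Vert φ a → ZMod 2) :
    tourPair (fun v w => C.pairTour v.1 w.1) (edgeOrder (m.edge (a := a)) (edgeTour φ) o) =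
      C.coboundary (fun b => ∑ B : Below φ b, ∑ B' : Below φ b, if m.rep B.1 = m.rep B'.1 then 0
        else C.ptTour B.1.1 B'.1.1 * C.ptTour (m.rep B.1).1 (m.rep B'.1).1) a +
      ∑ v : C.Vert φ a, C.ptTour v.lowerPt.1 (m.partner v.lowerPt).1 * o v := by
  have hcard : ∀ b, (Fintype.card (Below φ b) : ZMod 2) = 0 := by
    intro b
    rw [card_below, cast_tot]
    simp only [ZMod.natCast_val, ZMod.cast_id', id_eq]
    exact congrFun hφ b
  have key : ∀ v : C.Vert φ a, ∑ w : C.Vert φ a, C.pairTour v.1 w.1 *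
      edgeOrder (m.edge (a := a)) (edgeTour φ) o v w =
      ∑ B' : Below φ (C.tgt v.upperPt), (if m.rep v.lowerPt = m.rep B'.1 then 0
        else C.ptTour v.lowerPt.1 B'.1.1 * C.ptTour (m.rep v.lowerPt).1 (m.rep B'.1).1) +
      C.ptTour v.lowerPt.1 (m.partner v.lowerPt).1 * o v := by
    intro v
    -- The first summand may be written for all w, as it vanishes when the upper points agree.
    have e1 : ∀ w : C.Vert φ a, C.pairTour v.1 w.1 *
        edgeOrder (m.edge (a := a)) (edgeTour φ) o v w =
        C.ptTour v.upperPt w.upperPt + (if v.upperPt = w.upperPt then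
          (if m.rep v.lowerPt = m.rep w.lowerPt then 0
          else C.ptTour v.lowerPt.1 w.lowerPt.1 * C.ptTour (m.rep v.lowerPt).1
            (m.rep w.lowerPt).1) else 0) +
        if w = m.other v then C.ptTour v.lowerPt.1 (m.partner v.lowerPt).1 * o v else 0 := by
      intro w
      by_cases hw : w = m.other v
      · subst hw
        have h1 := (m.edge_eq_iff v (m.other v)).2 (Or.inr (m.joins_other v))
        have h2 : v ≠ m.other v := fun h => m.partner_ne v.lowerPt (congrArg Vert.lowerPt h).symm
        have h3 : m.rep v.lowerPt = m.rep (m.other v).lowerPt := congrArg Prod.snd h1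
        have h4 : v.1.1.2 = (m.other v).1.1.2 := rfl
        have h5 : v.upperPt = (m.other v).upperPt := rfl
        have h6 : (m.other v).1.1.1 = (m.partner v.lowerPt).1 := rfl
        have h7 : v.1.1.1 = v.lowerPt.1 := rfl
        simp only [pairTour, edgeOrder, lexTour, h1, h2, h3, ← h4, ← h5, h6, h7,
          isTour_ptTour.self, if_true, if_false]
        ring
      · by_cases hA : v.upperPt = w.upperPt
        · have h4 : v.1.1.2 = w.1.1.2 := hA
          by_cases hr : m.rep v.lowerPt = m.rep w.lowerPt
          · have h1 : m.edge v = m.edge w := Prod.ext hA hr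
            have h2 : w = v := by
              rcases (m.edge_eq_iff v w).1 h1 with h | h
              · exact h
              · exact absurd (m.joins_iff.1 h) hw
            subst h2
            simp [edgeOrder, lexTour, isTour_ptTour.self, hw]
          · have h1 : m.edge v ≠ m.edge w := fun h => hr (congrArg Prod.snd h)
            have h6 : w.1.1.1 = w.lowerPt.1 := rfl
            have h7 : v.1.1.1 = v.lowerPt.1 := rfl
            simp only [pairTour, edgeOrder, edgeTour, lexTour, h1, h4, hw, hA, hr, h6, h7,
              isTour_ptTour.self, if_true, if_false]
            simp [edge, hA]
        · have h1 : m.edge v ≠ m.edge w := fun h => hA (congrArg Prod.fst h)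
          have h4 : v.1.1.2 ≠ w.1.1.2 := hA
          simp only [pairTour, edgeOrder, edgeTour, lexTour, h1, h4, hw, hA, if_false, add_zero]
          simp only [edge, hA, if_false]
          exact ZMod.two_mul_self _
    simp only [e1, Finset.sum_add_distrib, Finset.sum_ite_eq', Finset.mem_univ, if_true]
    congr 1
    rw [sum_vert_below fun B A => C.ptTour v.upperPt A, sum_vert_below fun B A =>
      if v.upperPt = A then (if m.rep v.lowerPt = m.rep B then 0
          else C.ptTour v.lowerPt.1 B.1 * C.ptTour (m.rep v.lowerPt).1 (m.rep B).1) else 0]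
    simp only [Finset.sum_const, Finset.card_univ, nsmul_eq_mul, hcard, zero_mul]
    rw [Finset.sum_eq_single ⟨v.upperPt, v.2.1⟩]
    · simp
    · intro A _ hA
      have : v.upperPt ≠ A.1 := fun h => hA (Subtype.ext h.symm)
      simp [this]
    · simp
  simp only [tourPair, key, Finset.sum_add_distrib]
  congr 1
  rw [coboundary_apply]
  exact sum_vert_below fun B A => ∑ B' : Below φ (C.tgt A), if m.rep B = m.rep B'.1 then 0
        else C.ptTour B.1 B'.1.1 * C.ptTour (m.rep B).1 (m.rep B'.1).1

end Matching

theorem Matching.sum_frameSum {s : C.Pt → ZMod 2} (hs : C.IsSignAssignment s) (m : C.Matching φ)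
    (f : C.PreFraming) (a : C.Ob) :
    ∑ K : m.Comp a, m.frameSum f K = ∑ v : C.Vert φ a, pairSign s v.1 * f.itv v.itv := by
  have h : ∀ K : m.Comp a, m.frameSum f K = ∑ v : C.Vert φ a,
      if (Quot.mk _ v : m.Comp a) = K then pairSign s v.1 * f.itv v.itv else 0 := by
    intro K
    rw [Matching.frameSum]
    refine (isPairing_vert_itv (φ := φ) (a := a) hs).sum_edges
      (fun v => (Quot.mk _ v : m.Comp a) = K) ?_ f.itv
    intro v w hvw hv
    rw [← hv]
    exact Quot.sound (Or.inl hvw.symm)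
  simp only [h]
  rw [Finset.sum_comm]
  exact Finset.sum_congr rfl fun v _ => by rw [Finset.sum_ite_eq]; simp

theorem Matching.sum_dirCount (m : C.Matching φ) (o : m.Direction) (s : C.Pt → ZMod 2)
    (a : C.Ob) : ∑ K : m.Comp a, m.dirCount o s K = ∑ v : C.Vert φ a,
      (if s v.lowerPt.1 = s (m.partner v.lowerPt).1 then m.firstSign v.lowerPt else 0) *
        if o.leaves v = true then 1 else 0 := by
  have hif : ∀ (P Q R S : Prop) [Decidable (P ∧ Q ∧ R ∧ S)] [Decidable P] [Decidable Q]
      [Decidable R] [Decidable S], ((if P ∧ Q ∧ R ∧ S then 1 else 0 : ℕ) : ZMod 2) =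
      if P then (if R then (if Q then 1 else 0) else 0) * (if S then 1 else 0) else 0 := by
    intro P Q R S _ _ _ _ _
    by_cases P <;> by_cases Q <;> by_cases R <;> by_cases S <;> simp [*]
  have h : ∀ K : m.Comp a, m.dirCount o s K = ∑ v : C.Vert φ a,
      if (Quot.mk _ v : m.Comp a) = K then
        (if s v.lowerPt.1 = s (m.partner v.lowerPt).1 then m.firstSign v.lowerPt else 0) *
        (if o.leaves v = true then 1 else 0) else 0 := by
    intro K
    rw [Matching.dirCount, Finset.card_filter, Nat.cast_sum]
    refine Finset.sum_congr rfl fun v _ => ?_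
    exact hif _ _ _ _
  simp only [h]
  rw [Finset.sum_comm]
  exact Finset.sum_congr rfl fun v _ => by rw [Finset.sum_ite_eq]; simp

/-- The cochain `sq^φ` is the value of the quadratic form, up to a coboundary. -/
theorem sqCochain_eq [IsEmpty C.Circ] {s : C.Pt → ZMod 2} (hs : C.IsSignAssignment s)
    (f : C.PreFraming) (hφ : C.coboundary φ = 0) (m : C.Matching φ) (o : m.Direction) :
    ∃ h : C.Ob → ZMod 2, ∀ a, sqCochain s f m o a =
      sqForm s f (fun c => (φ c).val) a + C.coboundary h a := by
  -- The first sum is the matching part of the circle count; the second is what the choice of the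
  -- ordered pairs contributes, found in `k4`.
  refine ⟨fun b => (∑ B : Below φ b, ∑ B' : Below φ b, if m.rep B.1 = m.rep B'.1 then 0
        else C.ptTour B.1.1 B'.1.1 * C.ptTour (m.rep B.1).1 (m.rep B'.1).1) +
      ∑ B : Below φ b, m.firstSign B.1 *
        (s (m.partner B.1).1 + C.ptTour (m.partner B.1).1 B.1.1), fun a => ?_⟩
  -- A direction is a two-colouring for both kinds of edges at once, as the circle count requires.
  let l : C.Vert φ a → ZMod 2 := fun v => if o.leaves v = true then 1 else 0
  have hl : ∀ v w : C.Vert φ a, o.leaves v ≠ o.leaves w → l v + l w = 1 := by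
    intro v w h
    simp only [l]
    cases h1 : o.leaves v <;> cases h2 : o.leaves w <;> simp_all
  have p0 := isPairing_vert_itv (φ := φ) (a := a) hs
  have p1 : IsPairing (Vert.itv (φ := φ) (a := a)) l :=
    ⟨p0.exists_ne, fun v w hvw h => hl _ _ (o.leaves_itv v w hvw h)⟩
  have p2 : IsPairing (m.edge (a := a)) l := m.isPairing_edge fun v w h =>
    hl _ _ (o.leaves_joins v w h)
  have hχ : IsTour fun v w : C.Vert φ a => C.pairTour v.1 w.1 :=
    isTour_pairTour.comp Subtype.val_injective
  have k1 : (Fintype.card (m.Comp a) : ZMod 2) = _ :=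
    p1.card_components p2 _ (fun v w h => h.imp id fun h => (m.edge_eq_iff v w).2 (Or.inr h))
    (fun v w hne h => h.imp id fun h => ((m.edge_eq_iff v w).1 h).resolve_left hne.symm)
    isTour_itvTour Matching.isTour_edgeTour
  -- The lexicographic order of corners is inserted between the two edge orders. On the intervals
  -- the colouring is then replaced by the signs, at the cost of counting the intervals on which the
  -- two disagree.
  rw [tourPair_triangle (p1.isTour_edgeOrder isTour_itvTour) hχ
    (p2.isTour_edgeOrder Matching.isTour_edgeTour), p0.tourPair_edgeOrder_sign p1 _ hχ,
    p0.sum_tour hχ, m.tourPair_edge hφ, ← orderForm_eq_tourPair] at k1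
  have k2 := m.sum_frameSum hs f a
  have k3 := m.sum_dirCount o s a
  -- the terms which depend on the direction
  have k4 : ∑ v : C.Vert φ a, l v * (pairSign s v.1 +
      C.ptTour v.lowerPt.1 (m.partner v.lowerPt).1 +
      if s v.lowerPt.1 = s (m.partner v.lowerPt).1 then m.firstSign v.lowerPt else 0) =
      ∑ v : C.Vert φ a, m.firstSign v.lowerPt * (s v.upperPt + (s (m.partner v.lowerPt).1 +
        C.ptTour (m.partner v.lowerPt).1 v.lowerPt.1)) := by
    rw [(m.isPairing_edge_first (a := a)).sum_eq]
    refine Finset.sum_congr rfl fun v _ => ?_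
    rw [m.isPairing_edge_first_partner]
    have e1 : l v + l (m.other v) = 1 := hl _ _ (o.leaves_joins v _ (m.joins_other v))
    have e2 : (m.other v).lowerPt = m.partner v.lowerPt := rfl
    have e3 : pairSign s (m.other v).1 = s (m.partner v.lowerPt).1 + s v.upperPt := rfl
    have e4 : pairSign s v.1 = s v.lowerPt.1 + s v.upperPt := rfl
    have e5 := isTour_ptTour.swap v.lowerPt.1 (m.partner v.lowerPt).1
      fun h => m.partner_ne v.lowerPt (Subtype.ext h.symm)
    have e6 := m.firstSign_partner v.lowerPt
    rw [e2, e3, e4, m.partner_partner, e6]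
    by_cases hf : m.firstSign v.lowerPt = 0
    · simp [hf]
    · have hf := (ZMod.two_cases _).resolve_left hf
      rw [hf]
      by_cases h : s v.lowerPt.1 = s (m.partner v.lowerPt).1
      · simp only [h, if_true]
        grind
      · have h' : s v.lowerPt.1 + s (m.partner v.lowerPt).1 = 1 := by
          revert h
          generalize s v.lowerPt.1 = x
          generalize s (m.partner v.lowerPt).1 = y
          revert x y; decide
        have h6 : s (m.partner v.lowerPt).1 ≠ s v.lowerPt.1 := fun hh => h hh.symm
        simp only [h, h6, if_false]
        grind
  have k5 := sum_vert_below (φ := φ) (a := a) fun B A => m.firstSign B * (s A +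
    (s (m.partner B).1 + C.ptTour (m.partner B).1 B.1))
  have k6 : ∑ A : C.Out a, s A.1 * choose2 (tot (fun c => (φ c).val) (C.tgt A.1)) =
      ∑ A : C.Out a, ∑ B : Below φ (C.tgt A.1), m.firstSign B.1 * s A.1 := by
    refine Finset.sum_congr rfl fun A _ => ?_
    rw [← Finset.sum_mul, m.sum_firstSign, mul_comm]
  have k7 : ∑ I : C.ItvOver a, (φ (C.itvTgt I.1) * f.itv I.1) =
      ∑ v : C.Vert φ a, pairSign s v.1 * f.itv v.itv := by
    refine Eq.trans ?_ (sum_vert fun p => pairSign s p * f.itv (C.bdry p)).symm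
    rw [sum_itvOver hs]
    refine Finset.sum_congr rfl fun p _ => ?_
    rw [bdryOver_bot, bdryOver]; ring
  have hval : ∀ x : ZMod 2, ((x.val : ℕ) : ZMod 2) = x := by decide
  have k8 : ∑ v : C.Vert φ a, pairSign s v.1 * (pairSign s v.1 + l v) =
      ∑ v : C.Vert φ a, pairSign s v.1 + ∑ v : C.Vert φ a, l v * pairSign s v.1 := by
    rw [← Finset.sum_add_distrib]
    refine Finset.sum_congr rfl fun v _ => ?_
    have := ZMod.two_mul_self (pairSign s v.1)
    grind
  rw [k8] at k1
  simp only [sqCochain, Finset.univ_eq_empty, Finset.filter_empty, Finset.card_empty, Nat.cast_zero,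
    zero_add, Finset.sum_add_distrib, k2, k3, Finset.sum_const, Finset.card_univ, nsmul_eq_mul,
    mul_one, k1, sqForm, choose2_val, add_zero, hval, k6, k7]
  simp only [coboundary_apply, mul_add, Finset.sum_add_distrib] at k4 k5 ⊢
  simp only [mul_comm (l _)] at k4
  simp only [mul_comm (l _)]
  grind

end OneFlowCat

end

noncomputable section

/-! ### The framing condition -/

namespace OneFlowCat

open scoped Classical

variable {C : OneFlowCat}

variable (C) in
/-- Triples of composable points from `a` to an object satisfying `Φ`. -/
abbrev TripleOver (Φ : C.Ob → Prop) (a : C.Ob) : Type :=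
  {t : C.Pt × C.Pt × C.Pt // C.src t.2.2 = a ∧ C.tgt t.2.2 = C.src t.2.1 ∧
    C.tgt t.2.1 = C.src t.1 ∧ Φ (C.tgt t.1)}

namespace TripleOver

variable {Φ : C.Ob → Prop} {a : C.Ob}

/-- The two lower points of a triple. -/
def lowerPair (t : C.TripleOver Φ a) : C.Pair := ⟨(t.1.1, t.1.2.1), t.2.2.2.1⟩

/-- The two upper points of a triple. -/
def upperPair (t : C.TripleOver Φ a) : C.Pair := ⟨(t.1.2.1, t.1.2.2), t.2.2.1⟩

/-- The edge `I × {A}` on which a triple lies. -/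
def lowerEdge (t : C.TripleOver Φ a) : C.Itv × C.Pt := (C.bdry t.lowerPair, t.1.2.2)

/-- The edge `{P} × J` on which a triple lies. -/
def upperEdge (t : C.TripleOver Φ a) : C.Pt × C.Itv := (t.1.1, C.bdry t.upperPair)

/-- The sign of a triple. -/
def sign (s : C.Pt → ZMod 2) (t : C.TripleOver Φ a) : ZMod 2 := s t.1.1 + s t.1.2.1 + s t.1.2.2

theorem isPairing_lowerEdge {s : C.Pt → ZMod 2} (hs : C.IsSignAssignment s) :
    IsPairing (lowerEdge (Φ := Φ) (a := a)) (sign s) := by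
  have h := isPairing_bdry hs
  refine ⟨fun t => ?_, fun t t' htt h' => ?_⟩
  · set q := h.partner t.lowerPair with hq
    have hb : C.bdry q = C.bdry t.lowerPair := h.apply_partner _
    have e1 : C.src q.1.2 = C.src t.1.2.1 := by
      rw [← C.itvSrc_bdry, hb, C.itvSrc_bdry]; rfl
    have e2 : C.tgt q.1.1 = C.tgt t.1.1 := by
      rw [← C.itvTgt_bdry, hb, C.itvTgt_bdry]; rfl
    refine ⟨⟨(q.1.1, q.1.2, t.1.2.2), t.2.1, t.2.2.1.trans e1.symm, q.2, e2 ▸ t.2.2.2.2⟩, ?_, ?_⟩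
    · intro hh
      exact h.partner_ne t.lowerPair (congrArg lowerPair hh)
    · exact Prod.ext hb rfl
  · have h1 : t.1.2.2 = t'.1.2.2 := congrArg (fun e : C.Itv × C.Pt => e.2) h'
    have h2 := h.flip t.lowerPair t'.lowerPair
      (fun hh => htt (Subtype.ext (Prod.ext (congrArg (fun p : C.Pair => p.1.1) hh)
        (Prod.ext (congrArg (fun p : C.Pair => p.1.2) hh) h1)))) (congrArg (fun e : C.Itv × C.Pt => e.1) h')
    simp only [pairSign, lowerPair] at h2
    simp only [sign, h1]
    grind

theorem isPairing_upperEdge {s : C.Pt → ZMod 2} (hs : C.IsSignAssignment s) :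
    IsPairing (upperEdge (Φ := Φ) (a := a)) (sign s) := by
  have h := isPairing_bdry hs
  refine ⟨fun t => ?_, fun t t' htt h' => ?_⟩
  · set q := h.partner t.upperPair with hq
    have hb : C.bdry q = C.bdry t.upperPair := h.apply_partner _
    have e1 : C.src q.1.2 = C.src t.1.2.2 := by
      rw [← C.itvSrc_bdry, hb, C.itvSrc_bdry]; rfl
    have e2 : C.tgt q.1.1 = C.tgt t.1.2.1 := by
      rw [← C.itvTgt_bdry, hb, C.itvTgt_bdry]; rfl
    refine ⟨⟨(t.1.1, q.1.1, q.1.2), e1.trans t.2.1, q.2, e2.trans t.2.2.2.1, t.2.2.2.2⟩, ?_, ?_⟩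
    · intro hh
      exact h.partner_ne t.upperPair (congrArg upperPair hh)
    · exact Prod.ext rfl hb
  · have h1 : t.1.1 = t'.1.1 := congrArg (fun e : C.Pt × C.Itv => e.1) h'
    have h2 := h.flip t.upperPair t'.upperPair
      (fun hh => htt (Subtype.ext (Prod.ext h1 (Prod.ext (congrArg (fun p : C.Pair => p.1.1) hh)
        (congrArg (fun p : C.Pair => p.1.2) hh))))) (congrArg (fun e : C.Pt × C.Itv => e.2) h')
    simp only [pairSign, upperPair] at h2
    simp only [sign, h1]
    grind

theorem gr_eq (t : C.TripleOver Φ a) : C.gr a = C.gr (C.tgt t.1.1) + 3 := by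
  have h1 := C.gr_src t.1.1
  have h2 := C.gr_src t.1.2.1
  have h3 := C.gr_src t.1.2.2
  rw [t.2.1] at h3
  rw [t.2.2.1] at h3
  rw [t.2.2.2.1] at h2
  omega

end TripleOver

/-- The sign of a triple selects one of the two corners of each edge, for both kinds of edges, so
that the sums over edges and components turn into one sum over corners. -/
theorem sum_bdryValue {s : C.Pt → ZMod 2} (hs : C.IsSignAssignment s) (f : C.PreFraming)
    (a d : C.Ob) :
    ∑ K : C.BdryComp a d, (1 + bdryValue s f K) = (Fintype.card (C.BdryComp a d) : ZMod 2) +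
      ∑ t : C.TripleOver (fun c => c = d) a, t.sign s * (f.itv (C.bdry t.lowerPair) +
        (1 + s t.1.1 + f.itv (C.bdry t.upperPair))) := by
  have h : ∀ K : C.BdryComp a d, bdryValue s f K =
      ∑ t : C.TripleOver (fun c => c = d) a,
      if (Quot.mk _ t : C.BdryComp a d) = K then t.sign s *
        (f.itv (C.bdry t.lowerPair) + (1 + s t.1.1 + f.itv (C.bdry t.upperPair))) else 0 := by
    intro K
    have p1 : IsPairing (Triple.lower (a := a) (d := d))
        fun t => TripleOver.sign (Φ := fun c => c = d) s t :=
      TripleOver.isPairing_lowerEdge (Φ := fun c => c = d) hs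
    have p2 : IsPairing (Triple.upper (a := a) (d := d))
        fun t => TripleOver.sign (Φ := fun c => c = d) s t :=
      TripleOver.isPairing_upperEdge (Φ := fun c => c = d) hs
    have e1 := p1.sum_edges (fun t => (Quot.mk _ t : C.BdryComp a d) = K)
      (fun t t' h ht => by rw [← ht]; exact Quot.sound (Or.inl h.symm)) fun e => f.itv e.1
    have e2 := p2.sum_edges (fun t => (Quot.mk _ t : C.BdryComp a d) = K)
      (fun t t' h ht => by rw [← ht]; exact Quot.sound (Or.inr h.symm))
      fun e => 1 + s e.1 + f.itv e.2
    have e3 := congrArg₂ (fun x y => x + y) e1 e2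
    rw [← Finset.sum_add_distrib] at e3
    refine Eq.trans ?_ (e3.trans ?_)
    · rw [bdryValue]; congr!
    refine Finset.sum_congr rfl fun t _ => ?_
    split_ifs
    · simp only [Triple.lower, Triple.upper, TripleOver.lowerPair, TripleOver.upperPair]; ring
    · simp
  simp only [Finset.sum_add_distrib, Finset.sum_const, Finset.card_univ, nsmul_eq_mul, mul_one, h]
  congr 1
  rw [Finset.sum_comm]
  exact Finset.sum_congr rfl fun v _ => by rw [Finset.sum_ite_eq]; simp

/-- The grading condition can be dropped because there are no triples in other degrees. -/
theorem isFraming_iff [IsEmpty C.Circ] {s : C.Pt → ZMod 2} (hs : C.IsSignAssignment s)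
    (f : C.PreFraming) : C.IsFraming s f ↔ ∀ a d : C.Ob,
      (Fintype.card (C.BdryComp a d) : ZMod 2) +
      ∑ t : C.TripleOver (fun c => c = d) a, t.sign s * (f.itv (C.bdry t.lowerPair) +
        (1 + s t.1.1 + f.itv (C.bdry t.upperPair))) = 0 := by
  have h : ∀ a d : C.Ob,
    (∑ e : C.Circ × C.Pt with C.src e.2 = a ∧ C.tgt e.2 = C.circSrc e.1 ∧ C.circTgt e.1 = d,
      (1 + (1 + f.circ e.1))) = 0 ∧
    (∑ e : C.Pt × C.Circ with C.circSrc e.2 = a ∧ C.circTgt e.2 = C.src e.1 ∧ C.tgt e.1 = d,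
      (1 + (1 + f.circ e.2))) = 0 := fun a d =>
    ⟨Finset.sum_eq_zero fun e _ => isEmptyElim e.1, Finset.sum_eq_zero fun e _ => isEmptyElim e.2⟩
  constructor
  · intro hf a d
    by_cases hg : C.gr a = C.gr d + 3
    · have := hf a d hg
      rwa [(h a d).1, (h a d).2, add_zero, add_zero, sum_bdryValue hs] at this
    · have h0 : IsEmpty (C.TripleOver (fun c => c = d) a) := ⟨fun t => hg (by
        have := t.gr_eq
        rwa [t.2.2.2.2] at this)⟩
      have h1 : IsEmpty (C.BdryComp a d) := ⟨fun K => h0.false K.out⟩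
      simp
  · intro hf a d _
    rw [(h a d).1, (h a d).2, add_zero, add_zero, sum_bdryValue hs]
    exact hf a d

section Components

variable (Φ : C.Ob → Prop) (a : C.Ob)

/-- Triples lie in the same component if they can be joined by edges. -/
def TripleOver.Adj (t t' : C.TripleOver Φ a) : Prop :=
  t.lowerEdge = t'.lowerEdge ∨ t.upperEdge = t'.upperEdge

instance : Fintype (Quot (TripleOver.Adj Φ a)) := Fintype.ofFinite _

def tripleOverEquiv : C.TripleOver Φ a ≃ Σ d : {d : C.Ob // Φ d}, C.TripleOver (fun c => c = d.1) a where
  toFun t := ⟨⟨C.tgt t.1.1, t.2.2.2.2⟩, ⟨t.1, t.2.1, t.2.2.1, t.2.2.2.1, rfl⟩⟩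
  invFun x := ⟨x.2.1, x.2.2.1, x.2.2.2.1, x.2.2.2.2.1, by
    have h : C.tgt x.2.1.1 = x.1.1 := x.2.2.2.2.2
    rw [h]; exact x.1.2⟩
  left_inv _ := rfl
  right_inv := by
    rintro ⟨⟨d, hd⟩, ⟨t, h1, h2, h3, h4⟩⟩
    change C.tgt t.1 = d at h4
    subst h4
    rfl

theorem card_components_tripleOver :
    Fintype.card (Quot (TripleOver.Adj Φ a)) =
      ∑ d : {d : C.Ob // Φ d}, Fintype.card (C.BdryComp a d.1) := by
  rw [← Fintype.card_sigma]
  refine Fintype.card_congr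
    { toFun := Quot.lift (fun t => ⟨⟨C.tgt t.1.1, t.2.2.2.2⟩, Quot.mk _ (tripleOverEquiv Φ a t).2⟩) ?_
      invFun := fun x => Quot.lift (fun t => Quot.mk _ ((tripleOverEquiv Φ a).symm ⟨x.1, t⟩)) ?_ x.2
      left_inv := ?_
      right_inv := ?_ }
  · rintro t t' h
    have hd : C.tgt t.1.1 = C.tgt t'.1.1 := by
      rcases h with h | h
      · have := congrArg (fun e => C.itvTgt e.1) h
        simp only [TripleOver.lowerEdge, C.itvTgt_bdry] at this
        exact this
      · exact congrArg (fun e => C.tgt e.1) h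
    obtain ⟨⟨P, B, A⟩, h1, h2, h3, h4⟩ := t
    obtain ⟨⟨P', B', A'⟩, h1', h2', h3', h4'⟩ := t'
    dsimp only at hd
    have key : ∀ (d d' : C.Ob) (hd : d = d') (g : Φ d) (g' : Φ d') (e : C.tgt P = d)
        (e' : C.tgt P' = d'),
        (⟨⟨d, g⟩, Quot.mk _ ⟨(P, B, A), h1, h2, h3, e⟩⟩ :
          Σ d : {d : C.Ob // Φ d}, C.BdryComp a d.1) =
        ⟨⟨d', g'⟩, Quot.mk _ ⟨(P', B', A'), h1', h2', h3', e'⟩⟩ := by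
      intro d d' hd g g' e e'
      subst hd
      have : (Quot.mk _ ⟨(P, B, A), h1, h2, h3, e⟩ : C.BdryComp a d) =
        Quot.mk _ ⟨(P', B', A'), h1', h2', h3', e'⟩ := Quot.sound h
      rw [this]
    exact key _ _ hd _ _ rfl rfl
  · intro t t' h
    exact Quot.sound h
  · intro q
    induction q using Quot.ind with | _ t => rfl
  · rintro ⟨⟨d, hd⟩, q⟩
    induction q using Quot.ind with | _ t =>
    obtain ⟨t, h1, h2, h3, h4⟩ := t
    dsimp only at h4
    subst h4
    rfl

/-- The framing conditions for all d satisfying Φ are added up. With Φ the support of a cochain φ,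
the triples then fit the corner sums of the quadratic form. -/
theorem framing_tripleOver [IsEmpty C.Circ] {s : C.Pt → ZMod 2} {f : C.PreFraming}
    (h : C.IsFramed s f) :
    (Fintype.card (Quot (TripleOver.Adj Φ a)) : ZMod 2) +
      ∑ t : C.TripleOver Φ a, t.sign s * (f.itv (C.bdry t.lowerPair) +
        (1 + s t.1.1 + f.itv (C.bdry t.upperPair))) = 0 := by
  rw [card_components_tripleOver, Nat.cast_sum, ← Equiv.sum_comp (tripleOverEquiv Φ a).symm,
    Fintype.sum_sigma, ← Finset.sum_add_distrib]
  exact Finset.sum_eq_zero fun d _ => (isFraming_iff h.1 f).1 h.2 a d.1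

end Components

end OneFlowCat

end

noncomputable section

/-! ### The fundamental identity for the quadratic form -/

namespace OneFlowCat

open scoped Classical

variable {C : OneFlowCat}

/-- The number of points `P ∈ M(c, d)` with `φ(d) = 1`. -/
def totOf (φ : C.Ob → ZMod 2) : C.Ob → ℕ := tot fun c => (φ c).val

theorem card_vert (φ : C.Ob → ZMod 2) (a : C.Ob) :
    Fintype.card (C.Vert φ a) = tot (totOf φ) a := by
  rw [Fintype.card_congr (vertEquiv φ a), Fintype.card_sigma]
  exact Finset.sum_congr rfl fun A _ => card_below φ _

/-- The intervals over `b` on which `φ` is `1`. -/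
def itvCount (s : C.Pt → ZMod 2) (φ : C.Ob → ZMod 2) (b : C.Ob) : ZMod 2 :=
  ∑ v : C.Vert φ b, pairSign s v.1

/-- The sum of the framings of the intervals over `b` on which `φ` is `1`. -/
def frameForm (s : C.Pt → ZMod 2) (f : C.PreFraming) (φ : C.Ob → ZMod 2) (b : C.Ob) : ZMod 2 :=
  ∑ v : C.Vert φ b, pairSign s v.1 * f.itv v.itv

/-- The total counts the ends of the intervals on which φ is 1. There are 2m of them for m
intervals, and choose2(2m) = m mod 2. -/
theorem choose2_tot_totOf {s : C.Pt → ZMod 2} (hs : C.IsSignAssignment s) (φ : C.Ob → ZMod 2)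
    (b : C.Ob) : choose2 (tot (totOf φ) b) = itvCount s φ b := by
  obtain ⟨χ, hχ⟩ := exists_isTour (C.Vert φ b)
  rw [← card_vert, ← choose2_card hχ]
  exact (isPairing_vert_itv hs).sum_tour hχ

abbrev OverSupport (φ : C.Ob → ZMod 2) (a : C.Ob) : Type := C.TripleOver (fun c => φ c = 1) a

variable {φ : C.Ob → ZMod 2} {a : C.Ob}

def overEquivLower (φ : C.Ob → ZMod 2) (a : C.Ob) :
    OverSupport φ a ≃ Σ A : C.Out a, C.Vert φ (C.tgt A.1) where
  toFun t := ⟨⟨t.1.2.2, t.2.1⟩, ⟨t.lowerPair, t.2.2.1.symm, t.2.2.2.2⟩⟩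
  invFun x := ⟨(x.2.1.1.1, x.2.1.1.2, x.1.1), x.1.2, x.2.2.1.symm, x.2.1.2, x.2.2.2⟩
  left_inv _ := rfl
  right_inv _ := rfl

def overEquivUpper (φ : C.Ob → ZMod 2) (a : C.Ob) :
    OverSupport φ a ≃ Σ p : C.PairOver a, Below φ p.1.bot where
  toFun t := ⟨⟨t.upperPair, t.2.1⟩, ⟨⟨t.1.1, t.2.2.2.2⟩, t.2.2.2.1.symm⟩⟩
  invFun x := ⟨(x.2.1.1, x.1.1.1.1, x.1.1.1.2), x.1.2, x.1.1.2, x.2.2.symm, x.2.1.2⟩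
  left_inv _ := rfl
  right_inv _ := rfl

theorem sum_over_lower (G : C.Pair → C.Pt → ZMod 2) :
    ∑ t : OverSupport φ a, G t.lowerPair t.1.2.2 =
      ∑ A : C.Out a, ∑ v : C.Vert φ (C.tgt A.1), G v.1 A.1 := by
  rw [← Fintype.sum_sigma', ← Equiv.sum_comp (overEquivLower φ a)]
  rfl

/-- The sum over the points `P ∈ M(c, d)` with `φ(d) = 1`. -/
def belowSum (φ : C.Ob → ZMod 2) (c : C.Ob) (g : C.Pt → ZMod 2) : ZMod 2 :=
  ∑ P : Below φ c, g P.1.1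

theorem sum_over_upper (G : C.Pt → C.Pair → ZMod 2) :
    ∑ t : OverSupport φ a, G t.1.1 t.upperPair =
      ∑ p : C.PairOver a, belowSum φ p.1.bot fun P => G P p.1 := by
  simp only [belowSum]
  rw [← Fintype.sum_sigma', ← Equiv.sum_comp (overEquivUpper φ a)]
  rfl

theorem belowSum_add (φ : C.Ob → ZMod 2) (c : C.Ob) (g g' : C.Pt → ZMod 2) :
    belowSum φ c (fun P => g P + g' P) = belowSum φ c g + belowSum φ c g' :=
  Finset.sum_add_distrib

theorem belowSum_mul_left (φ : C.Ob → ZMod 2) (c : C.Ob) (x : ZMod 2) (g : C.Pt → ZMod 2) :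
    belowSum φ c (fun P => x * g P) = x * belowSum φ c g :=
  (Finset.mul_sum _ _ _).symm

theorem belowSum_const (φ : C.Ob → ZMod 2) (c : C.Ob) (x : ZMod 2) :
    belowSum φ c (fun _ => x) = totOf φ c * x := by
  rw [belowSum, Finset.sum_const, Finset.card_univ, card_below, nsmul_eq_mul]; rfl

theorem belowSum_self (φ : C.Ob → ZMod 2) (c : C.Ob) (g : C.Pt → ZMod 2) :
    belowSum φ c (fun P => belowSum φ c fun P' => if P = P' then g P else 0) = belowSum φ c g := by
  refine Finset.sum_congr rfl fun P _ => ?_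
  change (∑ P' : Below φ c, if P.1.1 = P'.1.1 then g P.1.1 else 0) = g P.1.1
  rw [Finset.sum_eq_single P]
  · simp
  · intro P' _ h
    have : P.1.1 ≠ P'.1.1 := fun h' => h (Subtype.ext (Subtype.ext h'.symm))
    simp [this]
  · simp

theorem belowSum_ptTour (φ : C.Ob → ZMod 2) (c : C.Ob) :
    belowSum φ c (fun P => belowSum φ c fun P' => C.ptTour P P') = choose2 (totOf φ c) := by
  have h : IsTour fun P P' : Below φ c => C.ptTour P.1.1 P'.1.1 :=
    isTour_ptTour.comp (Subtype.val_injective.comp Subtype.val_injective)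
  have := choose2_card h
  rw [card_below] at this
  exact this

/-- The order of triples by `A`, then by `B`, then by `P`. -/
def tripleTour (φ : C.Ob → ZMod 2) (a : C.Ob) : OverSupport φ a → OverSupport φ a → ZMod 2 :=
  lexTour (fun t => t.1.2.2) C.ptTour fun t t' => C.pairTour t.lowerPair t'.lowerPair

/-- The order by A, then B, then P is lexicographic in two ways: with respect to A and the lower
pair, or to the upper pair and P. The first reading suits the edges I × {A}, the second the edges
{P} × J. -/
theorem tripleTour_eq (t t' : OverSupport φ a) : tripleTour φ a t t' =
    lexTour TripleOver.upperPair C.pairTour (fun t t' => C.ptTour t.1.1 t'.1.1) t t' := by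
  by_cases hA : t.1.2.2 = t'.1.2.2 <;> by_cases hB : t.1.2.1 = t'.1.2.1 <;>
    simp [tripleTour, lexTour, pairTour, TripleOver.upperPair, TripleOver.lowerPair, hA, hB,
      Subtype.ext_iff, Prod.ext_iff]

theorem isTour_tripleTour : IsTour (tripleTour φ a) := by
  refine isTour_ptTour.lexTour (fun t => isTour_pairTour.self _) fun t t' h hA =>
    isTour_pairTour.swap _ _ fun h' => h (Subtype.ext ?_)
  have h1 := congrArg (fun p : C.Pair => p.1.1) h'
  have h2 := congrArg (fun p : C.Pair => p.1.2) h'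
  exact Prod.ext h1 (Prod.ext h2 hA)

/-- The order of the edges `I × {A}` by `A`, then by `I`. -/
def lowerTour (C : OneFlowCat) : C.Itv × C.Pt → C.Itv × C.Pt → ZMod 2 :=
  lexTour Prod.snd C.ptTour fun x y => C.itvTour x.1 y.1

/-- The order of the edges `{P} × J` by `J`, then by `P`. -/
def upperTour (C : OneFlowCat) : C.Pt × C.Itv → C.Pt × C.Itv → ZMod 2 :=
  lexTour Prod.snd C.itvTour fun x y => C.ptTour x.1 y.1

theorem isTour_lowerTour : IsTour (lowerTour C) :=
  isTour_ptTour.lexTour (fun _ => isTour_itvTour.self _) fun _ _ hxy h =>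
    isTour_itvTour.swap _ _ fun h' => hxy (Prod.ext h' h)

theorem isTour_upperTour : IsTour (upperTour C) :=
  isTour_itvTour.lexTour (fun _ => isTour_ptTour.self _) fun _ _ hxy h =>
    isTour_ptTour.swap _ _ fun h' => hxy (Prod.ext h' h)

/-- Triples with different A are compared by A in both orders and contribute evenly. For fixed A,
what remains is the circle-count term over the target of A, with all signs shifted by s(A); the
shift costs s(A) for each interval. -/
theorem tourPair_lower {s : C.Pt → ZMod 2} (hs : C.IsSignAssignment s) :
    tourPair (edgeOrder TripleOver.lowerEdge (lowerTour C) (TripleOver.sign s)) (tripleTour φ a) =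
      ∑ A : C.Out a, (orderForm s φ (C.tgt A.1) + s A.1 * itvCount s φ (C.tgt A.1)) := by
  have hcard : ∀ b, (Fintype.card (C.Vert φ b) : ZMod 2) = 0 := fun b => by
    have := (isPairing_vert_itv (φ := φ) (a := b) hs).sum_comp_eq_zero fun _ => 1
    simpa using this
  have e1 : ∀ t t' : OverSupport φ a,
      edgeOrder TripleOver.lowerEdge (lowerTour C) (TripleOver.sign s) t t' * tripleTour φ a t t' =
      C.ptTour t.1.2.2 t'.1.2.2 + if t.1.2.2 = t'.1.2.2 then
        edgeOrder C.bdry C.itvTour (fun p => pairSign s p + s t.1.2.2) t.lowerPair t'.lowerPair *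
          C.pairTour t.lowerPair t'.lowerPair else 0 := by
    intro t t'
    by_cases hA : t.1.2.2 = t'.1.2.2
    · have hp : t.lowerPair = t'.lowerPair ↔ t = t' := by
        constructor
        · intro h'
          have h1 := congrArg (fun p : C.Pair => p.1.1) h'
          have h2 := congrArg (fun p : C.Pair => p.1.2) h'
          exact Subtype.ext (Prod.ext h1 (Prod.ext h2 hA))
        · rintro rfl; rfl
      have he : t.lowerEdge = t'.lowerEdge ↔ C.bdry t.lowerPair = C.bdry t'.lowerPair := by
        simp [TripleOver.lowerEdge, hA]
      have hsg : t.sign s = pairSign s t.lowerPair + s t'.1.2.2 := by rw [← hA]; rfl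
      simp only [edgeOrder, lexTour, tripleTour, hA, if_true, isTour_ptTour.self, zero_add, hp, he,
        hsg]
      by_cases hb : C.bdry t.lowerPair = C.bdry t'.lowerPair
      · simp only [hb, if_true]
      · simp only [hb, if_false, lowerTour, lexTour, TripleOver.lowerEdge, hA, if_true]
    · have he : t.lowerEdge ≠ t'.lowerEdge := fun h =>
        hA (congrArg (fun e : C.Itv × C.Pt => e.2) h)
      have hl : lowerTour C t.lowerEdge t'.lowerEdge = C.ptTour t.1.2.2 t'.1.2.2 := if_neg hA
      simp only [edgeOrder, lexTour, tripleTour, hA, he, if_false, hl, add_zero]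
      exact ZMod.two_mul_self _
  have e2 : ∀ t : OverSupport φ a, ∑ t' : OverSupport φ a,
      edgeOrder TripleOver.lowerEdge (lowerTour C) (TripleOver.sign s) t t' * tripleTour φ a t t' =
      ∑ w : C.Vert φ (C.tgt t.1.2.2), edgeOrder C.bdry C.itvTour
        (fun p => pairSign s p + s t.1.2.2) t.lowerPair w.1 * C.pairTour t.lowerPair w.1 := by
    intro t
    simp only [e1, Finset.sum_add_distrib]
    rw [sum_over_lower fun p A => C.ptTour t.1.2.2 A, sum_over_lower fun p A => if t.1.2.2 = A then
      edgeOrder C.bdry C.itvTour (fun p => pairSign s p + s t.1.2.2) t.lowerPair p *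
          C.pairTour t.lowerPair p else 0]
    simp only [Finset.sum_const, Finset.card_univ, nsmul_eq_mul, hcard, zero_mul, mul_zero]
    rw [zero_add, Finset.sum_eq_single ⟨t.1.2.2, t.2.1⟩]
    · simp
    · intro A _ hA
      have : t.1.2.2 ≠ A.1 := fun h => hA (Subtype.ext h.symm)
      simp [this]
    · simp
  simp only [tourPair, e2]
  rw [sum_over_lower fun p A => ∑ w : C.Vert φ (C.tgt A), edgeOrder C.bdry C.itvTour
        (fun p => pairSign s p + s A) p w.1 * C.pairTour p w.1]
  refine Finset.sum_congr rfl fun A _ => ?_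
  have p0 := isPairing_vert_itv (φ := φ) (a := C.tgt A.1) hs
  have p1 : IsPairing (Vert.itv (φ := φ) (a := C.tgt A.1)) fun v => pairSign s v.1 + s A.1 :=
    ⟨p0.exists_ne, fun v w h h' => by have := p0.flip v w h h'; grind⟩
  have e3 := p0.tourPair_edgeOrder_sign p1 C.itvTour
    (isTour_pairTour.comp (Subtype.val_injective (p := fun p : C.Pair =>
      C.src p.1.2 = C.tgt A.1 ∧ φ (C.tgt p.1.1) = 1)))
  rw [← orderForm_eq_tourPair] at e3
  have e4 : ∀ v w : C.Vert φ (C.tgt A.1), edgeOrder C.bdry C.itvTour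
      (fun p => pairSign s p + s A.1) v.1 w.1 = edgeOrder Vert.itv C.itvTour
      (fun v => pairSign s v.1 + s A.1) v w := fun v w => edgeOrder_comp Subtype.val_injective v w
  simp only [e4]
  rw [tourPair] at e3
  rw [e3, itvCount, Finset.mul_sum]
  congr 1
  refine Finset.sum_congr rfl fun v _ => ?_
  grind

/-- If the upper pairs lie on different intervals, the points P enter only through their number,
which gives the order form of `totOf φ`. The two ends of one interval add choose2 of the number of
points P, and s(P) for each of them as the sign of a triple includes s(P). Triples with the same
upper pair cancel between the ends. -/
theorem tourPair_upper {s : C.Pt → ZMod 2} (hs : C.IsSignAssignment s) :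
    tourPair (tripleTour φ a) (edgeOrder TripleOver.upperEdge (upperTour C) (TripleOver.sign s)) =
      orderForm s (fun c => (totOf φ c : ZMod 2)) a +
      ∑ I : C.ItvOver a, (choose2 (totOf φ (C.itvTgt I.1)) + belowSum φ (C.itvTgt I.1) s) := by
  have h := isPairing_bdryOver hs a
  let X : C.Pair → C.Pair → ZMod 2 := fun p q => itvOrder s p q * C.pairTour p q
  have hX : ∀ p, X p p = 0 := fun p => by simp [X, isTour_pairTour.self]
  have e1 : ∀ t t' : OverSupport φ a, tripleTour φ a t t' *
      edgeOrder TripleOver.upperEdge (upperTour C) (TripleOver.sign s) t t' =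
      if t.upperPair = t'.upperPair then C.ptTour t.1.1 t'.1.1 else
      if C.bdry t.upperPair = C.bdry t'.upperPair then
        (if t.1.1 = t'.1.1 then X t.upperPair t'.upperPair else 0) +
          C.pairTour t.upperPair t'.upperPair *
          (C.ptTour t.1.1 t'.1.1 + if t.1.1 = t'.1.1 then s t.1.1 else 0)
      else X t.upperPair t'.upperPair := by
    intro t t'
    rw [tripleTour_eq]
    by_cases hp : t.upperPair = t'.upperPair
    · have hp1 : t.1.2.1 = t'.1.2.1 := congrArg (fun p : C.Pair => p.1.1) hp
      have hp2 : t.1.2.2 = t'.1.2.2 := congrArg (fun p : C.Pair => p.1.2) hp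
      by_cases hP : t.1.1 = t'.1.1
      · have htt : t = t' := Subtype.ext (Prod.ext hP (Prod.ext hp1 hp2))
        subst htt
        simp [edgeOrder, lexTour, isTour_ptTour.self]
      · simp [edgeOrder, lexTour, upperTour, TripleOver.upperEdge, hp, hP, ZMod.two_mul_self]
    · have htt : t ≠ t' := fun h => hp (h ▸ rfl)
      by_cases hb : C.bdry t.upperPair = C.bdry t'.upperPair
      · by_cases hP : t.1.1 = t'.1.1
        · have hsg : t.sign s = s t.1.1 + pairSign s t.upperPair := add_assoc _ _ _
          simp only [edgeOrder, lexTour, itvOrder, TripleOver.upperEdge, hp, hb, hP, htt, if_true,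
            if_false, hsg, X, isTour_ptTour.self]
          ring
        · simp [edgeOrder, lexTour, upperTour, TripleOver.upperEdge, hp, hb, hP]
      · simp only [edgeOrder, lexTour, itvOrder, upperTour, TripleOver.upperEdge, hp, hb, if_false,
          X, Prod.mk.injEq, and_false]
        ring
  have e2 : ∀ p q : C.PairOver a, (belowSum φ p.1.bot fun P => belowSum φ q.1.bot fun P' =>
      if p.1 = q.1 then C.ptTour P P' else if C.bdry p.1 = C.bdry q.1 then
        (if P = P' then X p.1 q.1 else 0) + C.pairTour p.1 q.1 *
          (C.ptTour P P' + if P = P' then s P else 0) else X p.1 q.1) =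
      totOf φ p.1.bot * totOf φ q.1.bot * X p.1 q.1 +
      (if q = p then choose2 (totOf φ p.1.bot) else 0) +
      if q = h.partner p then C.pairTour p.1 (h.partner p).1 *
        (choose2 (totOf φ p.1.bot) + belowSum φ p.1.bot s) else 0 := by
    intro p q
    by_cases hpq : q = p
    · subst hpq
      simp only [if_true, belowSum_ptTour, hX, mul_zero, zero_add, (h.partner_ne q).symm, if_false,
        add_zero]
    · have hpq' : p.1 ≠ q.1 := fun h => hpq (Subtype.ext h.symm)
      by_cases hq : q = h.partner p
      · have hb : C.bdry p.1 = C.bdry q.1 := by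
          have := congrArg Subtype.val (h.apply_partner p)
          rw [← hq] at this; exact this.symm
        have hbot : q.1.bot = p.1.bot := by
          rw [Pair.bot, Pair.bot, ← C.itvTgt_bdry, ← C.itvTgt_bdry, hb]
        rw [hbot]
        simp only [hpq', hpq, hb, if_true, if_false, ← hq, belowSum_add, belowSum_mul_left,
          belowSum_ptTour]
        rw [belowSum_self φ _ fun _ => X p.1 q.1, belowSum_self, belowSum_const]
        have := ZMod.two_mul_self (totOf φ p.1.bot : ZMod 2)
        grind
      · have hb : C.bdry p.1 ≠ C.bdry q.1 := fun hh => hq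
          (h.eq_partner (Subtype.ext hh.symm) hpq)
        simp only [hpq', hpq, hb, hq, if_false, belowSum_const]
        ring
  have e3 : tourPair (tripleTour φ a)
      (edgeOrder TripleOver.upperEdge (upperTour C) (TripleOver.sign s)) =
      ∑ p : C.PairOver a, ∑ q : C.PairOver a, (belowSum φ p.1.bot fun P => belowSum φ q.1.bot
        fun P' => if p.1 = q.1 then C.ptTour P P' else if C.bdry p.1 = C.bdry q.1 then
        (if P = P' then X p.1 q.1 else 0) + C.pairTour p.1 q.1 *
          (C.ptTour P P' + if P = P' then s P else 0) else X p.1 q.1) := by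
    simp only [tourPair, e1]
    refine (sum_over_upper fun P p => ∑ t' : OverSupport φ a,
      if p = t'.upperPair then C.ptTour P t'.1.1 else
      if C.bdry p = C.bdry t'.upperPair then
        (if P = t'.1.1 then X p t'.upperPair else 0) + C.pairTour p t'.upperPair *
          (C.ptTour P t'.1.1 + if P = t'.1.1 then s P else 0)
      else X p t'.upperPair).trans ?_
    refine Finset.sum_congr rfl fun p _ => ?_
    refine Eq.trans ?_ Finset.sum_comm
    refine Finset.sum_congr rfl fun P _ => ?_
    exact sum_over_upper fun P' q => if p.1 = q then C.ptTour P.1.1 P' else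
      if C.bdry p.1 = C.bdry q then
        (if P.1.1 = P' then X p.1 q else 0) + C.pairTour p.1 q *
          (C.ptTour P.1.1 P' + if P.1.1 = P' then s P.1.1 else 0)
      else X p.1 q
  rw [e3]
  simp only [e2, Finset.sum_add_distrib, Finset.sum_ite_eq', Finset.mem_univ, if_true]
  rw [sum_bot_eq_zero hs a fun c => choose2 (totOf φ c), add_zero]
  let g : C.Ob → ZMod 2 := fun c => choose2 (totOf φ c) + belowSum φ c s
  have e4 : ∑ p : C.PairOver a, C.pairTour p.1 (h.partner p).1 * g p.1.bot =
      ∑ I : C.ItvOver a, g (C.itvTgt I.1) := by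
    rw [sum_itvOver hs, h.sum_eq]
    refine Finset.sum_congr rfl fun p _ => ?_
    have h1 := isTour_pairTour.swap p.1 (h.partner p).1 fun hh =>
      h.partner_ne p (Subtype.ext hh.symm)
    have hbot : (h.partner p).1.bot = p.1.bot := by
      rw [← bdryOver_bot, ← bdryOver_bot, h.apply_partner]
    rw [h.partner_partner, hbot, bdryOver_bot]
    grind
  have e5 : ∑ p : C.PairOver a, ∑ q : C.PairOver a,
      (totOf φ p.1.bot : ZMod 2) * totOf φ q.1.bot * X p.1 q.1 =
      orderForm s (fun c => (totOf φ c : ZMod 2)) a := by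
    simp only [orderForm, X, mul_assoc]
  rw [e5, ← Finset.sum_add_distrib]
  exact congrArg _ e4

theorem sum_lower_framing {s : C.Pt → ZMod 2} (hs : C.IsSignAssignment s) (f : C.PreFraming) :
    ∑ t : OverSupport φ a, t.sign s * f.itv (C.bdry t.lowerPair) =
      ∑ A : C.Out a, frameForm s f φ (C.tgt A.1) := by
  have := sum_over_lower (φ := φ) (a := a) fun p A => (pairSign s p + s A) * f.itv (C.bdry p)
  refine this.trans (Finset.sum_congr rfl fun A _ => ?_)
  have h0 := (isPairing_vert_itv (φ := φ) (a := C.tgt A.1) hs).sum_comp_eq_zero f.itv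
  simp only [add_mul, Finset.sum_add_distrib, ← Finset.mul_sum]
  change _ + s A.1 * ∑ v : C.Vert φ (C.tgt A.1), f.itv v.itv = _
  rw [h0, mul_zero, add_zero]
  rfl

/-- The part s(P)(s(P) + f(J)) of the summand is the same at both ends of J and cancels. In the
rest, the sign of the upper pair selects one end of J. -/
theorem sum_upper_framing {s : C.Pt → ZMod 2} (hs : C.IsSignAssignment s) (f : C.PreFraming) :
    ∑ t : OverSupport φ a, t.sign s * (s t.1.1 + f.itv (C.bdry t.upperPair)) =
      ∑ I : C.ItvOver a, (totOf φ (C.itvTgt I.1) * f.itv I.1 + belowSum φ (C.itvTgt I.1) s) := by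
  have e1 := sum_over_upper (φ := φ) (a := a) fun P p =>
    (s P + pairSign s p) * (s P + f.itv (C.bdry p))
  have e2 : ∀ t : OverSupport φ a, t.sign s * (s t.1.1 + f.itv (C.bdry t.upperPair)) =
      (s t.1.1 + pairSign s t.upperPair) * (s t.1.1 + f.itv (C.bdry t.upperPair)) := fun t => by
    simp only [TripleOver.sign, pairSign, TripleOver.upperPair, add_assoc]
  simp only [e2]
  rw [e1, sum_itvOver hs]
  have e3 : ∀ p : C.PairOver a, (belowSum φ p.1.bot fun P =>
      (s P + pairSign s p.1) * (s P + f.itv (C.bdry p.1))) =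
      (belowSum φ (C.itvTgt (bdryOver a p).1) fun P => s P * (s P + f.itv (bdryOver a p).1)) +
      pairSign s p.1 * (totOf φ (C.itvTgt (bdryOver a p).1) * f.itv (bdryOver a p).1 +
        belowSum φ (C.itvTgt (bdryOver a p).1) s) := by
    intro p
    simp only [add_mul, belowSum_add, belowSum_mul_left, belowSum_const, bdryOver_bot]
    simp only [bdryOver]
    ring
  simp only [e3, Finset.sum_add_distrib]
  rw [(isPairing_bdryOver hs a).sum_comp_eq_zero fun I =>
    belowSum φ (C.itvTgt I.1) fun P => s P * (s P + f.itv I.1), zero_add]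

/-- For a framed `1`-flow category, the quadratic form of the reduction of a coboundary is a
coboundary. -/
theorem sqForm_totOf [IsEmpty C.Circ] {s : C.Pt → ZMod 2} {f : C.PreFraming}
    (h : C.IsFramed s f) (φ : C.Ob → ZMod 2) (a : C.Ob) :
    sqForm s f (totOf φ) a =
      C.coboundary (fun b => orderForm s φ b + frameForm s f φ b) a := by
  have hs := h.1
  have p1 := TripleOver.isPairing_lowerEdge (Φ := fun c => φ c = 1) (a := a) hs
  have p2 := TripleOver.isPairing_upperEdge (Φ := fun c => φ c = 1) (a := a) hs
  have hf : (Fintype.card (Quot (TripleOver.Adj (fun c => φ c = 1) a)) : ZMod 2) +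
      ∑ t : OverSupport φ a, t.sign s * (f.itv (C.bdry t.lowerPair) +
        (1 + s t.1.1 + f.itv (C.bdry t.upperPair))) = 0 := by
    rw [← framing_tripleOver (fun c => φ c = 1) a h]
    congr!
  -- Circles of all ∂M(a, d) are counted by comparing the lower and the upper edges through the
  -- lexicographic order. The sum of this order cancels against the constant 1 in the framing
  -- condition, and the terms Σ s(P) of the upper edges cancel too.
  rw [p1.card_components p2 (TripleOver.Adj (fun c => φ c = 1) a) (fun _ _ h => h) (fun _ _ _ h => h) isTour_lowerTour
    isTour_upperTour, tourPair_triangle (p1.isTour_edgeOrder isTour_lowerTour) isTour_tripleTour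
    (p2.isTour_edgeOrder isTour_upperTour), tourPair_lower hs, tourPair_upper hs,
    p1.sum_tour isTour_tripleTour] at hf
  have e1 := sum_lower_framing (φ := φ) (a := a) hs f
  have e2 := sum_upper_framing (φ := φ) (a := a) hs f
  simp only [sqForm, choose2_tot_totOf hs, coboundary_apply, mul_add, mul_one, add_assoc,
    Finset.sum_add_distrib] at hf e1 e2 ⊢
  have key : ∀ r u w x y z t v l m n : ZMod 2, l = t → m + n = v + y →
      r + (u + (w + (x + (y + (z + (l + (z + (m + n)))))))) = 0 → v + (x + (w + u)) = r + t := by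
    intro r u w x y z t v l m n h1 h2 h3
    grind
  exact key _ _ _ _ _ _ _ _ _ _ _ e1 e2 hf

end OneFlowCat

end

noncomputable section

/-! ### The second Steenrod square of a framed `1`-flow category without circles -/

/-- A map all of whose fibres have an even number of elements is invariant under a fixed point free
involution with two-coloured orbits. -/
theorem exists_involution {V W : Type} [Finite V] [Finite W] (g : V → W)
    (h : ∀ w, Even (Nat.card {v : V // g v = w})) :
    ∃ (τ : V → V) (κ : V → Bool), (∀ v, g (τ v) = g v) ∧ (∀ v, τ (τ v) = v) ∧
      ∀ v, κ (τ v) = !κ v := by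
  choose m hm using h
  have e : ∀ w, Nonempty ({v : V // g v = w} ≃ Fin (m w) × Bool) := fun w => by
    refine Finite.card_eq.1 ?_
    rw [hm w, Nat.card_prod, Nat.card_fin, Nat.card_eq_fintype_card (α := Bool), Fintype.card_bool]
    omega
  obtain ⟨E, hE⟩ : ∃ E : V ≃ Σ w, Fin (m w) × Bool, ∀ v, (E v).1 = g v :=
    ⟨(Equiv.sigmaFiberEquiv g).symm.trans (Equiv.sigmaCongrRight fun w => (e w).some),
      fun _ => rfl⟩
  let T : (Σ w, Fin (m w) × Bool) → Σ w, Fin (m w) × Bool := fun x => ⟨x.1, x.2.1, !x.2.2⟩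
  let κ : (Σ w, Fin (m w) × Bool) → Bool := fun x => x.2.2
  have hT : ∀ x, T (T x) = x := fun x => by simp [T]
  refine ⟨fun v => E.symm (T (E v)), fun v => κ (E v), fun v => ?_, fun v => ?_, fun v => ?_⟩
  · rw [← hE, ← hE, Equiv.apply_symm_apply]
  · beta_reduce
    rw [Equiv.apply_symm_apply, hT, Equiv.symm_apply_apply]
  · beta_reduce
    rw [Equiv.apply_symm_apply]

namespace OneFlowCat

open scoped Classical

variable {C : OneFlowCat} {s : C.Pt → ZMod 2} {f : C.PreFraming} {k : ℤ}

theorem cast_totOf (φ : C.Ob → ZMod 2) (b : C.Ob) : (totOf φ b : ZMod 2) = C.coboundary φ b := by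
  simp only [totOf, cast_tot, ZMod.natCast_zmod_val]

theorem even_totOf {φ : C.Ob → ZMod 2} (hφ : C.coboundary φ = 0) (b : C.Ob) :
    Even (totOf φ b) := by
  have := cast_totOf φ b
  rw [hφ, Pi.zero_apply, ZMod.natCast_eq_zero_iff] at this
  exact even_iff_two_dvd.2 this

theorem nonempty_matching {φ : C.Ob → ZMod 2} (hφ : C.coboundary φ = 0) :
    Nonempty (C.Matching φ) := by
  obtain ⟨τ, κ, h1, h2, h3⟩ := exists_involution
    (fun B : {B : C.Pt // φ (C.tgt B) = 1} => C.src B.1) fun b => by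
      rw [Nat.card_eq_fintype_card]
      exact (card_below φ b).symm ▸ even_totOf hφ b
  exact ⟨⟨τ, κ, h1, h2, h3⟩⟩

/-- In each `Γ(a, φ)` the intervals and the matching are two pairings of the vertices; a common
two-colouring is a direction. -/
theorem nonempty_direction (hs : C.IsSignAssignment s) {φ : C.Ob → ZMod 2} (m : C.Matching φ) :
    Nonempty m.Direction := by
  choose o h1 h2 using fun a => (isPairing_vert_itv (φ := φ) (a := a) hs).exists_common
    m.isPairing_edge_first
  have key : ∀ x y : ZMod 2, x + y = 1 → decide (x = 1) ≠ decide (y = 1) := by decide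
  exact ⟨{
    leaves := fun {a} v => decide (o a v = 1)
    leaves_itv := fun v w hvw h => key _ _ ((h1 _).flip v w hvw h)
    leaves_joins := fun {a} v w h => key _ _ ((h2 a).flip v w
      (by rw [m.joins_iff.1 h]; exact fun h' => m.partner_ne _ (congrArg Vert.lowerPt h'.symm))
      ((m.edge_eq_iff _ _).2 (Or.inr h))) }⟩

/-- A cochain which represents the second Steenrod square of a cocycle. -/
def sqRep (s : C.Pt → ZMod 2) (f : C.PreFraming) (φ : C.Ob → ZMod 2) : C.Ob → ZMod 2 :=
  sqForm s f fun c => (φ c).val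

theorem frameForm_eq (hs : C.IsSignAssignment s) (φ : C.Ob → ZMod 2) (a : C.Ob) :
    frameForm s f φ a = ∑ I : C.ItvOver a, φ (C.itvTgt I.1) * f.itv I.1 := by
  rw [sum_itvOver hs]
  refine (sum_vert fun p => pairSign s p * f.itv (C.bdry p)).trans ?_
  refine Finset.sum_congr rfl fun p _ => ?_
  rw [bdryOver_bot, bdryOver]
  ring

theorem sqRep_eq (hs : C.IsSignAssignment s) {φ : C.Ob → ZMod 2} (hφ : C.coboundary φ = 0) :
    sqRep s f φ = fun a => orderForm s φ a + frameForm s f φ a +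
      wcob s (fun b => (totOf φ b / 2 : ℕ)) a := by
  funext a
  have h : ∀ b, choose2 (tot (fun c => (φ c).val) b) = (totOf φ b / 2 : ℕ) := fun b => by
    obtain ⟨m, hm⟩ := (even_totOf hφ b).two_dvd
    have : tot (fun c => (φ c).val) b = 2 * m := hm
    rw [hm, this, choose2_two_mul]
    simp
  simp only [sqRep, sqForm, ZMod.natCast_zmod_val, choose2_val, add_zero, h, wcob, frameForm_eq hs]
  ring

/-- The representative is a sum of two cochains, whose coboundaries are the value of the form at
`totOf φ`, computed once by the framing identity and once by the formula for even cochains. They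
cancel. -/
theorem coboundary_sqRep [IsEmpty C.Circ] (h : C.IsFramed s f) {φ : C.Ob → ZMod 2}
    (hφ : C.coboundary φ = 0) : C.coboundary (sqRep s f φ) = 0 := by
  funext a
  have e1 := sqForm_totOf h φ a
  have e2 := sqForm_two_mul h.1 f (fun b => totOf φ b / 2) a
  have e3 : totOf φ = fun b => 2 * (totOf φ b / 2) :=
    funext fun b => (Nat.two_mul_div_two_of_even (even_totOf hφ b)).symm
  rw [← e3, e1] at e2
  rw [sqRep_eq h.1 hφ]
  change C.coboundary ((fun b => orderForm s φ b + frameForm s f φ b) +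
    wcob s fun b => (totOf φ b / 2 : ℕ)) a = 0
  rw [map_add, Pi.add_apply, e2, CharTwo.add_self_eq_zero]

theorem sqForm_mem {ν : C.Ob → ℕ} (hν : ∀ a, C.gr a ≠ k → ν a = 0) :
    sqForm s f ν ∈ C.cochains (k + 2) := by
  intro a ha
  have h1 : ∀ I : C.ItvOver a, ν (C.itvTgt I.1) = 0 := fun I => hν _ fun h => ha (by
    have := C.gr_itvSrc I.1; rw [I.2] at this; omega)
  have h2 : ∀ p : C.PairOver a, ν p.1.bot = 0 := fun p => by
    rw [← bdryOver_bot, h1]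
  have h3 : ∀ A : C.Out a, tot ν (C.tgt A.1) = 0 := fun A => Finset.sum_eq_zero fun B _ =>
    h2 ⟨⟨(B.1, A.1), B.2.symm⟩, A.2⟩
  simp [sqForm, orderForm, h1, h2, h3, choose2]

theorem sqRep_mem {φ : C.Ob → ZMod 2} (hφ : φ ∈ C.cochains k) :
    sqRep s f φ ∈ C.cochains (k + 2) :=
  sqForm_mem fun a ha => by rw [hφ a ha]; rfl

/-- The coboundary is homogeneous, so a primitive may be truncated to degree k - 1. -/
theorem mem_coboundaries {g h : C.Ob → ZMod 2} (hg : g ∈ C.cochains k)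
    (hh : g = C.coboundary h) : g ∈ C.coboundaries k := by
  refine ⟨fun b => if C.gr b = k - 1 then h b else 0, fun a ha => by simp [ha], ?_⟩
  funext a
  by_cases ha : C.gr a = k
  · rw [hh, coboundary_apply, coboundary_apply]
    refine Finset.sum_congr rfl fun A _ => ?_
    have := C.gr_src A.1
    rw [A.2] at this
    rw [if_pos (by omega)]
  · rw [hg a ha, coboundary_apply]
    refine Finset.sum_eq_zero fun A _ => ?_
    have := C.gr_src A.1
    rw [A.2] at this
    rw [if_neg (by omega)]

theorem sqRep_add (hs : C.IsSignAssignment s) {φ ψ : C.Ob → ZMod 2} (hφ : C.coboundary φ = 0)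
    (hψ : C.coboundary ψ = 0) : ∃ h : C.Ob → ZMod 2,
      sqRep s f (φ + ψ) = sqRep s f φ + sqRep s f ψ + C.coboundary h := by
  -- The lift to {0,1} is not additive; the carry 2xy is an even cochain, on which the form is a
  -- coboundary.
  have key : ∀ x y : ZMod 2, (x + y).val + 2 * (x.val * y.val) = x.val + y.val := by decide
  obtain ⟨h1, e1⟩ := sqForm_add hs f (fun c => ((φ + ψ) c).val)
    (fun c => 2 * ((φ c).val * (ψ c).val)) fun b => by
      simp only [cast_tot, ZMod.natCast_zmod_val]
      exact congrFun ((map_add C.coboundary φ ψ).trans (by rw [hφ, hψ, add_zero])) b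
  obtain ⟨h2, e2⟩ := sqForm_add hs f (fun c => (φ c).val) (fun c => (ψ c).val) fun b => by
      simp only [cast_tot, ZMod.natCast_zmod_val]
      exact congrFun hφ b
  simp only [Pi.add_apply, key, e2, sqForm_two_mul hs] at e1
  refine ⟨h1 + h2 + wcob s fun c => (((φ c).val * (ψ c).val : ℕ) : ZMod 2), funext fun a => ?_⟩
  simp only [map_add, Pi.add_apply, sqRep]
  have := e1 a
  grind

theorem sqRep_coboundary [IsEmpty C.Circ] (h : C.IsFramed s f) (ψ : C.Ob → ZMod 2) :
    ∃ g : C.Ob → ZMod 2, sqRep s f (C.coboundary ψ) = C.coboundary g := by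
  -- The unreduced coboundary differs from the lift of the reduced one by an even cochain, so all
  -- three identities for the form apply.
  have key : ∀ b, totOf ψ b = (C.coboundary ψ b).val + 2 * (totOf ψ b / 2) := fun b => by
    rw [← cast_totOf, ZMod.val_natCast]
    omega
  obtain ⟨h1, e1⟩ := sqForm_add h.1 f (fun c => (C.coboundary ψ c).val)
    (fun b => 2 * (totOf ψ b / 2)) fun b => by
      simp only [cast_tot, ZMod.natCast_zmod_val]
      exact congrFun (C.coboundary_coboundary ψ) b
  refine ⟨h1 + (fun b => orderForm s ψ b + frameForm s f ψ b) +
    wcob s fun b => ((totOf ψ b / 2 : ℕ) : ZMod 2), funext fun a => ?_⟩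
  have e2 := e1 a
  rw [← funext key, sqForm_totOf h, sqForm_two_mul h.1] at e2
  simp only [map_add, Pi.add_apply, sqRep]
  grind

theorem mk_eq_mk_iff {φ ψ : C.Ob → ZMod 2} (hφ : φ ∈ C.cocycles k) (hψ : ψ ∈ C.cocycles k) :
    H.mk φ hφ = H.mk ψ hψ ↔ φ - ψ ∈ C.coboundaries k := by
  rw [H.mk, H.mk, Submodule.Quotient.eq]
  rfl

theorem mk_eq_mk {φ ψ : C.Ob → ZMod 2} (hφ : φ ∈ C.cocycles k) (hψ : ψ ∈ C.cocycles k)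
    {h : C.Ob → ZMod 2} (e : φ = ψ + C.coboundary h) : H.mk φ hφ = H.mk ψ hψ :=
  (mk_eq_mk_iff hφ hψ).2 (mem_coboundaries (sub_mem hφ.1 hψ.1) (by rw [e, add_sub_cancel_left]))

variable [IsEmpty C.Circ]

theorem sqRep_mem_cocycles (h : C.IsFramed s f) {φ : C.Ob → ZMod 2} (hφ : φ ∈ C.cocycles k) :
    sqRep s f φ ∈ C.cocycles (k + 2) :=
  ⟨sqRep_mem hφ.1, coboundary_sqRep h hφ.2⟩

/-- The second Steenrod square. -/
def steenrodSq (h : C.IsFramed s f) (k : ℤ) : C.H k →ₗ[ZMod 2] C.H (k + 2) :=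
  Submodule.liftQ _ (AddMonoidHom.toZModLinearMap 2
    { toFun := fun φ => H.mk (sqRep s f φ.1) (sqRep_mem_cocycles h φ.2)
      map_zero' := by
        refine (mk_eq_mk_iff _ (zero_mem _)).2 ?_
        have : sqRep s f ((0 : C.cocycles k) : C.Ob → ZMod 2) = 0 := by
          funext a
          simp [sqRep, sqForm, orderForm, tot, choose2]
        rw [this, sub_zero]
        exact zero_mem _
      map_add' := fun φ ψ => by
        obtain ⟨g, hg⟩ := sqRep_add (f := f) h.1 φ.2.2 ψ.2.2
        exact mk_eq_mk (h := g) _ (add_mem (sqRep_mem_cocycles h φ.2)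
          (sqRep_mem_cocycles h ψ.2)) hg }) fun φ hφ => by
    obtain ⟨ψ, -, hψ⟩ := hφ
    obtain ⟨g, hg⟩ := sqRep_coboundary h ψ
    refine (mk_eq_mk_iff _ (zero_mem _)).2 ?_
    have e : (φ : C.Ob → ZMod 2) = C.coboundary ψ := hψ.symm
    rw [sub_zero]
    exact mem_coboundaries (sqRep_mem φ.2.1) (e ▸ hg)

theorem steenrodSq_mk (h : C.IsFramed s f) {φ : C.Ob → ZMod 2} (hφ : φ ∈ C.cocycles k) :
    steenrodSq h k (H.mk φ hφ) = H.mk (sqRep s f φ) (sqRep_mem_cocycles h hφ) := rfl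

theorem sqCochain_mem {φ : C.Ob → ZMod 2} (hφ : φ ∈ C.cochains k) (m : C.Matching φ)
    (o : m.Direction) : sqCochain s f m o ∈ C.cochains (k + 2) := by
  intro a ha
  have h1 : IsEmpty (C.Vert φ a) := ⟨fun v => by
    have h1 := C.gr_itvSrc v.itv
    have h2 : C.itvSrc v.itv = a := (C.itvSrc_bdry _).trans v.2.1
    have h3 : φ (C.itvTgt v.itv) = 1 := by rw [Vert.itv, C.itvTgt_bdry]; exact v.2.2
    rw [hφ _ (fun h => ha (by rw [← h2, h1, h]))] at h3
    exact absurd h3 (by decide)⟩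
  have h2 : IsEmpty (m.Comp a) := ⟨fun K => h1.false K.out⟩
  simp [sqCochain]

theorem isSecondSteenrodSquare_steenrodSq (h : C.IsFramed s f) :
    IsSecondSteenrodSquare s f (steenrodSq h k) := by
  intro φ hφ m o
  obtain ⟨g, hg⟩ := sqCochain_eq h.1 f hφ.2 m o
  have e : sqCochain s f m o = sqRep s f φ + C.coboundary g := funext hg
  have hm : sqCochain s f m o ∈ C.cocycles (k + 2) := by
    refine ⟨sqCochain_mem hφ.1 m o, ?_⟩
    change C.coboundary _ = 0
    rw [e, map_add, C.coboundary_coboundary, coboundary_sqRep h hφ.2, add_zero]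
  exact ⟨hm, (mk_eq_mk _ _ e).symm⟩

/-- Uniqueness would be vacuous without matchings and directions; they exist for every cocycle. -/
theorem IsSecondSteenrodSquare.eq (h : C.IsFramed s f) {T : C.H k →ₗ[ZMod 2] C.H (k + 2)}
    (hT : IsSecondSteenrodSquare s f T) : T = steenrodSq h k := by
  refine LinearMap.ext fun x => ?_
  induction x using Submodule.Quotient.induction_on with | _ φ =>
  obtain ⟨m⟩ := nonempty_matching φ.2.2
  obtain ⟨o⟩ := nonempty_direction h.1 m
  obtain ⟨h1, e1⟩ := hT φ.1 φ.2 m o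
  obtain ⟨h2, e2⟩ := isSecondSteenrodSquare_steenrodSq h φ.1 φ.2 m o
  exact e1.trans e2.symm

end OneFlowCat

end

noncomputable section

/-! ### Change of the sign assignment and of the framing -/

namespace OneFlowCat

open scoped Classical

variable {C : OneFlowCat} {s σ : C.Pt → ZMod 2} {f f' : C.PreFraming}

/-- A `1`-cocycle on the points of the `0`-dimensional moduli spaces. -/
def IsClosed (σ : C.Pt → ZMod 2) : Prop :=
  ∀ p q : C.Pair, C.bdry p = C.bdry q → pairSign σ p = pairSign σ q

/-- The contribution of a corner `(B, A)` to the change of the framing. -/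
def cornerChange (x y : ZMod 2) (s σ : C.Pt → ZMod 2) (p : C.Pair) : ZMod 2 :=
  σ p.1.2 * s p.1.1 + x * σ p.1.1 + y * (σ p.1.2 * σ p.1.1)

theorem IsSignAssignment.add_isClosed (hs : C.IsSignAssignment s) (hσ : IsClosed σ) :
    C.IsSignAssignment (s + σ) := by
  intro p q hpq h
  have h1 := hs p q hpq h
  have h2 := hσ p q h
  simp only [pairSign] at h2
  simp only [Pi.add_apply]
  grind

theorem IsSignAssignment.isClosed_add {s' : C.Pt → ZMod 2} (hs : C.IsSignAssignment s)
    (hs' : C.IsSignAssignment s') : IsClosed (s + s') := by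
  intro p q h
  by_cases hpq : p = q
  · rw [hpq]
  have h1 := hs p q hpq h
  have h2 := hs' p q hpq h
  simp only [pairSign, Pi.add_apply]
  grind

/-- The sign counts each edge once, while every edge has its two ends among the corners. So a term
per edge that splits into its ends is summed freely over corners. -/
theorem sum_sign_lower (hs : C.IsSignAssignment s) {Φ : C.Ob → Prop} {a : C.Ob}
    (H : C.Pair → ZMod 2) (g : C.Pair → ZMod 2)
    (hg : ∀ p q, p ≠ q → C.bdry p = C.bdry q → g p = H p + H q) :
    ∑ t : C.TripleOver Φ a, t.sign s * g t.lowerPair = ∑ t : C.TripleOver Φ a, H t.lowerPair := by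
  have p1 := TripleOver.isPairing_lowerEdge (Φ := Φ) (a := a) hs
  rw [p1.sum_eq fun t => H t.lowerPair]
  refine Finset.sum_congr rfl fun t _ => ?_
  have h1 := p1.apply_partner t
  rw [hg t.lowerPair (p1.partner t).lowerPair]
  · intro h
    refine p1.partner_ne t (Subtype.ext (Prod.ext ?_ (Prod.ext ?_ ?_)))
    · exact (congrArg (fun p : C.Pair => p.1.1) h).symm
    · exact (congrArg (fun p : C.Pair => p.1.2) h).symm
    · exact congrArg (fun e : C.Itv × C.Pt => e.2) h1
  · exact (congrArg (fun e : C.Itv × C.Pt => e.1) h1).symm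

theorem sum_sign_upper (hs : C.IsSignAssignment s) {Φ : C.Ob → Prop} {a : C.Ob}
    (H : C.Pair → ZMod 2) (g : C.Pair → ZMod 2)
    (hg : ∀ p q, p ≠ q → C.bdry p = C.bdry q → g p = H p + H q) :
    ∑ t : C.TripleOver Φ a, t.sign s * g t.upperPair = ∑ t : C.TripleOver Φ a, H t.upperPair := by
  have p1 := TripleOver.isPairing_upperEdge (Φ := Φ) (a := a) hs
  rw [p1.sum_eq fun t => H t.upperPair]
  refine Finset.sum_congr rfl fun t _ => ?_
  have h1 := p1.apply_partner t
  rw [hg t.upperPair (p1.partner t).upperPair]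
  · intro h
    refine p1.partner_ne t (Subtype.ext (Prod.ext ?_ (Prod.ext ?_ ?_)))
    · exact congrArg (fun e : C.Pt × C.Itv => e.1) h1
    · exact (congrArg (fun p : C.Pair => p.1.1) h).symm
    · exact (congrArg (fun p : C.Pair => p.1.2) h).symm
  · exact (congrArg (fun e : C.Pt × C.Itv => e.2) h1).symm

/-- A function of the edges `I × {A}` has sum zero over the triples. -/
theorem sum_lower_eq_zero (hs : C.IsSignAssignment s) {Φ : C.Ob → Prop} {a : C.Ob}
    (hσ : IsClosed σ) (g : ZMod 2 → C.Pt → ZMod 2) :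
    ∑ t : C.TripleOver Φ a, g (σ t.1.1 + σ t.1.2.1) t.1.2.2 = 0 := by
  have p1 := TripleOver.isPairing_lowerEdge (Φ := Φ) (a := a) hs
  refine p1.sum_eq_zero _ fun t => ?_
  have h1 := p1.apply_partner t
  have h2 : (p1.partner t).1.2.2 = t.1.2.2 := congrArg (fun e : C.Itv × C.Pt => e.2) h1
  have h3 := hσ _ _ (congrArg (fun e : C.Itv × C.Pt => e.1) h1)
  change σ (p1.partner t).1.1 + σ (p1.partner t).1.2.1 = σ t.1.1 + σ t.1.2.1 at h3
  rw [h2, h3]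

/-- A function of the edges `{P} × J` has sum zero over the triples. -/
theorem sum_upper_eq_zero (hs : C.IsSignAssignment s) {Φ : C.Ob → Prop} {a : C.Ob}
    (hσ : IsClosed σ) (g : C.Pt → ZMod 2 → ZMod 2) :
    ∑ t : C.TripleOver Φ a, g t.1.1 (σ t.1.2.1 + σ t.1.2.2) = 0 := by
  have p1 := TripleOver.isPairing_upperEdge (Φ := Φ) (a := a) hs
  refine p1.sum_eq_zero _ fun t => ?_
  have h1 := p1.apply_partner t
  have h2 : (p1.partner t).1.1 = t.1.1 := congrArg (fun e : C.Pt × C.Itv => e.1) h1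
  have h3 := hσ _ _ (congrArg (fun e : C.Pt × C.Itv => e.2) h1)
  change σ (p1.partner t).1.2.1 + σ (p1.partner t).1.2.2 = σ t.1.2.1 + σ t.1.2.2 at h3
  rw [h2, h3]

/-- The sum over the triples in the framing condition depends on the framing of the edges only. -/
theorem sum_sign_congr (hs : C.IsSignAssignment s) {Φ : C.Ob → Prop} {a : C.Ob}
    (hσ : IsClosed σ) (f : C.PreFraming) :
    ∑ t : C.TripleOver Φ a, t.sign (s + σ) * (f.itv (C.bdry t.lowerPair) +
        (1 + (s + σ) t.1.1 + f.itv (C.bdry t.upperPair))) =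
    ∑ t : C.TripleOver Φ a, t.sign s * (f.itv (C.bdry t.lowerPair) +
        (1 + (s + σ) t.1.1 + f.itv (C.bdry t.upperPair))) := by
  have p1 := TripleOver.isPairing_lowerEdge (Φ := Φ) (a := a) hs
  have p2 := TripleOver.isPairing_upperEdge (Φ := Φ) (a := a) hs
  have e1 : ∑ t : C.TripleOver Φ a, t.sign σ * f.itv (C.bdry t.lowerPair) = 0 := by
    refine p1.sum_eq_zero _ fun t => ?_
    have h1 := p1.apply_partner t
    have h2 : (p1.partner t).1.2.2 = t.1.2.2 := congrArg (fun e : C.Itv × C.Pt => e.2) h1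
    have h3 : C.bdry (p1.partner t).lowerPair = C.bdry t.lowerPair :=
      congrArg (fun e : C.Itv × C.Pt => e.1) h1
    have h4 := hσ _ _ h3
    change σ (p1.partner t).1.1 + σ (p1.partner t).1.2.1 = σ t.1.1 + σ t.1.2.1 at h4
    rw [TripleOver.sign, TripleOver.sign, h2, h3, h4]
  have e2 : ∑ t : C.TripleOver Φ a, t.sign σ * (1 + (s + σ) t.1.1 +
      f.itv (C.bdry t.upperPair)) = 0 := by
    refine p2.sum_eq_zero _ fun t => ?_
    have h1 := p2.apply_partner t
    have h2 : (p2.partner t).1.1 = t.1.1 := congrArg (fun e : C.Pt × C.Itv => e.1) h1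
    have h3 : C.bdry (p2.partner t).upperPair = C.bdry t.upperPair :=
      congrArg (fun e : C.Pt × C.Itv => e.2) h1
    have h4 := hσ _ _ h3
    change σ (p2.partner t).1.2.1 + σ (p2.partner t).1.2.2 = σ t.1.2.1 + σ t.1.2.2 at h4
    have h5 : (p2.partner t).sign σ = t.sign σ := by
      simp only [TripleOver.sign, h2]
      rw [add_assoc, h4, ← add_assoc]
    rw [h2, h3, h5]
  have e3 := congrArg₂ (fun x y => x + y) e1 e2
  rw [← Finset.sum_add_distrib, add_zero] at e3
  rw [← sub_eq_zero, ← Finset.sum_sub_distrib, ← e3]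
  refine Finset.sum_congr rfl fun t _ => ?_
  simp only [TripleOver.sign, Pi.add_apply]
  ring

/-- The twist of a framing by a closed function. -/
theorem IsFramed.twist [IsEmpty C.Circ] (h : C.IsFramed s f) (hσ : IsClosed σ) (x y : ZMod 2)
    (hf : ∀ p q, p ≠ q → C.bdry p = C.bdry q → f'.itv (C.bdry p) = f.itv (C.bdry p) +
      pairSign σ p + (cornerChange x y s σ p + cornerChange x y s σ q)) :
    C.IsFramed (s + σ) f' := by
  have hs := h.1
  have hs' := hs.add_isClosed hσ
  refine ⟨hs', (isFraming_iff hs' f').2 fun a d => ?_⟩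
  have h0 := (isFraming_iff hs f).1 h.2 a d
  rw [sum_sign_congr hs hσ]
  have hg : ∀ p q, p ≠ q → C.bdry p = C.bdry q →
      f'.itv (C.bdry p) + f.itv (C.bdry p) + pairSign σ p =
        cornerChange x y s σ p + cornerChange x y s σ q := fun p q hpq hb => by
    have := hf p q hpq hb
    grind
  have e1 := sum_sign_lower (Φ := fun c => c = d) (a := a) hs (cornerChange x y s σ) _ hg
  have e2 := sum_sign_upper (Φ := fun c => c = d) (a := a) hs (cornerChange x y s σ) _ hg
  have z1 := sum_upper_eq_zero (Φ := fun c => c = d) (a := a) hs hσ fun P z => s P * z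
  have z2 := sum_lower_eq_zero (Φ := fun c => c = d) (a := a) hs hσ fun z A =>
    s A * σ A + x * z + y * (z * σ A)
  have z3 := sum_upper_eq_zero (Φ := fun c => c = d) (a := a) hs hσ fun P z => y * (σ P * z)
  -- The corner terms are designed for this: their sum over lower and upper pairs, with the defect
  -- t.sign · σ(A) of the changed signs, is a sum of functions of one edge each. Such functions
  -- cancel between the two corners of the edge, for any x and y.
  have z4 : ∑ t : C.TripleOver (fun c => c = d) a, (t.sign s * σ t.1.2.2 +
      cornerChange x y s σ t.lowerPair + cornerChange x y s σ t.upperPair) = 0 := by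
    have z := congrArg₂ (fun x y => x + y) (congrArg₂ (fun x y => x + y) z1 z2) z3
    rw [← Finset.sum_add_distrib, ← Finset.sum_add_distrib, add_zero, add_zero] at z
    rw [← z]
    refine Finset.sum_congr rfl fun t _ => ?_
    simp only [TripleOver.sign, cornerChange, TripleOver.lowerPair, TripleOver.upperPair]
    grind
  rw [Finset.sum_add_distrib, Finset.sum_add_distrib, ← e1, ← e2] at z4
  rw [← h0, add_right_inj, ← sub_eq_zero, ← Finset.sum_sub_distrib, ← z4,
    ← Finset.sum_add_distrib, ← Finset.sum_add_distrib]
  refine Finset.sum_congr rfl fun t _ => ?_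
  simp only [pairSign, TripleOver.lowerPair, TripleOver.upperPair, Pi.add_apply]
  grind

end OneFlowCat

end

/-! ### Effect of a change of signs and framing on the second Steenrod square -/

noncomputable section

namespace OneFlowCat

open scoped Classical

variable {C : OneFlowCat} {s σ : C.Pt → ZMod 2} {f f' : C.PreFraming} {φ : C.Ob → ZMod 2}

/-- Half of the number of points `P ∈ M(b, c)` with `φ(c) = 1`. -/
def half (φ : C.Ob → ZMod 2) (b : C.Ob) : ZMod 2 := (totOf φ b / 2 : ℕ)

/-- The effect of a change of the framing on the second Steenrod square. -/
theorem sqRep_change (hs : C.IsSignAssignment s) (hσ : IsClosed σ) (hφ : C.coboundary φ = 0)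
    (k : C.Pair → ZMod 2) (hk : ∀ p q, p ≠ q → C.bdry p = C.bdry q →
      f'.itv (C.bdry p) = f.itv (C.bdry p) + pairSign σ p + (k p + k q)) (a : C.Ob) :
    sqRep (s + σ) f' φ a = sqRep s f φ a + ∑ p : C.PairOver a, φ p.1.bot * k p.1 +
      wcob σ (half φ) a := by
  have hs' := hs.add_isClosed hσ
  -- An interval on which the ends are exchanged, that is σ = 1, changes the circle count by one;
  -- this is what the summand `pairSign σ p` in the framing compensates.
  have e1 : orderForm (s + σ) φ a = orderForm s φ a +
      ∑ p : C.PairOver a, φ p.1.bot * (pairSign s p.1 * pairSign σ p.1) := by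
    rw [orderForm_eq_tourPair, orderForm_eq_tourPair,
      (isPairing_vert_itv hs).tourPair_edgeOrder_sign (isPairing_vert_itv hs') _
        (isTour_pairTour.comp Subtype.val_injective),
      ← sum_vert fun p => pairSign s p * pairSign σ p]
    congr 1
    refine Finset.sum_congr rfl fun v _ => ?_
    simp only [pairSign, Pi.add_apply]
    grind
  have e2 : ∑ p : C.PairOver a, φ p.1.bot * k p.1 = ∑ p : C.PairOver a, pairSign s p.1 *
      (φ p.1.bot * (f'.itv (C.bdry p.1) + f.itv (C.bdry p.1) + pairSign σ p.1)) := by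
    have h := isPairing_bdryOver hs a
    rw [h.sum_eq]
    refine Finset.sum_congr rfl fun p _ => ?_
    have hb : (h.partner p).1.bot = p.1.bot := by
      rw [← bdryOver_bot, ← bdryOver_bot, h.apply_partner]
    have := hk p.1 (h.partner p).1 (fun h' => h.partner_ne p (Subtype.ext h'.symm))
      (congrArg Subtype.val (h.apply_partner p)).symm
    rw [hb]
    grind
  have e3 : frameForm (s + σ) f' φ a + frameForm s f φ a = ∑ p : C.PairOver a, pairSign s p.1 *
      (φ p.1.bot * (f'.itv (C.bdry p.1) + f.itv (C.bdry p.1))) := by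
    rw [frameForm_eq hs', frameForm_eq hs, ← Finset.sum_add_distrib, sum_itvOver hs]
    refine Finset.sum_congr rfl fun p _ => ?_
    rw [bdryOver_bot, bdryOver]
    ring
  have e4 : wcob (s + σ) (half φ) a = wcob s (half φ) a + wcob σ (half φ) a := by
    simp only [wcob, Pi.add_apply, add_mul, Finset.sum_add_distrib]
  have e5 : ∑ p : C.PairOver a, φ p.1.bot * k p.1 = frameForm (s + σ) f' φ a + frameForm s f φ a +
      ∑ p : C.PairOver a, φ p.1.bot * (pairSign s p.1 * pairSign σ p.1) := by
    rw [e2, e3, ← Finset.sum_add_distrib]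
    exact Finset.sum_congr rfl fun p _ => by ring
  rw [sqRep_eq hs' hφ, sqRep_eq hs hφ]
  change _ + wcob (s + σ) (half φ) a = _ + wcob s (half φ) a + _ + _
  rw [e4, e1, e5]
  grind

theorem wcob_one (φ : C.Ob → ZMod 2) : wcob (fun _ => 1) φ = C.coboundary φ := by
  funext a
  simp [wcob, coboundary_apply]

theorem wcob_add (w : C.Pt → ZMod 2) (φ ψ : C.Ob → ZMod 2) :
    wcob w (φ + ψ) = wcob w φ + wcob w ψ := by
  funext a
  simp only [wcob, Pi.add_apply, mul_add, Finset.sum_add_distrib]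

theorem wcob_zero (w : C.Pt → ZMod 2) : wcob w (0 : C.Ob → ZMod 2) = 0 := by
  funext a
  simp [wcob]

/-- As σ is closed, σ(A) + σ(B) agrees at the two ends of an interval, so the weighted coboundary is
a cochain map of degree 1. -/
theorem wcob_coboundary (hs : C.IsSignAssignment s) (hσ : IsClosed σ) (φ : C.Ob → ZMod 2) :
    wcob σ (C.coboundary φ) = C.coboundary (wcob σ φ) := by
  funext a
  rw [← wcob_one, ← wcob_one, ← sum_pairOver_mul, ← sum_pairOver_mul, ← sub_eq_zero,
    ← Finset.sum_sub_distrib]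
  refine (isPairing_bdryOver hs a).sum_eq_zero _ fun p => ?_
  have h := (isPairing_bdryOver hs a).apply_partner p
  have hb : ((isPairing_bdryOver hs a).partner p).1.bot = p.1.bot := by
    rw [← bdryOver_bot, ← bdryOver_bot, h]
  have h2 := hσ _ _ (congrArg Subtype.val h)
  simp only [pairSign] at h2
  have key : ∀ x y z w v : ZMod 2, x + y = z + w → y * 1 * v - 1 * x * v = w * 1 * v - 1 * z * v := by
    decide
  rw [hb]
  exact key _ _ _ _ _ h2

/-- The first Steenrod square of a cocycle is a cocycle. -/
theorem coboundary_bockstein (hs : C.IsSignAssignment s) (hφ : C.coboundary φ = 0) :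
    C.coboundary (wcob s φ + half φ) = 0 := by
  funext a
  -- The cochain in question is, mod 2, half the signed coboundary of the lift of φ, as Σ (-1)^s φ =
  -- Σ φ - 2 Σ sφ. Here the coboundary of the unsigned half is read off from choose2(2m) = m.
  have e1 : C.coboundary (half φ) a = itvCount s φ a := by
    rw [← choose2_tot_totOf hs]
    have e3 : totOf φ = fun b => 2 * (totOf φ b / 2) :=
      funext fun b => (Nat.two_mul_div_two_of_even (even_totOf hφ b)).symm
    rw [e3, tot_two_mul, choose2_two_mul, cast_tot]
    rfl
  have e2 : itvCount s φ a = C.coboundary (wcob s φ) a + wcob s (C.coboundary φ) a := by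
    rw [itvCount, sum_vert fun p => pairSign s p, ← wcob_one, ← wcob_one, ← sum_pairOver_mul,
      ← sum_pairOver_mul, ← Finset.sum_add_distrib]
    refine Finset.sum_congr rfl fun p _ => ?_
    simp only [pairSign]
    ring
  rw [map_add, Pi.add_apply, e1, e2, hφ, wcob_zero, Pi.zero_apply, add_zero,
    CharTwo.add_self_eq_zero]

/-- The coboundary of a function on the objects, as a function of the points. -/
def ptCob (t : C.Ob → ZMod 2) (P : C.Pt) : ZMod 2 := t (C.src P) + t (C.tgt P)

theorem isClosed_ptCob (t : C.Ob → ZMod 2) : IsClosed (C.ptCob t) := by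
  intro p q h
  have h1 := C.itvSrc_bdry p
  have h2 := C.itvTgt_bdry p
  have h3 := C.itvSrc_bdry q
  have h4 := C.itvTgt_bdry q
  rw [h] at h1 h2
  simp only [pairSign, ptCob, p.2, q.2, ← h1, ← h2, ← h3, ← h4]
  grind

theorem wcob_ptCob (t φ : C.Ob → ZMod 2) :
    wcob (C.ptCob t) φ = t * C.coboundary φ + C.coboundary (t * φ) := by
  funext a
  simp only [wcob, ptCob, Pi.add_apply, Pi.mul_apply, coboundary_apply, Finset.mul_sum,
    ← Finset.sum_add_distrib]
  exact Finset.sum_congr rfl fun A _ => by rw [A.2]; ring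

/-- If the sign assignment is changed by a coboundary, and the framing accordingly, the second
Steenrod square does not change. -/
theorem sqRep_gauge (hs : C.IsSignAssignment s) (hσ : IsClosed σ) (hφ : C.coboundary φ = 0)
    (t : C.Ob → ZMod 2) (g : C.Pt → ZMod 2) (x : ZMod 2) (k : C.Pair → ZMod 2)
    (hk : ∀ p q, p ≠ q → C.bdry p = C.bdry q →
      f'.itv (C.bdry p) = f.itv (C.bdry p) + pairSign (C.ptCob t) p + (k p + k q))
    (hk' : ∀ p : C.Pair, k p = C.ptCob t p.1.2 * (s p.1.1 + σ p.1.1) +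
      σ p.1.2 * C.ptCob t p.1.1 + x * σ p.1.1 + pairSign g p) :
    ∃ h : C.Ob → ZMod 2, sqRep (s + C.ptCob t) f' φ = sqRep s f φ + C.coboundary h := by
  -- On a cocycle ψ, weighting by the coboundary of t gives the coboundary of tψ. This is applied to
  -- the Bockstein cocycle, to the cocycle of σ-weights and to φ itself. The x-term vanishes since
  -- it is x times the coboundary of a cocycle, and g contributes the coboundary of its weighted
  -- sum.
  refine ⟨t * (wcob s φ + half φ) + t * wcob σ φ + wcob σ (t * φ) + wcob g φ, funext fun a => ?_⟩
  rw [sqRep_change hs (isClosed_ptCob t) hφ k hk a, Pi.add_apply, add_assoc]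
  congr 1
  have e1 : ∑ p : C.PairOver a, φ p.1.bot * k p.1 =
      wcob (C.ptCob t) (wcob s φ) a + wcob (C.ptCob t) (wcob σ φ) a +
      wcob σ (wcob (C.ptCob t) φ) a + x * wcob (fun _ => 1) (wcob σ φ) a +
      wcob (fun _ => 1) (wcob g φ) a + wcob g (wcob (fun _ => 1) φ) a := by
    simp only [← sum_pairOver_mul, Finset.mul_sum, ← Finset.sum_add_distrib]
    refine Finset.sum_congr rfl fun p _ => ?_
    rw [hk', pairSign]
    ring
  have e2 : C.coboundary (wcob σ φ) = 0 := by rw [← wcob_coboundary hs hσ, hφ, wcob_zero]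
  have e3 : wcob (C.ptCob t) (wcob s φ + half φ) = C.coboundary (t * (wcob s φ + half φ)) := by
    rw [wcob_ptCob, coboundary_bockstein hs hφ, mul_zero, zero_add]
  have e4 : wcob (C.ptCob t) (wcob σ φ) = C.coboundary (t * wcob σ φ) := by
    rw [wcob_ptCob, e2, mul_zero, zero_add]
  have e5 : wcob σ (wcob (C.ptCob t) φ) = C.coboundary (wcob σ (t * φ)) := by
    rw [wcob_ptCob, hφ, mul_zero, zero_add, wcob_coboundary hs hσ]
  have e6 := congrFun e3 a
  rw [wcob_add, Pi.add_apply] at e6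
  rw [e1, e4, e5, wcob_one, wcob_one, wcob_one, hφ, e2, wcob_zero]
  simp only [map_add, Pi.add_apply] at e6 ⊢
  simp only [Pi.zero_apply, mul_zero, add_zero, ← e6]
  ring

end OneFlowCat

end

noncomputable section

/-! ### The cube -/

namespace CubeVertex

variable {n : ℕ} {u v w x : CubeVertex n} {i j k : Fin n}

/-- The vertex obtained by changing the `i`-th coordinate to `0`. -/
def drop (u : CubeVertex n) (i : Fin n) : CubeVertex n := Function.update u i false

@[simp] theorem drop_self : u.drop i i = false := Function.update_self _ _ _

theorem drop_of_ne (h : j ≠ i) : u.drop i j = u j := Function.update_of_ne h _ _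

theorem drop_comm (u : CubeVertex n) (i j : Fin n) : (u.drop i).drop j = (u.drop j).drop i := by
  by_cases h : i = j
  · rw [h]
  · exact Function.update_comm h _ _ _

theorem drop_le : u.drop i ≤ u := by
  intro l
  by_cases h : l = i
  · subst h; simp
  · rw [drop_of_ne h]

theorem weight_drop (h : u i = true) : u.weight = (u.drop i).weight + 1 := by
  rw [weight_eq_add (drop_le (u := u) (i := i))]
  have : (Finset.univ.filter fun l => u.drop i l ≠ u l) = {i} := by
    ext l
    by_cases hl : l = i
    · subst hl; simp [h]
    · simp [hl, drop_of_ne hl]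
  rw [this, Finset.card_singleton]

theorem le_drop (h : v ≤ u) (hi : v i = false) : v ≤ u.drop i := by
  intro l
  by_cases hl : l = i
  · subst hl; simp [hi]
  · rw [drop_of_ne hl]; exact h l

theorem ne_of_drop (h : u.drop i j = true) : j ≠ i := by
  rintro rfl
  simp at h

theorem apply_of_drop (h : u.drop i j = true) : u j = true := by
  rwa [drop_of_ne (ne_of_drop h)] at h

theorem drop_injective (hi : u i = true) (h : u.drop i = u.drop j) : i = j := by
  by_contra hij
  have := congrFun h i
  rw [drop_self, drop_of_ne hij, hi] at this
  exact Bool.noConfusion this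

theorem exists_drop (h : v ≤ u) (hw : u.weight = v.weight + 1) : ∃ i, u i = true ∧ v = u.drop i := by
  have hc : (Finset.univ.filter fun l => v l ≠ u l).card = 1 := by
    have := weight_eq_add h; omega
  obtain ⟨i, hi⟩ := Finset.card_eq_one.1 hc
  have hm : ∀ l, v l ≠ u l ↔ l = i := fun l => by
    have := congrArg (fun s => l ∈ s) hi
    simpa using this
  have h1 := (hm i).2 rfl
  have h2 := h i
  have h3 : v i = false ∧ u i = true := by
    revert h1 h2
    cases v i <;> cases u i <;> simp
  refine ⟨i, h3.2, funext fun l => ?_⟩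
  by_cases hl : l = i
  · subst hl; rw [drop_self, h3.1]
  · rw [drop_of_ne hl]
    by_contra h4
    exact hl ((hm l).1 h4)

theorem weight_le (u : CubeVertex n) : u.weight ≤ n := by
  have : u.weight ≤ ∑ _i : Fin n, 1 := Finset.sum_le_sum fun i _ => Bool.toNat_le (u i)
  simpa using this

theorem weight_pos (h : u i = true) : 0 < u.weight := by
  rw [weight_drop h]; omega

/-- Extension of a function of the sub-cubes to all pairs of vertices by zero. -/
def ext {m : ℕ} (h : SubCube n m → ZMod 2) (u v : CubeVertex n) : ZMod 2 := by
  classical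
  exact if hq : v ≤ u ∧ u.weight = v.weight + m then h ⟨(u, v), hq⟩ else 0

theorem ext_apply {m : ℕ} (h : SubCube n m → ZMod 2) (q : SubCube n m) :
    ext h q.1.1 q.1.2 = h q := dif_pos q.2

/-- Functions of the edges satisfying the cocycle condition are coboundaries. -/
theorem exists_potential (E : CubeVertex n → CubeVertex n → ZMod 2)
    (hE : ∀ u i j, i ≠ j → u i = true → u j = true →
      E u (u.drop i) + E (u.drop i) ((u.drop i).drop j) =
        E u (u.drop j) + E (u.drop j) ((u.drop j).drop i)) :
    ∃ t : CubeVertex n → ZMod 2, ∀ u i, u i = true → E u (u.drop i) = t u + t (u.drop i) := by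
  classical
  have key : ∀ N : ℕ, ∃ t : CubeVertex n → ZMod 2, ∀ u i, u.weight ≤ N → u i = true →
      E u (u.drop i) = t u + t (u.drop i) := by
    intro N
    induction N with
    | zero => exact ⟨0, fun u i hu hi => absurd (weight_pos hi) (by omega)⟩
    | succ N ih =>
      obtain ⟨t, ht⟩ := ih
      -- The potential is extended to vertices of the next weight along one chosen edge down; the
      -- square condition makes the other edges agree.
      refine ⟨fun u => if u.weight ≤ N then t u else if h : ∃ j, u j = true then
        t (u.drop h.choose) + E u (u.drop h.choose) else 0, fun u i hu hi => ?_⟩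
      have hw := weight_drop hi
      by_cases hN : u.weight ≤ N
      · simp only [hN, if_true, (by omega : (u.drop i).weight ≤ N)]
        exact ht u i hN hi
      · have h : ∃ j, u j = true := ⟨i, hi⟩
        simp only [hN, if_false, h, dif_pos, (by omega : (u.drop i).weight ≤ N), if_true]
        have hj : u h.choose = true := h.choose_spec
        generalize h.choose = j at hj
        by_cases hij : i = j
        · subst hij; grind
        · have hw' := weight_drop hj
          have h1 := ht (u.drop i) j (by omega) (by rw [drop_of_ne (Ne.symm hij), hj])
          have h2 := ht (u.drop j) i (by omega) (by rw [drop_of_ne hij, hi])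
          have h3 := hE u i j hij hi hj
          rw [drop_comm u j i] at h2 h3
          grind
  obtain ⟨t, ht⟩ := key n
  exact ⟨t, fun u i hi => ht u i (weight_le u) hi⟩

/-- Functions of the squares satisfying the cocycle condition are coboundaries. -/
theorem exists_edge_potential (E : CubeVertex n → CubeVertex n → ZMod 2)
    (hE : ∀ u i j k, i ≠ j → i ≠ k → j ≠ k → u i = true → u j = true → u k = true →
      E u ((u.drop i).drop j) + E u ((u.drop i).drop k) + E u ((u.drop j).drop k) +
      E (u.drop i) (((u.drop i).drop j).drop k) + E (u.drop j) (((u.drop i).drop j).drop k) +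
      E (u.drop k) (((u.drop i).drop j).drop k) = 0) :
    ∃ g : CubeVertex n → Fin n → ZMod 2, ∀ u i j, i ≠ j → u i = true → u j = true →
      E u ((u.drop i).drop j) = g u i + g u j + g (u.drop i) j + g (u.drop j) i := by
  classical
  have key : ∀ N : ℕ, ∃ g : CubeVertex n → Fin n → ZMod 2, ∀ u i j, u.weight ≤ N → i ≠ j →
      u i = true → u j = true →
      E u ((u.drop i).drop j) = g u i + g u j + g (u.drop i) j + g (u.drop j) i := by
    intro N
    induction N with
    | zero => exact ⟨0, fun u i j hu _ hi _ => absurd (weight_pos hi) (by omega)⟩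
    | succ N ih =>
      obtain ⟨g, hg⟩ := ih
      -- At a new vertex the value is set to 0 in one chosen direction k, which forces the values in
      -- the others by the squares containing k. The remaining squares are then correct by the
      -- condition on 3-cubes.
      refine ⟨fun u i => if u.weight ≤ N then g u i else if h : ∃ j, u j = true then
        if i = h.choose then 0 else E u ((u.drop i).drop h.choose) + g (u.drop i) h.choose +
          g (u.drop h.choose) i else 0, fun u i j hu hij hi hj => ?_⟩
      have hwi := weight_drop hi
      have hwj := weight_drop hj
      by_cases hN : u.weight ≤ N
      · simp only [hN, if_true, (by omega : (u.drop i).weight ≤ N),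
          (by omega : (u.drop j).weight ≤ N)]
        exact hg u i j hN hij hi hj
      · have h : ∃ j, u j = true := ⟨i, hi⟩
        simp only [hN, if_false, h, dif_pos, (by omega : (u.drop i).weight ≤ N), if_true,
          (by omega : (u.drop j).weight ≤ N)]
        have hk : u h.choose = true := h.choose_spec
        generalize h.choose = k at hk
        by_cases hik : i = k
        · subst hik
          simp only [if_true, hij.symm, if_false]
          rw [drop_comm u j i]
          grind
        by_cases hjk : j = k
        · subst hjk
          simp only [if_true, hij, if_false]
          grind
        have hwk := weight_drop hk
        simp only [hik, hjk, if_false]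
        have h1 := hg (u.drop i) j k (by omega) hjk (by rw [drop_of_ne (Ne.symm hij), hj])
          (by rw [drop_of_ne (Ne.symm hik), hk])
        have h2 := hg (u.drop j) i k (by omega) hik (by rw [drop_of_ne hij, hi])
          (by rw [drop_of_ne (Ne.symm hjk), hk])
        have h3 := hg (u.drop k) i j (by omega) hij (by rw [drop_of_ne hik, hi])
          (by rw [drop_of_ne hjk, hj])
        have h4 := hE u i j k hij hik hjk hi hj hk
        rw [drop_comm u j i] at h2
        rw [drop_comm u k i, drop_comm u k j, drop_comm (u.drop i) k j] at h3
        grind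
  obtain ⟨g, hg⟩ := key n
  exact ⟨g, fun u i j => hg u i j (weight_le u)⟩

/-- The number of nonzero coordinates before the `j`-th one. -/
def before (u : CubeVertex n) (j : Fin n) : ZMod 2 :=
  ∑ l, if l < j ∧ u l = true then 1 else 0

theorem before_drop (hi : u i = true) (j : Fin n) :
    (u.drop i).before j = u.before j + if i < j then 1 else 0 := by
  have e : ∀ l, (if l < j ∧ u l = true then (1 : ZMod 2) else 0) =
      (if l < j ∧ u.drop i l = true then 1 else 0) + if l = i then (if i < j then 1 else 0) else 0 := by
    intro l
    by_cases hl : l = i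
    · subst hl; simp [hi]
    · simp [hl, drop_of_ne hl]
  rw [before, before]
  simp only [e, Finset.sum_add_distrib, Finset.sum_ite_eq', Finset.mem_univ, if_true]
  grind

end CubeVertex

end

/-! ### Edges, squares and 3-cubes of the cube flow category -/

noncomputable section

namespace CubeFlow

open scoped Classical
open CubeVertex OneFlowCat

variable {n : ℕ} {u v w x : CubeVertex n} {i j k : Fin n}

instance : IsEmpty (cubeFlow n).Circ := inferInstanceAs (IsEmpty Empty)

/-- The source of an edge. -/
def top (P : (cubeFlow n).Pt) : CubeVertex n := (cubeFlow n).src P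

/-- The target of an edge. -/
def bot (P : (cubeFlow n).Pt) : CubeVertex n := (cubeFlow n).tgt P

theorem mid (p : (cubeFlow n).Pair) : bot p.1.2 = top p.1.1 := p.2

/-- The value of a function of the points on the edge between two vertices. -/
def ptVal (s : (cubeFlow n).Pt → ZMod 2) (u v : CubeVertex n) : ZMod 2 :=
  CubeVertex.ext (m := 1) s u v

/-- The framing of the square between two vertices. -/
def itvVal (f : (cubeFlow n).PreFraming) (u v : CubeVertex n) : ZMod 2 :=
  CubeVertex.ext (m := 2) f.itv u v

theorem ptVal_apply (s : (cubeFlow n).Pt → ZMod 2) (P : (cubeFlow n).Pt) :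
    ptVal s (top P) (bot P) = s P := CubeVertex.ext_apply (m := 1) s P

theorem itvVal_apply (f : (cubeFlow n).PreFraming) (I : (cubeFlow n).Itv) :
    itvVal f ((cubeFlow n).itvSrc I) ((cubeFlow n).itvTgt I) = f.itv I :=
  CubeVertex.ext_apply (m := 2) f.itv I

theorem itvVal_bdry (f : (cubeFlow n).PreFraming) (p : (cubeFlow n).Pair) :
    f.itv ((cubeFlow n).bdry p) = itvVal f (top p.1.2) (bot p.1.1) :=
  (itvVal_apply f _).symm

/-- The point over the edge in direction `i`. -/
def edge (u : CubeVertex n) (i : Fin n) (hi : u i = true) : (cubeFlow n).Pt :=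
  ⟨(u, u.drop i), drop_le, weight_drop hi⟩

theorem pt_ext {P Q : (cubeFlow n).Pt} (h1 : top P = top Q)
    (h2 : bot P = bot Q) : P = Q :=
  Subtype.ext (Prod.ext h1 h2)

theorem itv_ext {I J : (cubeFlow n).Itv} (h1 : (cubeFlow n).itvSrc I = (cubeFlow n).itvSrc J)
    (h2 : (cubeFlow n).itvTgt I = (cubeFlow n).itvTgt J) : I = J :=
  Subtype.ext (Prod.ext h1 h2)

theorem tgt_le (P : (cubeFlow n).Pt) : bot P ≤ top P := P.2.1

theorem weight_src (P : (cubeFlow n).Pt) :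
    (top P).weight = (bot P).weight + 1 := P.2.2

theorem exists_tgt_eq (P : (cubeFlow n).Pt) : ∃ i, top P i = true ∧
    bot P = (top P).drop i := exists_drop P.2.1 P.2.2

/-- The pair of edges in direction `i` and then `j`. -/
def pair (u : CubeVertex n) (i j : Fin n) (hij : i ≠ j) (hi : u i = true) (hj : u j = true) :
    (cubeFlow n).Pair :=
  ⟨(edge (u.drop i) j (by rw [drop_of_ne hij.symm, hj]), edge u i hi), rfl⟩

theorem bdry_eq_iff (p q : (cubeFlow n).Pair) : (cubeFlow n).bdry p = (cubeFlow n).bdry q ↔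
    top p.1.2 = top q.1.2 ∧
      bot p.1.1 = bot q.1.1 := by
  exact ⟨fun h => ⟨congrArg (cubeFlow n).itvSrc h, congrArg (cubeFlow n).itvTgt h⟩,
    fun h => itv_ext h.1 h.2⟩

theorem pair_ext {p q : (cubeFlow n).Pair} (h1 : top p.1.2 = top q.1.2)
    (h2 : bot p.1.2 = bot q.1.2)
    (h3 : bot p.1.1 = bot q.1.1) : p = q :=
  Subtype.ext (Prod.ext (pt_ext (by rw [← mid, ← mid, h2]) h3) (pt_ext h1 h2))

/-- The two corners of a square. -/
theorem exists_pair {p q : (cubeFlow n).Pair} (hpq : p ≠ q)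
    (h : (cubeFlow n).bdry p = (cubeFlow n).bdry q) :
    ∃ (u : CubeVertex n) (i j : Fin n) (hij : i ≠ j) (hi : u i = true) (hj : u j = true),
      p = pair u i j hij hi hj ∧ q = pair u j i hij.symm hj hi := by
  obtain ⟨h1, h3⟩ := (bdry_eq_iff p q).1 h
  obtain ⟨i, hi, ei⟩ := exists_tgt_eq p.1.2
  obtain ⟨j, hj, ej⟩ := exists_tgt_eq q.1.2
  obtain ⟨k, hk, ek⟩ := exists_tgt_eq p.1.1
  obtain ⟨l, hl, el⟩ := exists_tgt_eq q.1.1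
  rw [← mid, ei] at hk ek
  rw [← mid, ej, ← h1] at hl el
  rw [← h1] at hj ej
  have hij : i ≠ j := by
    rintro rfl
    exact hpq (pair_ext h1 (by rw [ei, ej]) h3)
  have hki := ne_of_drop hk
  have hlj := ne_of_drop hl
  have e := ek.symm.trans (h3.trans el)
  have hkj : k = j := by
    have := congrFun e j
    rw [drop_of_ne hlj.symm, drop_self] at this
    by_contra hne
    rw [drop_of_ne (Ne.symm hne), drop_of_ne hij.symm, hj] at this
    exact Bool.noConfusion this
  have hli : l = i := by
    have := congrFun e i
    rw [drop_of_ne hki.symm, drop_self] at this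
    by_contra hne
    rw [drop_of_ne (Ne.symm hne), drop_of_ne hij, hi] at this
    exact Bool.noConfusion this
  subst hkj hli
  exact ⟨_, l, k, hij, hi, hj, pair_ext rfl ei ek, pair_ext h1.symm ej el⟩

theorem bdry_pair (hij : i ≠ j) (hi : u i = true) (hj : u j = true) :
    (cubeFlow n).bdry (pair u i j hij hi hj) = (cubeFlow n).bdry (pair u j i hij.symm hj hi) :=
  (bdry_eq_iff _ _).2 ⟨rfl, drop_comm _ _ _⟩

theorem pair_ne (hij : i ≠ j) (hi : u i = true) (hj : u j = true) :
    pair u i j hij hi hj ≠ pair u j i hij.symm hj hi := fun h =>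
  hij (drop_injective hi (congrArg (fun p : (cubeFlow n).Pair => bot p.1.2) h))

theorem ptVal_drop (s : (cubeFlow n).Pt → ZMod 2) (hi : u i = true) :
    ptVal s u (u.drop i) = s (edge u i hi) := ptVal_apply s (edge u i hi)

theorem isSignAssignment_iff (s : (cubeFlow n).Pt → ZMod 2) :
    (cubeFlow n).IsSignAssignment s ↔ ∀ u i j, i ≠ j → u i = true → u j = true →
      ptVal s u (u.drop i) + ptVal s (u.drop i) ((u.drop i).drop j) +
      (ptVal s u (u.drop j) + ptVal s (u.drop j) ((u.drop j).drop i)) = 1 := by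
  constructor
  · intro h u i j hij hi hj
    have := h _ _ (pair_ne hij hi hj) (bdry_pair hij hi hj)
    rw [ptVal_drop s hi, ptVal_drop s hj, ptVal_drop (u := u.drop i) s
      (by rw [drop_of_ne hij.symm, hj]), ptVal_drop (u := u.drop j) s (by rw [drop_of_ne hij, hi])]
    simp only [pair] at this
    grind
  · intro h p q hpq hb
    obtain ⟨u, i, j, hij, hi, hj, rfl, rfl⟩ := exists_pair hpq hb
    have := h u i j hij hi hj
    rw [ptVal_drop s hi, ptVal_drop s hj, ptVal_drop (u := u.drop i) s
      (by rw [drop_of_ne hij.symm, hj]), ptVal_drop (u := u.drop j) s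
      (by rw [drop_of_ne hij, hi])] at this
    simp only [pair]
    grind

/-- A closed function of the edges is the coboundary of a function of the vertices. -/
theorem exists_eq_ptCob {σ : (cubeFlow n).Pt → ZMod 2} (hσ : IsClosed σ) :
    ∃ t : (cubeFlow n).Ob → ZMod 2, σ = (cubeFlow n).ptCob t := by
  obtain ⟨t, ht⟩ := exists_potential (ptVal σ) fun u i j hij hi hj => by
    have := hσ _ _ (bdry_pair hij hi hj)
    rw [ptVal_drop σ hi, ptVal_drop σ hj, ptVal_drop (u := u.drop i) σ
      (by rw [drop_of_ne hij.symm, hj]), ptVal_drop (u := u.drop j) σ (by rw [drop_of_ne hij, hi])]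
    simp only [pair, pairSign] at this
    grind
  refine ⟨t, funext fun P => ?_⟩
  obtain ⟨i, hi, e⟩ := exists_tgt_eq P
  have h := ht _ i hi
  rw [← e, ptVal_apply] at h
  exact h

section Triples

theorem top_eq (t : (cubeFlow n).TripleOver (fun c => c = x) u) : top t.1.2.2 = u := t.2.1

theorem mid_upper (t : (cubeFlow n).TripleOver (fun c => c = x) u) :
    bot t.1.2.2 = top t.1.2.1 := t.2.2.1

theorem mid_lower (t : (cubeFlow n).TripleOver (fun c => c = x) u) :
    bot t.1.2.1 = top t.1.1 := t.2.2.2.1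

theorem bot_eq (t : (cubeFlow n).TripleOver (fun c => c = x) u) : bot t.1.1 = x := t.2.2.2.2

theorem le_of_triple (t : (cubeFlow n).TripleOver (fun c => c = x) u) :
    x ≤ u ∧ u.weight = x.weight + 3 := by
  obtain ⟨⟨P, B, A⟩, h1, h2, h3, h4⟩ := t
  have a1 := tgt_le P
  have a2 := tgt_le B
  have a3 := tgt_le A
  have b1 := weight_src P
  have b2 := weight_src B
  have b3 := weight_src A
  change top A = u at h1
  change bot A = top B at h2
  change bot B = top P at h3
  change bot P = x at h4
  rw [h1, h2] at a3 b3
  rw [h3] at a2 b2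
  rw [h4] at a1 b1
  exact ⟨a1.trans (a2.trans a3), by omega⟩

/-- The triple in which first the coordinate `i` and then the coordinate `j` is changed. -/
def triple (hx : x ≤ u) (hw : u.weight = x.weight + 3) (hij : i ≠ j) (hi : u i = true)
    (hj : u j = true) (xi : x i = false) (xj : x j = false) :
    (cubeFlow n).TripleOver (fun c => c = x) u :=
  have hj' : u.drop i j = true := by rw [drop_of_ne hij.symm, hj]
  ⟨(⟨((u.drop i).drop j, x), le_drop (le_drop hx xi) xj, by
      have h1 := weight_drop hi
      have h2 := weight_drop hj'
      dsimp only
      omega⟩, edge (u.drop i) j hj', edge u i hi), rfl, rfl, rfl, rfl⟩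

theorem exists_triple (t : (cubeFlow n).TripleOver (fun c => c = x) u) :
    ∃ (i j : Fin n), i ≠ j ∧ u i = true ∧ u j = true ∧ x i = false ∧ x j = false ∧
      bot t.1.2.2 = u.drop i ∧ bot t.1.2.1 = (u.drop i).drop j := by
  obtain ⟨⟨P, B, A⟩, h1, h2, h3, h4⟩ := t
  change top A = u at h1
  change bot A = top B at h2
  change bot B = top P at h3
  change bot P = x at h4
  obtain ⟨i, hi, ei⟩ := exists_tgt_eq A
  obtain ⟨j, hj, ej⟩ := exists_tgt_eq B
  have a1 := tgt_le P
  rw [h4, ← h3, ej] at a1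
  rw [← h2, ei] at hj ej a1
  rw [h1] at hi ei ej hj a1
  have hij := (ne_of_drop hj).symm
  refine ⟨i, j, hij, hi, apply_of_drop hj, ?_, ?_, ei, ej⟩
  · have := a1 i
    rw [drop_of_ne hij, drop_self] at this
    exact Bool.eq_false_iff.2 fun h => absurd (this h) Bool.false_ne_true
  · have := a1 j
    rw [drop_self] at this
    exact Bool.eq_false_iff.2 fun h => absurd (this h) Bool.false_ne_true

theorem lowerEdge_eq_iff (t t' : (cubeFlow n).TripleOver (fun c => c = x) u) :
    t.lowerEdge = t'.lowerEdge ↔ bot t.1.2.2 = bot t'.1.2.2 := by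
  constructor
  · exact fun h => congrArg (fun e => bot e.2) h
  · intro h
    refine Prod.ext ((bdry_eq_iff _ _).2 ⟨?_, (bot_eq t).trans (bot_eq t').symm⟩)
      (pt_ext ((top_eq t).trans (top_eq t').symm) h)
    exact (mid_upper t).symm.trans (h.trans (mid_upper t'))

theorem upperEdge_eq_iff (t t' : (cubeFlow n).TripleOver (fun c => c = x) u) :
    t.upperEdge = t'.upperEdge ↔ top t.1.1 = top t'.1.1 := by
  constructor
  · exact fun h => congrArg (fun e => top e.1) h
  · intro h
    refine Prod.ext (pt_ext h ((bot_eq t).trans (bot_eq t').symm)) ((bdry_eq_iff _ _).2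
      ⟨(top_eq t).trans (top_eq t').symm, ?_⟩)
    exact (mid_lower t).trans (h.trans (mid_lower t').symm)

/-- Over a 3-cube the boundary is a hexagon, whose six corners are the orders in which the
coordinates are changed. Neighbours differ in the last two or in the first two changes, and at most
three such moves join any two orders. -/
theorem card_bdryComp {u x : (cubeFlow n).Ob} (t₀ : (cubeFlow n).TripleOver (fun c => c = x) u) :
    Fintype.card ((cubeFlow n).BdryComp u x) = 1 := by
  refine Fintype.card_eq_one_iff.2 ?_
  have hx := le_of_triple t₀
  have key : ∀ t t' : (cubeFlow n).TripleOver (fun c => c = x) u,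
      (Quot.mk _ t : (cubeFlow n).BdryComp u x) = Quot.mk _ t' := by
    intro t t'
    obtain ⟨i, j, hij, hi, hj, xi, xj, e1, e2⟩ := exists_triple t
    obtain ⟨i', j', hij', hi', hj', xi', xj', e1', e2'⟩ := exists_triple t'
    by_cases h : i = i'
    · subst h
      exact Quot.sound (Or.inl ((lowerEdge_eq_iff t t').2 (e1.trans e1'.symm)))
    · have h1 : (Quot.mk _ t : (cubeFlow n).BdryComp u x) =
          Quot.mk _ (triple hx.1 hx.2 h hi hi' xi xi') :=
        Quot.sound (Or.inl ((lowerEdge_eq_iff t _).2 e1))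
      have h2 : (Quot.mk _ (triple hx.1 hx.2 h hi hi' xi xi') : (cubeFlow n).BdryComp u x) =
          Quot.mk _ (triple hx.1 hx.2 (Ne.symm h) hi' hi xi' xi) :=
        Quot.sound (Or.inr ((upperEdge_eq_iff _ _).2 (drop_comm _ _ _)))
      have h3 : (Quot.mk _ (triple hx.1 hx.2 (Ne.symm h) hi' hi xi' xi) :
          (cubeFlow n).BdryComp u x) = Quot.mk _ t' :=
        Quot.sound (Or.inl ((lowerEdge_eq_iff _ t').2 e1'.symm))
      exact h1.trans (h2.trans h3)
  exact ⟨Quot.mk _ t₀, fun K => by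
    induction K using Quot.ind with | _ t => exact key t t₀⟩

theorem mem_iff (hij : i ≠ j) (hik : i ≠ k) (hjk : j ≠ k) (hi : u i = true) (hj : u j = true)
    (hk : u k = true) (l : Fin n) :
    u l = true ∧ ((u.drop i).drop j).drop k l = false ↔ l = i ∨ l = j ∨ l = k := by
  constructor
  · rintro ⟨h1, h2⟩
    by_contra! h
    rw [drop_of_ne h.2.2, drop_of_ne h.2.1, drop_of_ne h.1, h1] at h2
    exact Bool.noConfusion h2
  · rintro (rfl | rfl | rfl)
    · exact ⟨hi, by rw [drop_of_ne hik, drop_of_ne hij, drop_self]⟩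
    · exact ⟨hj, by rw [drop_of_ne hjk, drop_self]⟩
    · exact ⟨hk, drop_self⟩

theorem weight_three (hij : i ≠ j) (hik : i ≠ k) (hjk : j ≠ k) (hi : u i = true) (hj : u j = true)
    (hk : u k = true) : u.weight = (((u.drop i).drop j).drop k).weight + 3 := by
  have h1 := weight_drop hi
  have h2 := weight_drop (u := u.drop i) (i := j) (by rw [drop_of_ne hij.symm, hj])
  have h3 := weight_drop (u := (u.drop i).drop j) (i := k)
    (by rw [drop_of_ne hjk.symm, drop_of_ne hik.symm, hk])
  omega

theorem exists_other (hij : i ≠ j) (hik : i ≠ k) (hjk : j ≠ k) {l : Fin n}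
    (hl : l = i ∨ l = j ∨ l = k) : ∃ m, l ≠ m ∧ (m = i ∨ m = j ∨ m = k) := by
  rcases hl with rfl | rfl | rfl
  · exact ⟨j, hij, Or.inr (Or.inl rfl)⟩
  · exact ⟨i, hij.symm, Or.inl rfl⟩
  · exact ⟨i, hik.symm, Or.inl rfl⟩

theorem sum_lower {s : (cubeFlow n).Pt → ZMod 2} (hs : (cubeFlow n).IsSignAssignment s)
    (f : (cubeFlow n).PreFraming) (hij : i ≠ j) (hik : i ≠ k) (hjk : j ≠ k) (hi : u i = true)
    (hj : u j = true) (hk : u k = true) (hx : x = ((u.drop i).drop j).drop k) :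
    ∑ t : (cubeFlow n).TripleOver (fun c => c = x) u, t.sign s *
      f.itv ((cubeFlow n).bdry t.lowerPair) =
      itvVal f (u.drop i) x + itvVal f (u.drop j) x + itvVal f (u.drop k) x := by
  have hm : ∀ l, u l = true ∧ x l = false ↔ l = i ∨ l = j ∨ l = k :=
    hx ▸ mem_iff hij hik hjk hi hj hk
  have hle : x ≤ u := hx ▸ drop_le.trans (drop_le.trans drop_le)
  have hw : u.weight = x.weight + 3 := hx ▸ weight_three hij hik hjk hi hj hk
  have hp := TripleOver.isPairing_lowerEdge (Φ := fun c => c = x) (a := u) hs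
  have h1 := hp.congr_fun (e' := fun t => bot t.1.2.2) lowerEdge_eq_iff
  have h2 := h1.sum_edges (fun _ => True) (fun _ _ _ h => h) fun v => itvVal f v x
  simp only [true_and, if_true] at h2
  have h3 : (Finset.univ.filter fun v : CubeVertex n =>
      ∃ t : (cubeFlow n).TripleOver (fun c => c = x) u, bot t.1.2.2 = v) =
      {u.drop i, u.drop j, u.drop k} := by
    ext v
    simp only [Finset.mem_filter, Finset.mem_univ, true_and, Finset.mem_insert,
      Finset.mem_singleton]
    constructor
    · rintro ⟨t, rfl⟩
      obtain ⟨l, m, -, hl, -, xl, -, e, -⟩ := exists_triple t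
      rw [e]
      rcases (hm l).1 ⟨hl, xl⟩ with rfl | rfl | rfl <;> simp
    · have : ∀ l, (l = i ∨ l = j ∨ l = k) → ∃ t : (cubeFlow n).TripleOver (fun c => c = x) u,
          bot t.1.2.2 = u.drop l := fun l hl => by
        obtain ⟨m, hlm, hm'⟩ := exists_other hij hik hjk hl
        have a1 := (hm l).2 hl
        have a2 := (hm m).2 hm'
        exact ⟨triple hle hw hlm a1.1 a2.1 a1.2 a2.2, rfl⟩
      rintro (rfl | rfl | rfl)
      · exact this i (Or.inl rfl)
      · exact this j (Or.inr (Or.inl rfl))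
      · exact this k (Or.inr (Or.inr rfl))
  have h4 : ∑ v ∈ ({u.drop i, u.drop j, u.drop k} : Finset (CubeVertex n)), itvVal f v x =
      itvVal f (u.drop i) x + itvVal f (u.drop j) x + itvVal f (u.drop k) x := by
    have n1 : u.drop i ≠ u.drop j := fun h => hij (drop_injective hi h)
    have n2 : u.drop i ≠ u.drop k := fun h => hik (drop_injective hi h)
    have n3 : u.drop j ≠ u.drop k := fun h => hjk (drop_injective hj h)
    rw [Finset.sum_insert (by simp [n1, n2]), Finset.sum_insert (by simp [n3]),
      Finset.sum_singleton, add_assoc]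
  rw [← h4]
  refine Eq.trans (Finset.sum_congr rfl fun t _ => ?_) (h2.symm.trans ?_)
  · rw [itvVal_bdry]
    change _ * itvVal f (top t.1.2.1) (bot t.1.1) = _
    rw [← mid_upper t, bot_eq]
  · rw [← h3]

theorem sum_upper {s : (cubeFlow n).Pt → ZMod 2} (hs : (cubeFlow n).IsSignAssignment s)
    (f : (cubeFlow n).PreFraming) (hij : i ≠ j) (hik : i ≠ k) (hjk : j ≠ k) (hi : u i = true)
    (hj : u j = true) (hk : u k = true) (hx : x = ((u.drop i).drop j).drop k) :
    ∑ t : (cubeFlow n).TripleOver (fun c => c = x) u, t.sign s *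
      (1 + s t.1.1 + f.itv ((cubeFlow n).bdry t.upperPair)) =
      (1 + ptVal s ((u.drop i).drop j) x + itvVal f u ((u.drop i).drop j)) +
      (1 + ptVal s ((u.drop i).drop k) x + itvVal f u ((u.drop i).drop k)) +
      (1 + ptVal s ((u.drop j).drop k) x + itvVal f u ((u.drop j).drop k)) := by
  have hm : ∀ l, u l = true ∧ x l = false ↔ l = i ∨ l = j ∨ l = k :=
    hx ▸ mem_iff hij hik hjk hi hj hk
  have hle : x ≤ u := hx ▸ drop_le.trans (drop_le.trans drop_le)
  have hw : u.weight = x.weight + 3 := hx ▸ weight_three hij hik hjk hi hj hk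
  have hp := TripleOver.isPairing_upperEdge (Φ := fun c => c = x) (a := u) hs
  have h1 := hp.congr_fun (e' := fun t => top t.1.1) upperEdge_eq_iff
  have h2 := h1.sum_edges (fun _ => True) (fun _ _ _ h => h)
    fun w => 1 + ptVal s w x + itvVal f u w
  simp only [true_and, if_true] at h2
  have h3 : (Finset.univ.filter fun w : CubeVertex n =>
      ∃ t : (cubeFlow n).TripleOver (fun c => c = x) u, top t.1.1 = w) =
      {(u.drop i).drop j, (u.drop i).drop k, (u.drop j).drop k} := by
    ext w
    simp only [Finset.mem_filter, Finset.mem_univ, true_and, Finset.mem_insert,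
      Finset.mem_singleton]
    constructor
    · rintro ⟨t, rfl⟩
      obtain ⟨l, m, hlm, hl, hm', xl, xm, -, e⟩ := exists_triple t
      rw [← mid_lower t, e]
      rcases (hm l).1 ⟨hl, xl⟩ with rfl | rfl | rfl <;>
        rcases (hm m).1 ⟨hm', xm⟩ with rfl | rfl | rfl <;>
        first | exact absurd rfl hlm | simp [drop_comm]
    · have : ∀ l m, l ≠ m → (l = i ∨ l = j ∨ l = k) → (m = i ∨ m = j ∨ m = k) →
          ∃ t : (cubeFlow n).TripleOver (fun c => c = x) u,
            top t.1.1 = (u.drop l).drop m := fun l m hlm hl hm' => by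
        have a1 := (hm l).2 hl
        have a2 := (hm m).2 hm'
        exact ⟨triple hle hw hlm a1.1 a2.1 a1.2 a2.2, rfl⟩
      rintro (rfl | rfl | rfl)
      · exact this i j hij (Or.inl rfl) (Or.inr (Or.inl rfl))
      · exact this i k hik (Or.inl rfl) (Or.inr (Or.inr rfl))
      · exact this j k hjk (Or.inr (Or.inl rfl)) (Or.inr (Or.inr rfl))
  have h4 : ∑ w ∈ ({(u.drop i).drop j, (u.drop i).drop k, (u.drop j).drop k} :
      Finset (CubeVertex n)), (1 + ptVal s w x + itvVal f u w) =
      (1 + ptVal s ((u.drop i).drop j) x + itvVal f u ((u.drop i).drop j)) +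
      (1 + ptVal s ((u.drop i).drop k) x + itvVal f u ((u.drop i).drop k)) +
      (1 + ptVal s ((u.drop j).drop k) x + itvVal f u ((u.drop j).drop k)) := by
    have n1 : (u.drop i).drop j ≠ (u.drop i).drop k := fun h =>
      hjk (drop_injective (by rw [drop_of_ne hij.symm, hj]) h)
    have n2 : (u.drop i).drop j ≠ (u.drop j).drop k := fun h =>
      hik (drop_injective (by rw [drop_of_ne hij, hi]) ((drop_comm u j i).trans h))
    have n3 : (u.drop i).drop k ≠ (u.drop j).drop k := fun h =>
      hij (drop_injective (by rw [drop_of_ne hik, hi])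
        ((drop_comm u k i).trans (h.trans (drop_comm u j k))))
    rw [Finset.sum_insert (by simp [n1, n2]), Finset.sum_insert (by simp [n3]),
      Finset.sum_singleton, ← add_assoc]
  rw [← h4]
  refine Eq.trans (Finset.sum_congr rfl fun t _ => ?_) (h2.symm.trans ?_)
  · rw [itvVal_bdry, ← ptVal_apply s, bot_eq]
    change _ * (_ + itvVal f (top t.1.2.2) (bot t.1.2.1)) = _
    rw [top_eq, mid_lower]
  · rw [← h3]

theorem sum_framing {s : (cubeFlow n).Pt → ZMod 2} (hs : (cubeFlow n).IsSignAssignment s)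
    (f : (cubeFlow n).PreFraming) (hij : i ≠ j) (hik : i ≠ k) (hjk : j ≠ k) (hi : u i = true)
    (hj : u j = true) (hk : u k = true) (hx : x = ((u.drop i).drop j).drop k) :
    ∑ t : (cubeFlow n).TripleOver (fun c => c = x) u, t.sign s *
      (f.itv ((cubeFlow n).bdry t.lowerPair) +
        (1 + s t.1.1 + f.itv ((cubeFlow n).bdry t.upperPair))) =
      itvVal f (u.drop i) x + itvVal f (u.drop j) x + itvVal f (u.drop k) x +
      ((1 + ptVal s ((u.drop i).drop j) x + itvVal f u ((u.drop i).drop j)) +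
      (1 + ptVal s ((u.drop i).drop k) x + itvVal f u ((u.drop i).drop k)) +
      (1 + ptVal s ((u.drop j).drop k) x + itvVal f u ((u.drop j).drop k))) := by
  rw [← sum_lower hs f hij hik hjk hi hj hk hx, ← sum_upper hs f hij hik hjk hi hj hk hx,
    ← Finset.sum_add_distrib]
  exact Finset.sum_congr rfl fun t _ => mul_add _ _ _

/-- The framing condition for the cube. -/
theorem isFraming_iff {s : (cubeFlow n).Pt → ZMod 2} (hs : (cubeFlow n).IsSignAssignment s)
    (f : (cubeFlow n).PreFraming) : (cubeFlow n).IsFraming s f ↔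
      ∀ u i j k, i ≠ j → i ≠ k → j ≠ k → u i = true → u j = true → u k = true →
      itvVal f u ((u.drop i).drop j) + itvVal f u ((u.drop i).drop k) +
      itvVal f u ((u.drop j).drop k) + itvVal f (u.drop i) (((u.drop i).drop j).drop k) +
      itvVal f (u.drop j) (((u.drop i).drop j).drop k) +
      itvVal f (u.drop k) (((u.drop i).drop j).drop k) =
      ptVal s ((u.drop i).drop j) (((u.drop i).drop j).drop k) +
      ptVal s ((u.drop i).drop k) (((u.drop i).drop j).drop k) +
      ptVal s ((u.drop j).drop k) (((u.drop i).drop j).drop k) := by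
  rw [OneFlowCat.isFraming_iff hs]
  constructor
  · intro h u i j k hij hik hjk hi hj hk
    have h1 := h u (((u.drop i).drop j).drop k)
    have hw := weight_three hij hik hjk hi hj hk
    have hm := mem_iff hij hik hjk hi hj hk
    rw [card_bdryComp (triple (drop_le.trans (drop_le.trans drop_le)) hw hij hi hj
      ((hm i).2 (Or.inl rfl)).2 ((hm j).2 (Or.inr (Or.inl rfl))).2)] at h1
    have h2 := (congrArg (fun y => ((1 : ℕ) : ZMod 2) + y)
      (sum_framing hs f hij hik hjk hi hj hk rfl)).symm.trans h1
    simp only [Nat.cast_one] at h2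
    grind
  · intro h u x
    by_cases h0 : IsEmpty ((cubeFlow n).TripleOver (fun c => c = x) u)
    · have h1 : IsEmpty ((cubeFlow n).BdryComp u x) := ⟨fun K => h0.false K.out⟩
      simp
    · obtain ⟨t⟩ := not_isEmpty_iff.1 h0
      obtain ⟨i, j, hij, hi, hj, -, -, -, e⟩ := exists_triple t
      obtain ⟨k, hk, e'⟩ := exists_tgt_eq t.1.1
      have e'' : bot t.1.1 = x := bot_eq t
      rw [e'', ← mid_lower t, e] at e'
      rw [← mid_lower t, e] at hk
      have hjk := (ne_of_drop hk).symm
      have hik := (ne_of_drop (apply_of_drop hk)).symm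
      have hk' := apply_of_drop (apply_of_drop hk)
      have h1 := h u i j k hij hik hjk hi hj hk'
      rw [card_bdryComp t]
      refine (congrArg (fun y => ((1 : ℕ) : ZMod 2) + y)
        (sum_framing hs f hij hik hjk hi hj hk' e')).trans ?_
      subst e'
      simp only [Nat.cast_one]
      grind

end Triples

end CubeFlow

end

/-! ### The standard framing of the cube and uniqueness up to gauge -/

noncomputable section

namespace OneFlowCat

open scoped Classical

variable {C : OneFlowCat}

/-- The function of the intervals which is the sum of the values of a function on the two boundary
points. -/
def cornerSum (H : C.Pair → ZMod 2) (I : C.Itv) : ZMod 2 := ∑ p : C.Pair with C.bdry p = I, H p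

theorem cornerSum_bdry (H : C.Pair → ZMod 2) {p q : C.Pair} (hpq : p ≠ q)
    (h : C.bdry p = C.bdry q) : cornerSum H (C.bdry p) = H p + H q := by
  obtain ⟨p', q', hpq', h'⟩ := C.bdry_two (C.bdry p)
  have h1 := (h' p).1 rfl
  have h2 := (h' q).1 h.symm
  have : (Finset.univ.filter fun r : C.Pair => C.bdry r = C.bdry p) = {p, q} := by
    ext r
    simp only [Finset.mem_filter, Finset.mem_univ, true_and, Finset.mem_insert,
      Finset.mem_singleton, h']
    rcases h1 with rfl | rfl <;> rcases h2 with rfl | rfl <;> tauto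
  rw [cornerSum, this, Finset.sum_pair hpq]

end OneFlowCat

namespace CubeFlow

open scoped Classical
open CubeVertex OneFlowCat

variable {n : ℕ} {u v w x : CubeVertex n} {i j k : Fin n}

/-- The function of the edges with given values. -/
def ofEdge (G : CubeVertex n → Fin n → ZMod 2) (P : (cubeFlow n).Pt) : ZMod 2 :=
  ∑ l with top P l ≠ bot P l, G (top P) l

theorem ptVal_ofEdge (G : CubeVertex n → Fin n → ZMod 2) (hi : u i = true) :
    ptVal (ofEdge G) u (u.drop i) = G u i := by
  rw [ptVal_drop _ hi]
  have : (Finset.univ.filter fun l => u l ≠ u.drop i l) = {i} := by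
    ext l
    by_cases hl : l = i
    · subst hl; simp [hi]
    · simp [hl, drop_of_ne hl]
  change ∑ l with u l ≠ u.drop i l, G u l = _
  rw [this, Finset.sum_singleton]

variable (n) in
/-- The standard sign assignment of the cube. -/
def stdSign : (cubeFlow n).Pt → ZMod 2 := ofEdge before

variable (n) in
/-- A frame assignment for the standard sign assignment of the cube. -/
def stdFrame : (cubeFlow n).PreFraming where
  itv I := ∏ l with I.1.1 l ≠ I.1.2 l, before I.1.1 l
  circ := Empty.elim

theorem itvVal_pair (f : (cubeFlow n).PreFraming) (hij : i ≠ j) (hi : u i = true)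
    (hj : u j = true) : itvVal f u ((u.drop i).drop j) =
      f.itv ((cubeFlow n).bdry (pair u i j hij hi hj)) :=
  (itvVal_bdry f (pair u i j hij hi hj)).symm

theorem itvVal_stdFrame (hij : i ≠ j) (hi : u i = true) (hj : u j = true) :
    itvVal (stdFrame n) u ((u.drop i).drop j) = u.before i * u.before j := by
  rw [itvVal_pair _ hij hi hj]
  have : (Finset.univ.filter fun l => u l ≠ (u.drop i).drop j l) = {i, j} := by
    ext l
    by_cases hl : l = j
    · subst hl; simp [hj]
    · by_cases hl' : l = i
      · subst hl'; simp [hi, drop_of_ne hl]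
      · simp [hl, hl', drop_of_ne hl, drop_of_ne hl']
  change ∏ l with u l ≠ (u.drop i).drop j l, u.before l = _
  rw [this, Finset.prod_pair hij]

theorem isFramed_std : (cubeFlow n).IsFramed (stdSign n) (stdFrame n) := by
  have hs : (cubeFlow n).IsSignAssignment (stdSign n) := by
    refine (isSignAssignment_iff _).2 fun u i j hij hi hj => ?_
    have h1 : u.drop i j = true := by rw [drop_of_ne hij.symm, hj]
    have h2 : u.drop j i = true := by rw [drop_of_ne hij, hi]
    rw [stdSign, ptVal_ofEdge _ hi, ptVal_ofEdge _ hj, ptVal_ofEdge _ h1, ptVal_ofEdge _ h2,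
      before_drop hi, before_drop hj]
    rcases lt_or_gt_of_ne hij with h | h <;> simp only [h, h.not_gt, if_true, if_false] <;> grind
  refine ⟨hs, (CubeFlow.isFraming_iff hs _).2 fun u i j k hij hik hjk hi hj hk => ?_⟩
  have i1 : u.drop i j = true := by rw [drop_of_ne hij.symm, hj]
  have i2 : u.drop i k = true := by rw [drop_of_ne hik.symm, hk]
  have j1 : u.drop j i = true := by rw [drop_of_ne hij, hi]
  have j2 : u.drop j k = true := by rw [drop_of_ne hjk.symm, hk]
  have k1 : u.drop k i = true := by rw [drop_of_ne hik, hi]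
  have k2 : u.drop k j = true := by rw [drop_of_ne hjk, hj]
  have ij : (u.drop i).drop j k = true := by rw [drop_of_ne hjk.symm, i2]
  have ik : (u.drop i).drop k j = true := by rw [drop_of_ne hjk, i1]
  have jk : (u.drop j).drop k i = true := by rw [drop_of_ne hik, j1]
  have e1 : ((u.drop i).drop j).drop k = ((u.drop i).drop k).drop j := drop_comm _ _ _
  have e2 : ((u.drop i).drop j).drop k = ((u.drop j).drop i).drop k := by rw [drop_comm u i j]
  have e3 : ((u.drop i).drop j).drop k = ((u.drop k).drop i).drop j := by
    rw [e1, drop_comm u i k]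
  have e4 : ((u.drop i).drop j).drop k = ((u.drop j).drop k).drop i := by
    rw [e2, drop_comm (u.drop j) i k]
  have a1 := itvVal_stdFrame hij hi hj
  have a2 := itvVal_stdFrame hik hi hk
  have a3 := itvVal_stdFrame hjk hj hk
  have a4 := itvVal_stdFrame hjk i1 i2
  have a5 := itvVal_stdFrame hik j1 j2
  have a6 := itvVal_stdFrame hij k1 k2
  have a7 := ptVal_ofEdge before ij
  have a8 := ptVal_ofEdge before ik
  have a9 := ptVal_ofEdge before jk
  rw [← e2] at a5
  rw [← e3] at a6
  rw [← e1] at a8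
  rw [← e4] at a9
  rw [a1, a2, a3, a4, a5, a6, stdSign, a7, a8, a9, before_drop i1, before_drop i2, before_drop j2,
    before_drop hi, before_drop hi, before_drop hj, before_drop hj, before_drop hk, before_drop hk]
  clear a1 a2 a3 a4 a5 a6 a7 a8 a9
  -- For each relative order of i, j, k the framing condition is a polynomial identity in the three
  -- numbers of preceding coordinates; inconsistent orders are discarded.
  rcases lt_or_gt_of_ne hij with h1 | h1 <;> rcases lt_or_gt_of_ne hik with h2 | h2 <;>
    rcases lt_or_gt_of_ne hjk with h3 | h3 <;>
    first
    | exact absurd (h1.trans h3) h2.not_gt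
    | exact absurd (h3.trans h1) h2.not_gt
    | (simp only [h1, h2, h3, h1.not_gt, h2.not_gt, h3.not_gt, if_true, if_false]
       generalize u.before i = a
       generalize u.before j = b
       generalize u.before k = c
       clear * -
       revert a b c
       decide)

/-- Any two framings of the cube differ by a change of gauge. -/
theorem exists_gauge {s s' : (cubeFlow n).Pt → ZMod 2} {f f' : (cubeFlow n).PreFraming}
    (h : (cubeFlow n).IsFramed s f) (h' : (cubeFlow n).IsFramed s' f') :
    ∃ (t : (cubeFlow n).Ob → ZMod 2) (g : (cubeFlow n).Pt → ZMod 2),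
      s' = s + (cubeFlow n).ptCob t ∧
      ∀ p q, p ≠ q → (cubeFlow n).bdry p = (cubeFlow n).bdry q →
        f'.itv ((cubeFlow n).bdry p) = f.itv ((cubeFlow n).bdry p) +
          pairSign ((cubeFlow n).ptCob t) p +
          ((cubeFlow n).ptCob t p.1.2 * s p.1.1 + pairSign g p +
            ((cubeFlow n).ptCob t q.1.2 * s q.1.1 + pairSign g q)) := by
  obtain ⟨t, ht⟩ := exists_eq_ptCob (h.1.isClosed_add h'.1)
  have hτ := isClosed_ptCob (C := cubeFlow n) t
  have hs' : s' = s + (cubeFlow n).ptCob t := by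
    rw [← ht]
    funext P
    simp only [Pi.add_apply]
    grind
  set τ := (cubeFlow n).ptCob t with hτdef
  have hbdry : ∀ p q, p ≠ q → (cubeFlow n).bdry p = (cubeFlow n).bdry q →
      cornerSum (cornerChange 0 0 s τ) ((cubeFlow n).bdry p) =
        cornerChange 0 0 s τ p + cornerChange 0 0 s τ q :=
    fun p q hpq hb => cornerSum_bdry _ hpq hb
  -- As τ is closed, its value belongs to the interval; weighting by the sign picks up one end only.
  have hτI : ∀ p q, p ≠ q → (cubeFlow n).bdry p = (cubeFlow n).bdry q →
      cornerSum (fun r => pairSign s r * pairSign τ r) ((cubeFlow n).bdry p) =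
        pairSign τ p := by
    intro p q hpq hb
    rw [cornerSum_bdry _ hpq hb, ← hτ p q hb]
    have := (isPairing_bdry h.1).flip p q hpq hb
    grind
  let f'' : (cubeFlow n).PreFraming :=
    { itv := fun I => f.itv I +
        cornerSum (fun r => pairSign s r * pairSign τ r) I +
        cornerSum (cornerChange 0 0 s τ) I
      circ := Empty.elim }
  have hf'' : ∀ p q, p ≠ q → (cubeFlow n).bdry p = (cubeFlow n).bdry q →
      f''.itv ((cubeFlow n).bdry p) = f.itv ((cubeFlow n).bdry p) + pairSign τ p +
        (cornerChange 0 0 s τ p + cornerChange 0 0 s τ q) := by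
    intro p q hpq hb
    simp only [f'']
    rw [hτI p q hpq hb, hbdry p q hpq hb]
  -- Twisting f along τ gives a framing for s'. Two framings for the same signs satisfy the same
  -- affine condition on 3-cubes, so their difference is closed and hence comes from a function of
  -- the edges.
  have h'' := h.twist hτ 0 0 hf''
  rw [← hs'] at h''
  have c1 := (CubeFlow.isFraming_iff h'.1 f').1 h'.2
  have c2 := (CubeFlow.isFraming_iff h''.1 f'').1 h''.2
  obtain ⟨g, hg⟩ := exists_edge_potential (fun u v => itvVal f' u v + itvVal f'' u v)
    fun u i j k hij hik hjk hi hj hk => by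
      have := c1 u i j k hij hik hjk hi hj hk
      have := c2 u i j k hij hik hjk hi hj hk
      grind
  refine ⟨t, ofEdge g, hs', fun p q hpq hb => ?_⟩
  have h1 := hf'' p q hpq hb
  obtain ⟨u, i, j, hij, hi, hj, rfl, rfl⟩ := exists_pair hpq hb
  have h2 := hg u i j hij hi hj
  have i1 : u.drop i j = true := by rw [drop_of_ne hij.symm, hj]
  have j1 : u.drop j i = true := by rw [drop_of_ne hij, hi]
  rw [itvVal_pair f' hij hi hj, itvVal_pair f'' hij hi hj, h1, ← ptVal_ofEdge g hi,
    ← ptVal_ofEdge g hj, ← ptVal_ofEdge g i1, ← ptVal_ofEdge g j1, ptVal_drop _ hi,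
    ptVal_drop _ hj, ptVal_drop _ i1, ptVal_drop _ j1] at h2
  simp only [cornerChange, zero_mul, add_zero, pair, pairSign] at h2 ⊢
  grind

end CubeFlow

end

noncomputable section

/-! ### The framings of `C_F` -/

/-- The number of components of a disjoint union of copies of a graph. -/
theorem card_quot_prod {T K T' : Type} (e : T ≃ K × T') (r : T → T → Prop) (r' : T' → T' → Prop)
    (h : ∀ t t', r t t' ↔ (e t).1 = (e t').1 ∧ r' (e t).2 (e t').2) :
    Nat.card (Quot r) = Nat.card K * Nat.card (Quot r') := by
  rw [← Nat.card_prod]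
  refine Nat.card_congr
    { toFun := Quot.lift (fun t => ((e t).1, Quot.mk _ (e t).2)) fun t t' ht => ?_
      invFun := fun x => Quot.lift (fun t => Quot.mk _ (e.symm (x.1, t))) (fun t t' ht => ?_) x.2
      left_inv := fun q => ?_
      right_inv := fun x => ?_ }
  · have := (h t t').1 ht
    exact Prod.ext this.1 (Quot.sound this.2)
  · exact Quot.sound ((h _ _).2 (by simpa using ht))
  · induction q using Quot.ind with | _ t =>
    change Quot.mk _ (e.symm ((e t).1, (e t).2)) = _
    rw [Prod.mk.eta, e.symm_apply_apply]
  · obtain ⟨k, q⟩ := x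
    induction q using Quot.ind with | _ t =>
    change ((e (e.symm (k, t))).1, Quot.mk _ (e (e.symm (k, t))).2) = _
    rw [e.apply_symm_apply]

namespace SignedCubeFunctor

open scoped Classical
open OneFlowCat

variable {n : ℕ} {F : SignedCubeFunctor n}

variable (F) in
/-- The elements of all correspondences `F_{u,v}`. -/
abbrev Elt : Type := Σ q : {q : CubeVertex n × CubeVertex n // q.2 ≤ q.1}, (F.hom q.2).carrier

namespace Elt

def src (X : F.Elt) : Σ u, F.obj u := ⟨X.1.1.1, (F.hom X.1.2).src X.2⟩

def tgt (X : F.Elt) : Σ u, F.obj u := ⟨X.1.1.2, (F.hom X.1.2).tgt X.2⟩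

/-- The composition of elements of correspondences. -/
def comp : {p : F.Elt × F.Elt // p.2.tgt = p.1.src} → F.Elt
  | ⟨(⟨⟨(v', w), hB⟩, B⟩, ⟨⟨(u, v), hA⟩, A⟩), h⟩ =>
    have hv : v = v' := congrArg Sigma.fst h
    ⟨⟨(u, w), (hB.trans hv.ge).trans hA⟩,
      (F.map hA (hB.trans hv.ge)).toEquiv (by
        subst hv
        exact ⟨(B, A), eq_of_heq (Sigma.mk.inj h).2⟩)⟩

theorem src_comp (p : {p : F.Elt × F.Elt // p.2.tgt = p.1.src}) :
    (comp p).src = p.1.2.src := by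
  obtain ⟨⟨⟨⟨⟨v', w⟩, hB⟩, B⟩, ⟨⟨⟨u, v⟩, hA⟩, A⟩⟩, h⟩ := p
  obtain rfl : v = v' := congrArg Sigma.fst h
  have h' := eq_of_heq (Sigma.mk.inj h).2
  exact congrArg (Sigma.mk u) ((F.map hA hB).src_eq ⟨(B, A), h'⟩)

theorem tgt_comp (p : {p : F.Elt × F.Elt // p.2.tgt = p.1.src}) :
    (comp p).tgt = p.1.1.tgt := by
  obtain ⟨⟨⟨⟨⟨v', w⟩, hB⟩, B⟩, ⟨⟨⟨u, v⟩, hA⟩, A⟩⟩, h⟩ := p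
  obtain rfl : v = v' := congrArg Sigma.fst h
  have h' := eq_of_heq (Sigma.mk.inj h).2
  exact congrArg (Sigma.mk w) ((F.map hA hB).tgt_eq ⟨(B, A), h'⟩)

/-- Factorizations through a given vertex are unique. -/
theorem comp_inj {p q : {p : F.Elt × F.Elt // p.2.tgt = p.1.src}} (h : comp p = comp q)
    (hv : p.1.2.1.1.2 = q.1.2.1.1.2) : p = q := by
  obtain ⟨⟨⟨⟨⟨v', w⟩, hB⟩, B⟩, ⟨⟨⟨u, v⟩, hA⟩, A⟩⟩, h1⟩ := p
  obtain ⟨⟨⟨⟨⟨v₂', w₂⟩, hB'⟩, B'⟩, ⟨⟨⟨u₂, v₂⟩, hA'⟩, A'⟩⟩, h1'⟩ := q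
  obtain rfl : v = v' := congrArg Sigma.fst h1
  obtain rfl : v₂ = v₂' := congrArg Sigma.fst h1'
  change v = v₂ at hv
  subst hv
  obtain rfl : u = u₂ := congrArg (fun q : F.Elt => q.1.1.1) h
  obtain rfl : w = w₂ := congrArg (fun q : F.Elt => q.1.1.2) h
  have h2 := eq_of_heq (Sigma.mk.inj h1).2
  have h2' := eq_of_heq (Sigma.mk.inj h1').2
  have h3 : (F.map hA hB).toEquiv ⟨(B, A), h2⟩ = (F.map hA hB).toEquiv ⟨(B', A'), h2'⟩ :=
    eq_of_heq (Sigma.mk.inj h).2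
  have h4 := congrArg Subtype.val ((F.map hA hB).toEquiv.injective h3)
  obtain ⟨rfl, rfl⟩ := Prod.mk.inj h4
  rfl

theorem exists_comp (X : F.Elt) {v : CubeVertex n} (h₁ : v ≤ X.1.1.1) (h₂ : X.1.1.2 ≤ v) :
    ∃ p : {p : F.Elt × F.Elt // p.2.tgt = p.1.src}, comp p = X ∧
      p.1.2.1.1 = (X.1.1.1, v) ∧ p.1.1.1.1 = (v, X.1.1.2) := by
  obtain ⟨⟨⟨u, w⟩, h⟩, X⟩ := X
  obtain ⟨⟨⟨B, A⟩, hBA⟩, hX⟩ := (F.map h₁ h₂).toEquiv.surjective X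
  exact ⟨⟨(⟨⟨(v, w), h₂⟩, B⟩, ⟨⟨(u, v), h₁⟩, A⟩), Sigma.ext rfl (heq_of_eq hBA)⟩,
    Sigma.ext rfl (heq_of_eq hX), rfl, rfl⟩

/-- Composition is used for elements of all correspondences, not only those of degree one and two,
because a triple of points is compared through its composite over a 3-cube. -/
theorem comp_assoc (Z Y X : F.Elt) (h₁ : X.tgt = Y.src) (h₂ : Y.tgt = Z.src) :
    comp ⟨(comp ⟨(Z, Y), h₂⟩, X), h₁.trans (src_comp ⟨(Z, Y), h₂⟩).symm⟩ =
      comp ⟨(Z, comp ⟨(Y, X), h₁⟩), (tgt_comp ⟨(Y, X), h₁⟩).trans h₂⟩ := by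
  obtain ⟨⟨⟨w', x⟩, hC⟩, C⟩ := Z
  obtain ⟨⟨⟨v', w⟩, hB⟩, B⟩ := Y
  obtain ⟨⟨⟨u, v⟩, hA⟩, A⟩ := X
  obtain rfl : v = v' := congrArg Sigma.fst h₁
  obtain rfl : w = w' := congrArg Sigma.fst h₂
  have h1 := eq_of_heq (Sigma.mk.inj h₁).2
  have h2 := eq_of_heq (Sigma.mk.inj h₂).2
  exact Sigma.ext rfl (heq_of_eq (F.map_assoc hA hB hC ⟨(⟨(C, B), h2⟩, A), h1⟩))

end Elt

/-- A point of `C_F` as an element of a correspondence. -/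
def ptElt (P : F.FlowPt) : F.Elt := ⟨⟨P.1.1, P.1.2.1⟩, P.2⟩

/-- An interval of `C_F` as an element of a correspondence. -/
def itvElt (X : F.FlowItv) : F.Elt := ⟨⟨X.1.1, X.1.2.1⟩, X.2⟩

theorem ptElt_injective : Function.Injective (ptElt (F := F)) := by
  rintro ⟨⟨⟨u, v⟩, h⟩, P⟩ ⟨⟨⟨u', v'⟩, h'⟩, P'⟩ e
  obtain rfl : u = u' := congrArg (fun q : F.Elt => q.1.1.1) e
  obtain rfl : v = v' := congrArg (fun q : F.Elt => q.1.1.2) e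
  exact Sigma.ext rfl (Sigma.mk.inj e).2

theorem itvElt_injective : Function.Injective (itvElt (F := F)) := by
  rintro ⟨⟨⟨u, v⟩, h⟩, P⟩ ⟨⟨⟨u', v'⟩, h'⟩, P'⟩ e
  obtain rfl : u = u' := congrArg (fun q : F.Elt => q.1.1.1) e
  obtain rfl : v = v' := congrArg (fun q : F.Elt => q.1.1.2) e
  exact Sigma.ext rfl (Sigma.mk.inj e).2

theorem exists_ptElt (X : F.Elt) (h : X.1.1.1.weight = X.1.1.2.weight + 1) :
    ∃ P : F.FlowPt, ptElt P = X := ⟨⟨⟨X.1.1, X.1.2, h⟩, X.2⟩, rfl⟩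

/-- A composable pair of points, as elements of correspondences. -/
def pairElt (p : F.flow.Pair) : {p : F.Elt × F.Elt // p.2.tgt = p.1.src} :=
  ⟨(ptElt p.1.1, ptElt p.1.2), p.2⟩

theorem itvElt_bdry (p : F.flow.Pair) : itvElt (F.flow.bdry p) = Elt.comp (pairElt p) := by
  obtain ⟨⟨⟨⟨⟨v', w⟩, hB⟩, B⟩, ⟨⟨⟨u, v⟩, hA⟩, A⟩⟩, h⟩ := p
  obtain rfl : v = v' := congrArg Sigma.fst h
  rfl

/-- The pair of edges below a pair of points. -/
def pairEdge (p : F.flow.Pair) : (cubeFlow n).Pair :=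
  ⟨(F.flowEdge p.1.1, F.flowEdge p.1.2), congrArg Sigma.fst p.2⟩

theorem flowSquare_bdry (p : F.flow.Pair) :
    F.flowSquare (F.flow.bdry p) = (cubeFlow n).bdry (pairEdge p) := by
  obtain ⟨⟨⟨⟨⟨v', w⟩, hB⟩, B⟩, ⟨⟨⟨u, v⟩, hA⟩, A⟩⟩, h⟩ := p
  rfl

theorem bdry_pairEdge {p q : F.flow.Pair} (h : F.flow.bdry p = F.flow.bdry q) :
    (cubeFlow n).bdry (pairEdge p) = (cubeFlow n).bdry (pairEdge q) := by
  rw [← flowSquare_bdry, h, flowSquare_bdry]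

theorem pairEdge_ne {p q : F.flow.Pair} (hpq : p ≠ q) (h : F.flow.bdry p = F.flow.bdry q) :
    pairEdge p ≠ pairEdge q := by
  intro he
  have h1 : Elt.comp (pairElt p) = Elt.comp (pairElt q) := by
    rw [← itvElt_bdry, h, itvElt_bdry]
  have h2 := Elt.comp_inj h1
    (congrArg (fun r : (cubeFlow n).Pair => (cubeFlow n).tgt r.1.2) he)
  refine hpq (Subtype.ext (Prod.ext ?_ ?_))
  · exact ptElt_injective (congrArg (fun r => r.1.1) h2)
  · exact ptElt_injective (congrArg (fun r => r.1.2) h2)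

instance : IsEmpty F.flow.Circ := inferInstanceAs (IsEmpty Empty)

variable (F) in
/-- The pull back of a function of the edges. -/
def pullPt (s : (cubeFlow n).Pt → ZMod 2) (P : F.flow.Pt) : ZMod 2 := s (F.flowEdge P)

variable (F) in
/-- The pull back of a pre-framing. -/
def pullFrame (f : (cubeFlow n).PreFraming) : F.flow.PreFraming where
  itv X := f.itv (F.flowSquare X)
  circ := Empty.elim

theorem isSignAssignment_pull {s : (cubeFlow n).Pt → ZMod 2}
    (hs : (cubeFlow n).IsSignAssignment s) : F.flow.IsSignAssignment (F.pullPt s) :=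
  fun p q hpq h => hs (pairEdge p) (pairEdge q) (pairEdge_ne hpq h) (bdry_pairEdge h)

section Triples

variable {a d : F.flow.Ob}

/-- The source of an element of `∐_u F_u`. -/
def vertex (a : F.flow.Ob) : (cubeFlow n).Ob := Sigma.fst (show Σ u, F.obj u from a)

/-- The triple of edges below a triple of points. -/
def tripleEdge (t : F.flow.TripleOver (fun c => c = d) a) :
    (cubeFlow n).TripleOver (fun c => c = vertex d) (vertex a) :=
  ⟨(F.flowEdge t.1.1, F.flowEdge t.1.2.1, F.flowEdge t.1.2.2), congrArg Sigma.fst t.2.1,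
    congrArg Sigma.fst t.2.2.1, congrArg Sigma.fst t.2.2.2.1, congrArg Sigma.fst t.2.2.2.2⟩

/-- The composite of a triple, associated to the left. -/
def tripleElt (t : F.flow.TripleOver (fun c => c = d) a) : F.Elt :=
  Elt.comp ⟨(Elt.comp (pairElt t.lowerPair), ptElt t.1.2.2),
    Eq.trans t.2.2.1 (Elt.src_comp (pairElt t.lowerPair)).symm⟩

theorem tripleElt_eq (t : F.flow.TripleOver (fun c => c = d) a) : tripleElt t =
    Elt.comp ⟨(ptElt t.1.1, Elt.comp (pairElt t.upperPair)),
      (Elt.tgt_comp (pairElt t.upperPair)).trans t.2.2.2.1⟩ :=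
  Elt.comp_assoc (ptElt t.1.1) (ptElt t.1.2.1) (ptElt t.1.2.2) t.2.2.1 t.2.2.2.1

theorem src_tripleElt (t : F.flow.TripleOver (fun c => c = d) a) : (tripleElt t).src = a :=
  (Elt.src_comp _).trans t.2.1

theorem tgt_tripleElt (t : F.flow.TripleOver (fun c => c = d) a) : (tripleElt t).tgt = d :=
  (Elt.tgt_comp _).trans ((Elt.tgt_comp _).trans t.2.2.2.2)

/-- Unique factorization through a given vertex: the composite of the triple, together with the
position of the edge in the cube, determines the interval and the upper point. -/
theorem lowerEdge_iff (t t' : F.flow.TripleOver (fun c => c = d) a) :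
    t.lowerEdge = t'.lowerEdge ↔ tripleElt t = tripleElt t' ∧
      (tripleEdge t).lowerEdge = (tripleEdge t').lowerEdge := by
  constructor
  · intro h
    have h1 : F.flow.bdry t.lowerPair = F.flow.bdry t'.lowerPair :=
      congrArg (fun e : F.flow.Itv × F.flow.Pt => e.1) h
    have h2 : t.1.2.2 = t'.1.2.2 := congrArg (fun e : F.flow.Itv × F.flow.Pt => e.2) h
    have h3 : Elt.comp (pairElt t.lowerPair) = Elt.comp (pairElt t'.lowerPair) := by
      rw [← itvElt_bdry, h1, itvElt_bdry]
    refine ⟨congrArg Elt.comp (Subtype.ext (Prod.ext h3 (congrArg ptElt h2))), ?_⟩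
    exact Prod.ext (bdry_pairEdge (p := t.lowerPair) (q := t'.lowerPair) h1)
      (congrArg F.flowEdge h2)
  · rintro ⟨h1, h2⟩
    have h3 := Elt.comp_inj h1 (congrArg (fun e : (cubeFlow n).Itv × (cubeFlow n).Pt =>
      (cubeFlow n).tgt e.2) h2)
    refine Prod.ext (itvElt_injective ?_) (ptElt_injective (congrArg (fun r => r.1.2) h3))
    refine (itvElt_bdry t.lowerPair).trans (Eq.trans ?_ (itvElt_bdry t'.lowerPair).symm)
    exact congrArg (fun r => r.1.1) h3

theorem upperEdge_iff (t t' : F.flow.TripleOver (fun c => c = d) a) :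
    t.upperEdge = t'.upperEdge ↔ tripleElt t = tripleElt t' ∧
      (tripleEdge t).upperEdge = (tripleEdge t').upperEdge := by
  rw [tripleElt_eq, tripleElt_eq]
  constructor
  · intro h
    have h1 : F.flow.bdry t.upperPair = F.flow.bdry t'.upperPair :=
      congrArg (fun e : F.flow.Pt × F.flow.Itv => e.2) h
    have h2 : t.1.1 = t'.1.1 := congrArg (fun e : F.flow.Pt × F.flow.Itv => e.1) h
    have h3 : Elt.comp (pairElt t.upperPair) = Elt.comp (pairElt t'.upperPair) := by
      rw [← itvElt_bdry, h1, itvElt_bdry]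
    refine ⟨congrArg Elt.comp (Subtype.ext (Prod.ext (congrArg ptElt h2) h3)), ?_⟩
    exact Prod.ext (congrArg F.flowEdge h2)
      (bdry_pairEdge (p := t.upperPair) (q := t'.upperPair) h1)
  · rintro ⟨h1, h2⟩
    have hv : ∀ t : F.flow.TripleOver (fun c => c = d) a,
        (Elt.comp (pairElt t.upperPair)).tgt.1 = (ptElt t.1.1).1.1.1 := fun t =>
      congrArg Sigma.fst ((Elt.tgt_comp (pairElt t.upperPair)).trans t.2.2.2.1)
    have hm : (ptElt t.1.1).1.1.1 = (ptElt t'.1.1).1.1.1 :=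
      congrArg (fun e : (cubeFlow n).Pt × (cubeFlow n).Itv => (cubeFlow n).src e.1) h2
    have h3 := Elt.comp_inj h1 ((hv t).trans (hm.trans (hv t').symm))
    refine Prod.ext (ptElt_injective (congrArg (fun r => r.1.1) h3)) (itvElt_injective ?_)
    refine (itvElt_bdry t.upperPair).trans (Eq.trans ?_ (itvElt_bdry t'.upperPair).symm)
    exact congrArg (fun r => r.1.2) h3

/-- The elements of the correspondences from `a` to `d`. -/
abbrev EltOver (a d : F.flow.Ob) : Type := {X : F.Elt // X.src = a ∧ X.tgt = d}

/-- The triples of `C_F` form copies of the triples of the cube. -/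
theorem bijective_triple : Function.Bijective fun t : F.flow.TripleOver (fun c => c = d) a =>
    ((⟨tripleElt t, src_tripleElt t, tgt_tripleElt t⟩ : EltOver a d), tripleEdge t) := by
  constructor
  · intro t t' h
    have h1 : tripleElt t = tripleElt t' := congrArg (fun x => x.1.1) h
    have h2 : tripleEdge t = tripleEdge t' := congrArg (fun x => x.2) h
    have e1 := (lowerEdge_iff t t').2 ⟨h1, by rw [h2]⟩
    have e2 := (upperEdge_iff t t').2 ⟨h1, by rw [h2]⟩
    have e3 : F.flow.bdry t.lowerPair = F.flow.bdry t'.lowerPair :=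
      congrArg (fun e : F.flow.Itv × F.flow.Pt => e.1) e1
    have e4 : pairEdge t.lowerPair = pairEdge t'.lowerPair :=
      congrArg (fun t => TripleOver.lowerPair t) h2
    have e5 : t.lowerPair = t'.lowerPair := by
      by_contra hne
      exact pairEdge_ne hne e3 e4
    refine Subtype.ext (Prod.ext (congrArg (fun p => p.1.1) e5) (Prod.ext
      (congrArg (fun p => p.1.2) e5) (congrArg (fun e : F.flow.Itv × F.flow.Pt => e.2) e1)))
  · rintro ⟨⟨X, hX⟩, ⟨⟨⟨⟨w, x⟩, hP⟩, ⟨⟨v, w'⟩, hB⟩, ⟨⟨u, v'⟩, hA⟩⟩, h1, h2, h3, h4⟩⟩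
    obtain rfl : v' = v := h2
    obtain rfl : w' = w := h3
    obtain ⟨hX1, hX2⟩ := hX
    have hu : X.1.1.1 = u := (congrArg Sigma.fst hX1).trans h1.symm
    have hx : X.1.1.2 = x := (congrArg Sigma.fst hX2).trans h4.symm
    -- A preimage is found by factoring X twice along the given path in the cube.
    obtain ⟨⟨⟨R, A⟩, hRA⟩, hc, hA', hR'⟩ := X.exists_comp (v := v') (by rw [hu]; exact hA.1)
      (by rw [hx]; exact hP.1.trans hB.1)
    dsimp only at hA' hR'
    obtain ⟨⟨⟨P, B⟩, hPB⟩, hc', hB', hP'⟩ := R.exists_comp (v := w') (by rw [hR']; exact hB.1)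
      (by rw [hR', hx]; exact hP.1)
    dsimp only at hB' hP'
    rw [hu] at hA'
    rw [hR', hx] at hP'
    rw [hR'] at hB'
    obtain ⟨P, rfl⟩ := exists_ptElt P (by rw [hP']; exact hP.2)
    obtain ⟨B, rfl⟩ := exists_ptElt B (by rw [hB']; exact hB.2)
    obtain ⟨A, rfl⟩ := exists_ptElt A (by rw [hA']; exact hA.2)
    subst hc' hc
    have k1 : (ptElt A).tgt = (ptElt B).src := hRA.trans (Elt.src_comp _)
    refine ⟨⟨(P, B, A), (Elt.src_comp _).symm.trans hX1, k1, hPB,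
      (Elt.tgt_comp ⟨(ptElt P, ptElt B), hPB⟩).symm.trans ((Elt.tgt_comp _).symm.trans hX2)⟩, ?_⟩
    refine Prod.ext (Subtype.ext rfl) (Subtype.ext (Prod.ext (Subtype.ext hP')
      (Prod.ext (Subtype.ext hB') (Subtype.ext hA'))))

/-- By `bijective_triple` the corners over a and d are copies, one for each element of the
correspondence, of the corners in the cube, with the same adjacency. The framing sum is therefore a
multiple of that of the cube. -/
theorem isFramed_pull {s : (cubeFlow n).Pt → ZMod 2} {f : (cubeFlow n).PreFraming}
    (h : (cubeFlow n).IsFramed s f) : F.flow.IsFramed (F.pullPt s) (F.pullFrame f) := by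
  have hs := isSignAssignment_pull (F := F) h.1
  refine ⟨hs, (OneFlowCat.isFraming_iff hs _).2 fun a d => ?_⟩
  have h0 := (OneFlowCat.isFraming_iff h.1 f).1 h.2 (vertex a) (vertex d)
  let e := Equiv.ofBijective _ (bijective_triple (a := a) (d := d))
  have hc : Nat.card (F.flow.BdryComp a d) =
      Nat.card (EltOver a d) * Nat.card ((cubeFlow n).BdryComp (vertex a) (vertex d)) := by
    refine card_quot_prod e _ _ fun t t' => ?_
    have h1 := lowerEdge_iff t t'
    have h2 := upperEdge_iff t t'
    have h3 : (e t).1 = (e t').1 ↔ tripleElt t = tripleElt t' := Subtype.ext_iff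
    change t.lowerEdge = t'.lowerEdge ∨ t.upperEdge = t'.upperEdge ↔ (e t).1 = (e t').1 ∧
      ((tripleEdge t).lowerEdge = (tripleEdge t').lowerEdge ∨
        (tripleEdge t).upperEdge = (tripleEdge t').upperEdge)
    rw [h1, h2, h3]
    tauto
  have hf : Finite (EltOver a d) := Finite.of_injective (β := Σ q : {q : CubeVertex n × CubeVertex n
    // q.2 ≤ q.1}, (F.hom q.2).carrier) Subtype.val Subtype.val_injective
  have hft := Fintype.ofFinite (EltOver a d)
  have hS : ∑ t : F.flow.TripleOver (fun c => c = d) a, t.sign (F.pullPt s) *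
      ((F.pullFrame f).itv (F.flow.bdry t.lowerPair) +
        (1 + F.pullPt s t.1.1 + (F.pullFrame f).itv (F.flow.bdry t.upperPair))) =
      (Nat.card (EltOver a d) : ZMod 2) *
      ∑ t : (cubeFlow n).TripleOver (fun c => c = vertex d) (vertex a), t.sign s *
        (f.itv ((cubeFlow n).bdry t.lowerPair) +
          (1 + s t.1.1 + f.itv ((cubeFlow n).bdry t.upperPair))) := by
    have h1 : ∑ x : EltOver a d × (cubeFlow n).TripleOver (fun c => c = vertex d) (vertex a),
        x.2.sign s * (f.itv ((cubeFlow n).bdry x.2.lowerPair) +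
          (1 + s x.2.1.1 + f.itv ((cubeFlow n).bdry x.2.upperPair))) = _ :=
      Fintype.sum_prod_type _
    simp only [Finset.sum_const, Finset.card_univ, nsmul_eq_mul, ← Nat.card_eq_fintype_card] at h1
    rw [← h1, ← Equiv.sum_comp e]
    refine Finset.sum_congr rfl fun t _ => ?_
    have h2 : (F.pullFrame f).itv (F.flow.bdry t.lowerPair) =
        f.itv ((cubeFlow n).bdry (tripleEdge t).lowerPair) :=
      congrArg f.itv (flowSquare_bdry t.lowerPair)
    have h3 : (F.pullFrame f).itv (F.flow.bdry t.upperPair) =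
        f.itv ((cubeFlow n).bdry (tripleEdge t).upperPair) :=
      congrArg f.itv (flowSquare_bdry t.upperPair)
    rw [h2, h3]
    rfl
  rw [hS, ← Nat.card_eq_fintype_card, hc, Nat.card_eq_fintype_card (α := (cubeFlow n).BdryComp _ _),
    Nat.cast_mul, ← mul_add, h0, mul_zero]

end Triples

end SignedCubeFunctor

end

noncomputable section

/-! ### The framings of `C_F` and the independence of the choices -/

/-- The table is the polynomial required by `IsFramed.twist`: the total change on one path plus a
term for each corner, with x = 1 + δ + ε and y = 1 + ε. Thus δ enters linearly in σ only, while ε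
also multiplies a quadratic term. -/
theorem frameChange_add (δ ε a b c d a' b' c' d' : ZMod 2) (h : a + b + c + d = 1)
    (h' : a' + d' = b' + c') :
    frameChange δ ε a b c d (a + a') (b + b') (c + c') (d + d') = a' + d' +
      ((d' * a + (1 + δ + ε) * a' + (1 + ε) * (d' * a')) +
        (c' * b + (1 + δ + ε) * b' + (1 + ε) * (c' * b'))) := by
  have h2 : ∀ x : ZMod 2, x = 0 ∨ x = 1 := by decide
  have key : ∀ x y : ZMod 2, x = x + y ↔ y = 0 := fun x y => left_eq_add
  simp only [frameChange, key, ne_eq]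
  rcases h2 a' with rfl | rfl <;> rcases h2 b' with rfl | rfl <;> rcases h2 c' with rfl | rfl <;>
    rcases h2 d' with rfl | rfl <;> simp at h' ⊢ <;> grind

namespace SignedCubeFunctor

open scoped Classical

open OneFlowCat

variable {n : ℕ} {F : SignedCubeFunctor n}

variable (F) in
/-- The sign of a point of `C_F` as an element of a correspondence. -/
def ptSign (P : F.flow.Pt) : ZMod 2 := F.corrSign P

/-- The maps F_{u,v,w} preserve signs, so the sign of a corner is that of its interval. This is why
the signs of F form a closed function. -/
theorem pairSign_ptSign (p : F.flow.Pair) :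
    pairSign F.ptSign p = (F.hom (F.flowSquare (F.flow.bdry p)).2.1).sign
      (show F.FlowItv from F.flow.bdry p).2 := by
  obtain ⟨⟨⟨⟨⟨v', w⟩, hB⟩, B⟩, ⟨⟨⟨u, v⟩, hA⟩, A⟩⟩, h⟩ := p
  obtain rfl : v = v' := congrArg Sigma.fst h
  have h' := eq_of_heq (Sigma.mk.inj h).2
  exact ((F.map hA.1 hB.1).sign_eq ⟨(B, A), h'⟩).symm

theorem isClosed_ptSign : IsClosed F.ptSign := fun p q h => by
  rw [pairSign_ptSign, pairSign_ptSign, h]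

theorem flowFrame_bdry (δ ε : ZMod 2) {s : (cubeFlow n).Pt → ZMod 2}
    (hs : (cubeFlow n).IsSignAssignment s) (f : (cubeFlow n).PreFraming) {p q : F.flow.Pair}
    (hpq : p ≠ q) (h : F.flow.bdry p = F.flow.bdry q) :
    (F.flowFrame δ ε s f).itv (F.flow.bdry p) = (F.pullFrame f).itv (F.flow.bdry p) +
      pairSign F.ptSign p +
      (cornerChange (1 + δ + ε) (1 + ε) (F.pullPt s) F.ptSign p +
        cornerChange (1 + δ + ε) (1 + ε) (F.pullPt s) F.ptSign q) := by
  have h1 := isSignAssignment_pull (F := F) hs p q hpq h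
  have h2 := isClosed_ptSign p q h
  rw [F.flowFrame_eq δ ε s f _ p q hpq rfl h.symm, add_assoc]
  refine congrArg (f.itv (F.flowSquare (F.flow.bdry p)) + ·) ?_
  simp only [pullPt, pairSign, ptSign] at h1 h2
  exact frameChange_add δ ε _ _ _ _ _ _ _ _ (by grind) (by grind)

theorem isFramed_flow {s : (cubeFlow n).Pt → ZMod 2} {f : (cubeFlow n).PreFraming}
    (h : (cubeFlow n).IsFramed s f) (δ ε : ZMod 2) :
    F.flow.IsFramed (F.flowSign s) (F.flowFrame δ ε s f) :=
  (isFramed_pull h).twist isClosed_ptSign (1 + δ + ε) (1 + ε) fun _ _ hpq hb =>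
    flowFrame_bdry δ ε h.1 f hpq hb

variable (F) in
/-- The operation `Sq²_ε`, defined by the standard framing of the cube. -/
def sqTwo (ε : ZMod 2) (i : ℤ) : F.H i →ₗ[ZMod 2] F.H (i + 2) :=
  steenrodSq (isFramed_flow (F := F) (CubeFlow.isFramed_std) 0 ε) i

/-- A gauge change on the cube pulls back to one on C_F. The corner terms for s and s' differ by
exactly the expression allowed in `sqRep_gauge`, in which δ + δ' plays the role of x. -/
theorem sqRep_flow_eq {s s' : (cubeFlow n).Pt → ZMod 2} {f f' : (cubeFlow n).PreFraming}
    (h : (cubeFlow n).IsFramed s f) (h' : (cubeFlow n).IsFramed s' f') (δ δ' ε : ZMod 2)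
    {φ : F.flow.Ob → ZMod 2} (hφ : F.flow.coboundary φ = 0) :
    ∃ ψ : F.flow.Ob → ZMod 2, sqRep (F.flowSign s') (F.flowFrame δ' ε s' f') φ =
      sqRep (F.flowSign s) (F.flowFrame δ ε s f) φ + F.flow.coboundary ψ := by
  obtain ⟨t, g, rfl, hf⟩ := CubeFlow.exists_gauge h h'
  have e : F.flowSign (s + (cubeFlow n).ptCob t) =
      F.flowSign s + F.flow.ptCob (fun a => t (vertex a)) := by
    funext P
    exact add_right_comm (F.pullPt s P) _ _
  rw [e]
  refine sqRep_gauge (isFramed_flow h δ ε).1 isClosed_ptSign hφ (fun a => t (vertex a))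
    (F.pullPt g) (δ + δ') (fun p => F.flow.ptCob (fun a => t (vertex a)) p.1.2 *
      (F.flowSign s p.1.1 + F.ptSign p.1.1) + F.ptSign p.1.2 *
      F.flow.ptCob (fun a => t (vertex a)) p.1.1 + (δ + δ') * F.ptSign p.1.1 +
      pairSign (F.pullPt g) p) ?_ fun _ => rfl
  intro p q hpq hb
  rw [flowFrame_bdry δ' ε h'.1 f' hpq hb, flowFrame_bdry δ ε h.1 f hpq hb]
  have e1 := hf _ _ (pairEdge_ne hpq hb) (bdry_pairEdge hb)
  rw [← flowSquare_bdry] at e1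
  have e2 : ∀ P, F.pullPt ((cubeFlow n).ptCob t) P = F.flow.ptCob (fun a => t (vertex a)) P :=
    fun _ => rfl
  have e3 : (F.pullFrame f').itv (F.flow.bdry p) = (F.pullFrame f).itv (F.flow.bdry p) +
      pairSign (F.pullPt ((cubeFlow n).ptCob t)) p +
      (F.pullPt ((cubeFlow n).ptCob t) p.1.2 * F.pullPt s p.1.1 + pairSign (F.pullPt g) p +
        (F.pullPt ((cubeFlow n).ptCob t) q.1.2 * F.pullPt s q.1.1 + pairSign (F.pullPt g) q)) := e1
  have e4 : ∀ P, F.pullPt (s + (cubeFlow n).ptCob t) P =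
      F.pullPt s P + F.flow.ptCob (fun a => t (vertex a)) P := fun _ => rfl
  have e5 : ∀ P, F.flowSign s P = F.pullPt s P + F.ptSign P := fun _ => rfl
  rw [e3]
  simp only [pairSign, cornerChange, e2, e4, e5]
  generalize (F.pullFrame f).itv (F.flow.bdry p) = z
  generalize F.flow.ptCob (fun a => t (vertex a)) = τ
  generalize F.pullPt s = s₀
  generalize F.pullPt g = g₀
  grind

theorem isSqTwo_sqTwo (ε : ZMod 2) (i : ℤ) : F.IsSqTwo ε (F.sqTwo ε i) := by
  intro s f h δ φ hφ m o
  obtain ⟨h1, h2⟩ := isSecondSteenrodSquare_steenrodSq (isFramed_flow (F := F) h δ ε) φ hφ m o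
  refine ⟨h1, Eq.trans ?_ h2⟩
  obtain ⟨ψ, hψ⟩ := sqRep_flow_eq (F := F) (CubeFlow.isFramed_std) h 0 δ ε hφ.2
  rw [sqTwo, steenrodSq_mk]
  exact (mk_eq_mk (sqRep_mem_cocycles (isFramed_flow h δ ε) hφ) _ hψ).symm

theorem IsSqTwo.eq {ε : ZMod 2} {i : ℤ} {T : F.H i →ₗ[ZMod 2] F.H (i + 2)} (hT : F.IsSqTwo ε T) :
    T = F.sqTwo ε i :=
  IsSecondSteenrodSquare.eq _ (hT _ _ (CubeFlow.isFramed_std) 0)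

end SignedCubeFunctor

end

/-! ### Dependence on the signs of F, and the examples -/

noncomputable section

namespace SignedCubeFunctor

open scoped Classical

open OneFlowCat

variable {n : ℕ} {F : SignedCubeFunctor n}

/-- The dependence of the second Steenrod square on the signs of the correspondences. -/
theorem sqRep_flow {s : (cubeFlow n).Pt → ZMod 2} {f : (cubeFlow n).PreFraming}
    (h : (cubeFlow n).IsFramed s f) (δ ε : ZMod 2) {φ : F.flow.Ob → ZMod 2}
    (hφ : F.flow.coboundary φ = 0) (a : F.flow.Ob) :
    sqRep (F.flowSign s) (F.flowFrame δ ε s f) φ a =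
      sqRep (F.pullPt s) (F.pullFrame f) φ a +
      (wcob F.ptSign (wcob (F.pullPt s) φ) a +
        (1 + δ + ε) * F.flow.coboundary (wcob F.ptSign φ) a +
        (1 + ε) * wcob F.ptSign (wcob F.ptSign φ) a) +
      wcob F.ptSign (half φ) a := by
  refine (sqRep_change (isFramed_pull h).1 isClosed_ptSign hφ _
    (fun p q hpq hb => flowFrame_bdry δ ε h.1 f hpq hb) a).trans ?_
  congr 2
  rw [← wcob_one, ← sum_pairOver_mul, ← sum_pairOver_mul, ← sum_pairOver_mul, Finset.mul_sum,
    Finset.mul_sum, ← Finset.sum_add_distrib, ← Finset.sum_add_distrib]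
  refine Finset.sum_congr rfl fun p _ => ?_
  rw [cornerChange]
  ring

end SignedCubeFunctor

/-! ### Functors on the square -/

/-- The vectors over `ℤ/2` supported in the directions in which `u` and `v` differ. -/
abbrev Carr (u v : CubeVertex 2) : Type := {z : Fin 2 → ZMod 2 // ∀ i, u i = v i → z i = 0}

instance (u : CubeVertex 2) : Unique (Carr u u) where
  default := ⟨0, fun _ _ => rfl⟩
  uniq z := Subtype.ext (funext fun i => z.2 i rfl)

/-- A bit as an element of `ℤ/2`. -/
def bit (b : Bool) : ZMod 2 := if b then 1 else 0

/-- The composition of `y`, which goes from `v` to `w`, and `x`, which goes from `u` to `v`. -/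
def carrComp (t : ZMod 2) {u v w : CubeVertex 2} (h₁ : v ≤ u) (h₂ : w ≤ v) (y : Carr v w)
    (x : Carr u v) : Carr u w :=
  ⟨![x.1 0 + y.1 0 + t * (bit (u 0) + bit (v 0)) * y.1 1, x.1 1 + y.1 1], fun i hi => by
    have h3 : u i = v i := le_antisymm (hi ▸ h₂ i) (h₁ i)
    have h4 : v i = w i := h3 ▸ hi
    have h5 := x.2 i h3
    have h6 := y.2 i h4
    have h7 : ∀ b : ZMod 2, b + b = 0 := CharTwo.add_self_eq_zero
    fin_cases i
    · simp_all
    · simp_all⟩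

/-- In each coordinate at most one of the two factors can be non-zero. The second coordinate of the
composite determines those of the factors, hence the twisting term, and then the first coordinate
can be solved for. -/
theorem carrComp_bijective (t : ZMod 2) {u v w : CubeVertex 2} (h₁ : v ≤ u) (h₂ : w ≤ v) :
    Function.Bijective fun p : Carr v w × Carr u v => carrComp t h₁ h₂ p.1 p.2 := by
  have key : ∀ i, u i = v i ∨ v i = w i := by
    intro i
    have a1 := h₁ i
    have a2 := h₂ i
    revert a1 a2
    cases u i <;> cases v i <;> cases w i <;> simp
  constructor
  · rintro ⟨y, x⟩ ⟨y', x'⟩ h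
    have h0 := congrArg (fun z : Carr u w => z.1 0) h
    have h1 := congrArg (fun z : Carr u w => z.1 1) h
    simp only [carrComp, Matrix.cons_val_zero, Matrix.cons_val_one] at h0 h1
    have c1 : y.1 1 = y'.1 1 ∧ x.1 1 = x'.1 1 := by
      rcases key 1 with k | k
      · have := x.2 1 k
        have := x'.2 1 k
        simp_all
      · have := y.2 1 k
        have := y'.2 1 k
        simp_all
    rw [c1.1, add_left_inj] at h0
    have c0 : y.1 0 = y'.1 0 ∧ x.1 0 = x'.1 0 := by
      rcases key 0 with k | k
      · have := x.2 0 k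
        have := x'.2 0 k
        simp_all
      · have := y.2 0 k
        have := y'.2 0 k
        simp_all
    refine Prod.ext (Subtype.ext (funext fun i => ?_)) (Subtype.ext (funext fun i => ?_))
    · fin_cases i
      exacts [c0.1, c1.1]
    · fin_cases i
      exacts [c0.2, c1.2]
  · intro z
    have hz : ∀ i, u i = v i → v i = w i → z.1 i = 0 := fun i a b => z.2 i (a.trans b)
    refine ⟨(⟨fun i => if v i = w i then 0 else z.1 i, fun i hi => if_pos hi⟩,
      ⟨fun i => if u i = v i then 0 else z.1 i + if i = 0 then t * (bit (u 0) + bit (v 0)) *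
        (if v 1 = w 1 then 0 else z.1 1) else 0, fun i hi => if_pos hi⟩), ?_⟩
    refine Subtype.ext (funext fun i => ?_)
    have h7 : ∀ b : ZMod 2, b + b = 0 := CharTwo.add_self_eq_zero
    have k := key i
    have hz' := hz i
    fin_cases i
    · by_cases a : u 0 = v 0 <;> by_cases b : v 0 = w 0 <;> simp_all [carrComp]
      simp [add_assoc, h7]
    · by_cases a : u 1 = v 1 <;> by_cases b : v 1 = w 1 <;> simp_all [carrComp]

/-- The sign of an element of `F_{u,v}`. -/
def carrSign (t l m : ZMod 2) (u v : CubeVertex 2) (z : Carr u v) : ZMod 2 :=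
  l * z.1 0 + m * z.1 1 + l * t * bit (u 0) * z.1 1

/-- The term l · t · u₀ · z₁ of the sign is there to absorb the twist in the composition: its
dependence on the starting vertex compensates t(u₀ + v₀)y₁. -/
theorem carrSign_comp (t l m : ZMod 2) {u v w : CubeVertex 2} (h₁ : v ≤ u) (h₂ : w ≤ v)
    (y : Carr v w) (x : Carr u v) :
    carrSign t l m u w (carrComp t h₁ h₂ y x) = carrSign t l m v w y + carrSign t l m u v x := by
  simp only [carrSign, carrComp, Matrix.cons_val_zero, Matrix.cons_val_one]
  grind

theorem carrComp_assoc (t : ZMod 2) {u v w x : CubeVertex 2} (h₁ : v ≤ u) (h₂ : w ≤ v) (h₃ : x ≤ w)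
    (c : Carr w x) (b : Carr v w) (a : Carr u v) :
    carrComp t h₁ (h₃.trans h₂) (carrComp t h₂ h₃ c b) a =
      carrComp t (h₂.trans h₁) h₃ c (carrComp t h₁ h₂ b a) := by
  refine Subtype.ext (funext fun i => ?_)
  simp only [carrComp, Matrix.cons_val_zero, Matrix.cons_val_one]
  congr 1
  · grind
  · rw [add_assoc]

theorem carrComp_refl_left (t : ZMod 2) {u v : CubeVertex 2} (h : v ≤ u) (y : Carr v v)
    (x : Carr u v) : carrComp t h le_rfl y x = x := by
  refine Subtype.ext (funext fun i => ?_)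
  have := fun i => y.2 i rfl
  fin_cases i <;> simp [carrComp, this]

theorem carrComp_refl_right (t : ZMod 2) {u v : CubeVertex 2} (h : v ≤ u) (y : Carr u v)
    (x : Carr u u) : carrComp t le_rfl h y x = y := by
  refine Subtype.ext (funext fun i => ?_)
  have := fun i => x.2 i rfl
  fin_cases i <;> simp [carrComp, this, CharTwo.add_self_eq_zero]

/-- A family of functors on the square, with one object over each vertex and two arrows over each
edge. -/
def squareFunctor (t l m : ZMod 2) : SignedCubeFunctor 2 where
  obj u := Carr u u
  hom {u v} _ :=
    { carrier := Carr u v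
      src := fun _ => default
      tgt := fun _ => default
      sign := carrSign t l m u v }
  hom_refl u := by
    have h1 : (fun _ => default : Carr u u → Carr u u) = id := Subsingleton.elim _ _
    have h2 : carrSign t l m u u = fun _ => 0 := by
      funext z
      rw [Subsingleton.elim z default]
      simp [carrSign, default]
    simp only [h1, h2]
    rfl
  map h₁ h₂ :=
    { toEquiv := (Equiv.subtypeUnivEquiv fun _ => rfl).trans
        (Equiv.ofBijective _ (carrComp_bijective t h₁ h₂))
      src_eq := fun _ => rfl
      tgt_eq := fun _ => rfl
      sign_eq := fun p => carrSign_comp t l m h₁ h₂ p.1.1 p.1.2 }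
  map_left_unitor h p := carrComp_refl_left t h p.1.1 p.1.2
  map_right_unitor h p := carrComp_refl_right t h p.1.1 p.1.2
  map_assoc h₁ h₂ h₃ p := carrComp_assoc t h₁ h₂ h₃ p.1.1.1.1 p.1.1.1.2 p.1.2

open OneFlowCat

instance (u v : CubeVertex 2) : Decidable (v ≤ u) := inferInstanceAs (Decidable (∀ i, v i ≤ u i))

theorem card_carr (e : SubCube 2 1) : Fintype.card (Carr e.1.1 e.1.2) = 2 := by
  revert e
  decide

namespace squareFunctor

variable {t l m : ZMod 2}

/-- Over each vertex there is one object, so sums over the points of the flow category become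
explicit finite sums, which can be evaluated by computation. -/
theorem sum_out {M : Type*} [AddCommMonoid M] {a : (squareFunctor t l m).flow.Ob}
    [Fintype ((squareFunctor t l m).flow.Out a)] {u : CubeVertex 2}
    (ha : SignedCubeFunctor.vertex a = u) (G : SubCube 2 1 → (Fin 2 → ZMod 2) → M) :
    ∑ A : (squareFunctor t l m).flow.Out a, G ((squareFunctor t l m).flowEdge A.1)
      (show Carr _ _ from Sigma.snd (show (squareFunctor t l m).FlowPt from A.1)).1 =
    ∑ e : SubCube 2 1, ∑ z : Carr e.1.1 e.1.2, if e.1.1 = u then G e z.1 else 0 := by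
  let P : (Σ e : SubCube 2 1, Carr e.1.1 e.1.2) → Prop := fun x => x.1.1.1 = u
  let e : (squareFunctor t l m).flow.Out a ≃ {x // P x} :=
    { toFun := fun A => ⟨A.1, (congrArg Sigma.fst A.2).trans ha⟩
      invFun := fun x => ⟨x.1, by
        obtain ⟨x, hx⟩ := x
        obtain ⟨u', z⟩ := a
        obtain rfl : u' = u := ha
        exact Sigma.ext hx (by
          obtain rfl : x.1.1.1 = u' := hx
          exact heq_of_eq (Subsingleton.elim (α := Carr _ _) _ _))⟩
      left_inv := fun _ => rfl
      right_inv := fun _ => rfl }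
  rw [← Fintype.sum_sigma' (f := fun (e : SubCube 2 1) (z : Carr e.1.1 e.1.2) =>
    if e.1.1 = u then G e z.1 else 0), ← Finset.sum_filter,
    Finset.sum_subtype (p := P) _ (by simp [P])]
  exact Equiv.sum_comp e fun x => G x.1.1 x.1.2.1

theorem exists_eq_comp_vertex (ψ : (squareFunctor t l m).flow.Ob → ZMod 2) :
    ∃ g : CubeVertex 2 → ZMod 2, ψ = fun a => g (SignedCubeFunctor.vertex a) := by
  refine ⟨fun u => ψ ⟨u, (default : Carr u u)⟩, funext ?_⟩
  rintro ⟨u, z⟩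
  exact congrArg (fun z : Carr u u => ψ ⟨u, z⟩) (Subsingleton.elim _ _)

open scoped Classical in
theorem wcob_pullPt (w : (cubeFlow 2).Pt → ZMod 2)
    (ψ : (squareFunctor t l m).flow.Ob → ZMod 2) :
    wcob ((squareFunctor t l m).pullPt w) ψ = 0 := by
  obtain ⟨g, rfl⟩ := exists_eq_comp_vertex ψ
  funext a
  refine (sum_out rfl fun e _ => w e * g e.1.2).trans (Finset.sum_eq_zero fun e _ => ?_)
  rw [Finset.sum_const, Finset.card_univ, card_carr, two_nsmul]
  exact CharTwo.add_self_eq_zero _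

/-- The two arrows over each edge cancel mod 2, so cochains may be compared directly instead of
cohomology classes. -/
theorem coboundary_eq_zero (ψ : (squareFunctor t l m).flow.Ob → ZMod 2) :
    (squareFunctor t l m).flow.coboundary ψ = 0 := by
  rw [← wcob_one]
  exact wcob_pullPt (fun _ => 1) ψ

open scoped Classical in
theorem wcob_ptSign {g g' : CubeVertex 2 → ZMod 2}
    (h : ∀ u, ∑ e : SubCube 2 1, ∑ z : Carr e.1.1 e.1.2,
      (if e.1.1 = u then carrSign t l m e.1.1 e.1.2 z * g e.1.2 else 0) = g' u) :
    wcob (squareFunctor t l m).ptSign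
      (fun a => g (SignedCubeFunctor.vertex a)) = fun a => g' (SignedCubeFunctor.vertex a) := by
  funext a
  refine (sum_out (a := a) rfl fun e z =>
    (l * z 0 + m * z 1 + l * t * bit (e.1.1 0) * z 1) * g e.1.2).trans ?_
  exact h _

/-- The indicator function of the bottom vertex. -/
def bottom (u : CubeVertex 2) : ZMod 2 := if u = fun _ => false then 1 else 0

/-- The indicator function of the two vertices in the middle. -/
def middle (u : CubeVertex 2) : ZMod 2 := if u 0 = u 1 then 0 else 1

/-- The indicator function of the top vertex. -/
def top (u : CubeVertex 2) : ZMod 2 := if u = fun _ => true then 1 else 0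

variable (t l m) in
/-- The cochain that is supported over the bottom vertex. -/
def bottomCochain (a : (squareFunctor t l m).flow.Ob) : ZMod 2 :=
  bottom (SignedCubeFunctor.vertex a)

variable (t l m) in
/-- The object over the top vertex. -/
def topOb : (squareFunctor t l m).flow.Ob :=
  (⟨fun _ => true, default⟩ : Σ u : CubeVertex 2, Carr u u)

theorem bottomCochain_mem : bottomCochain t l m ∈ (squareFunctor t l m).flow.cocycles 0 := by
  refine ⟨fun a ha => if_neg fun h => ha ?_, coboundary_eq_zero _⟩
  have h1 : (squareFunctor t l m).flow.gr a = ((SignedCubeFunctor.vertex a).weight : ℤ) := rfl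
  rw [h1, h]
  decide

open scoped Classical in
theorem half_bottomCochain :
    half (bottomCochain t l m) = fun a => middle (SignedCubeFunctor.vertex a) := by
  funext a
  have h : ∀ u : CubeVertex 2, (((∑ e : SubCube 2 1, ∑ _z : Carr e.1.1 e.1.2,
      if e.1.1 = u then (bottom e.1.2).val else 0) / 2 : ℕ) : ZMod 2) = middle u := by
    decide
  refine Eq.trans ?_ (h _)
  exact congrArg (fun k : ℕ => ((k / 2 : ℕ) : ZMod 2))
    (sum_out (a := a) rfl fun e _ => (bottom e.1.2).val)

/-- The value of `Sq²_ε` on the class of `bottomCochain`, at the top. -/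
def value (ε t l m : ZMod 2) : ZMod 2 :=
  sqRep ((squareFunctor t l m).flowSign (CubeFlow.stdSign 2))
    ((squareFunctor t l m).flowFrame 0 ε (CubeFlow.stdSign 2) (CubeFlow.stdFrame 2))
    (bottomCochain t l m) (topOb t l m)

variable (t l m) in
/-- The value without signs. -/
def plainValue : ZMod 2 :=
  sqRep ((squareFunctor t l m).pullPt (CubeFlow.stdSign 2))
    ((squareFunctor t l m).pullFrame (CubeFlow.stdFrame 2)) (bottomCochain t l m) (topOb t l m)

open scoped Classical in
theorem value_eq (ε : ZMod 2) : value ε t l m = plainValue t l m +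
    (1 + ε) * wcob (squareFunctor t l m).ptSign
      (wcob (squareFunctor t l m).ptSign (bottomCochain t l m)) (topOb t l m) +
    wcob (squareFunctor t l m).ptSign
      (fun a => middle (SignedCubeFunctor.vertex a)) (topOb t l m) := by
  have h := SignedCubeFunctor.sqRep_flow (F := squareFunctor t l m) CubeFlow.isFramed_std 0 ε
    (coboundary_eq_zero (bottomCochain t l m)) (topOb t l m)
  rw [wcob_pullPt, wcob_zero, coboundary_eq_zero, half_bottomCochain] at h
  simpa [value, plainValue] using h

/-- The pulled back framing does not see the signs of F, so m does not occur in the value. -/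
theorem plainValue_eq (m' : ZMod 2) : plainValue t l m = plainValue t l m' := rfl

theorem value_unsigned (ε : ZMod 2) : value ε 0 0 0 = plainValue 0 0 0 := by
  have h1 := wcob_ptSign (t := 0) (l := 0) (m := 0) (g := bottom) (g' := fun _ => 0) (by decide)
  have h2 := wcob_ptSign (t := 0) (l := 0) (m := 0) (g := middle) (g' := fun _ => 0) (by decide)
  have h3 := wcob_ptSign (t := 0) (l := 0) (m := 0) (g := fun _ => 0) (g' := fun _ => 0) (by decide)
  rw [value_eq, h2, show bottomCochain _ _ _ = fun a => bottom (SignedCubeFunctor.vertex a) from rfl, h1, h3]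
  simp

/-- Only edges in the second direction carry a sign on one of their arrows. A path from top to
bottom uses one such edge, so the quadratic term vanishes, and the edge at the top contributes 1 to
the linear term, for either ε. -/
theorem value_signed (ε : ZMod 2) : value ε 0 0 1 = plainValue 0 0 1 + 1 := by
  let g : CubeVertex 2 → ZMod 2 := fun u => if u = ![false, true] then 1 else 0
  have h1 := wcob_ptSign (t := 0) (l := 0) (m := 1) (g := bottom) (g' := g) (by decide)
  have h2 := wcob_ptSign (t := 0) (l := 0) (m := 1) (g := middle) (g' := top) (by decide)
  have h3 := wcob_ptSign (t := 0) (l := 0) (m := 1) (g := g) (g' := fun _ => 0) (by decide)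
  rw [value_eq, h2, show bottomCochain _ _ _ = fun a => bottom (SignedCubeFunctor.vertex a) from rfl, h1, h3]
  simp [top, topOb, SignedCubeFunctor.vertex]

/-- With the twist, the edges in the second direction starting at u₀ = 1 carry a sign as well. So on
the path from (1,1) through (1,0) to (0,0) both steps have odd weight, and the quadratic term, whose
coefficient is 1 + ε, equals 1. -/
theorem value_twisted : value 0 1 1 0 = value 1 1 1 0 + 1 := by
  let g : CubeVertex 2 → ZMod 2 := fun u => if u = ![true, false] then 1 else 0
  have h1 := wcob_ptSign (t := 1) (l := 1) (m := 0) (g := bottom) (g' := g) (by decide)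
  have h3 := wcob_ptSign (t := 1) (l := 1) (m := 0) (g := g) (g' := top) (by decide)
  rw [value_eq, value_eq, show bottomCochain _ _ _ = fun a => bottom (SignedCubeFunctor.vertex a) from rfl, h1, h3]
  have key : ∀ x y : ZMod 2, x + (1 + 0) * 1 + y = x + (1 + 1) * 1 + y + 1 := by decide
  exact key _ _

theorem sqTwo_bottomCochain (ε : ZMod 2) :
    (squareFunctor t l m).sqTwo ε 0 (H.mk (bottomCochain t l m) bottomCochain_mem) =
      H.mk _ (sqRep_mem_cocycles (SignedCubeFunctor.isFramed_flow CubeFlow.isFramed_std 0 ε)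
        bottomCochain_mem) := rfl

theorem mk_eq_mk_iff {k : ℤ} {φ ψ : (squareFunctor t l m).flow.Ob → ZMod 2}
    (hφ : φ ∈ (squareFunctor t l m).flow.cocycles k)
    (hψ : ψ ∈ (squareFunctor t l m).flow.cocycles k) : H.mk φ hφ = H.mk ψ hψ ↔ φ = ψ := by
  refine ⟨fun h => ?_, fun h => by subst h; rfl⟩
  obtain ⟨χ, -, hχ⟩ := (OneFlowCat.mk_eq_mk_iff hφ hψ).1 h
  rw [coboundary_eq_zero] at hχ
  exact sub_eq_zero.1 hχ.symm

theorem sqTwo_ne_zero {ε : ZMod 2} (h : value ε t l m ≠ 0) :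
    (squareFunctor t l m).sqTwo ε 0 ≠ 0 := by
  intro h0
  have h1 := sqTwo_bottomCochain (t := t) (l := l) (m := m) ε
  rw [h0, LinearMap.zero_apply] at h1
  have h2 := (mk_eq_mk_iff (zero_mem _) _).1 h1
  exact h (congrFun h2 (topOb t l m)).symm

theorem sqTwo_ne_sqTwo {ε ε' : ZMod 2} (h : value ε t l m ≠ value ε' t l m) :
    (squareFunctor t l m).sqTwo ε 0 ≠ (squareFunctor t l m).sqTwo ε' 0 := by
  intro h0
  have h1 := sqTwo_bottomCochain (t := t) (l := l) (m := m) ε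
  rw [h0, sqTwo_bottomCochain] at h1
  exact h (congrFun ((mk_eq_mk_iff _ _).1 h1) (topOb t l m)).symm

theorem exists_sqTwo_ne_zero (ε : ZMod 2) : ∃ m, (squareFunctor 0 0 m).sqTwo ε 0 ≠ 0 := by
  have h2 : ∀ x : ZMod 2, x = 0 → x + 1 ≠ 0 := by decide
  -- The plain value need not be computed: the functors with m = 0 and m = 1 give values that differ
  -- by 1, so one of them is non-zero.
  by_cases h : plainValue 0 0 0 = 0
  · exact ⟨1, sqTwo_ne_zero (by rw [value_signed, plainValue_eq 0]; exact h2 _ h)⟩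
  · exact ⟨0, sqTwo_ne_zero (by rwa [value_unsigned])⟩

end squareFunctor

end

/-! ### The proposition -/

theorem proposition1p1 :
    -- `C_F` is a framed `1`-flow category for every choice of `s`, `f`, `δ`, `ε`
    (∀ (n : ℕ) (F : SignedCubeFunctor n) (s : (cubeFlow n).Pt → ZMod 2)
      (f : (cubeFlow n).PreFraming), (cubeFlow n).IsFramed s f →
      ∀ δ ε : ZMod 2, F.flow.IsFramed (F.flowSign s) (F.flowFrame δ ε s f)) ∧
    -- it gives well-defined linear maps `Sq²_ε` that depend on `F` and `ε` only
    (∀ (n : ℕ) (F : SignedCubeFunctor n) (ε : ZMod 2) (i : ℤ),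
      ∃! T : F.H i →ₗ[ZMod 2] F.H (i + 2), F.IsSqTwo ε T) ∧
    -- they are non-zero in general
    (∀ ε : ZMod 2, ∃ (n : ℕ) (F : SignedCubeFunctor n) (i : ℤ)
      (T : F.H i →ₗ[ZMod 2] F.H (i + 2)), F.IsSqTwo ε T ∧ T ≠ 0) ∧
    -- they can depend on `ε`
    (∃ (n : ℕ) (F : SignedCubeFunctor n) (i : ℤ) (T₀ T₁ : F.H i →ₗ[ZMod 2] F.H (i + 2)),
      F.IsSqTwo 0 T₀ ∧ F.IsSqTwo 1 T₁ ∧ T₀ ≠ T₁) := by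
  refine ⟨fun n F s f h δ ε => SignedCubeFunctor.isFramed_flow h δ ε,
    fun n F ε i => ⟨F.sqTwo ε i, SignedCubeFunctor.isSqTwo_sqTwo ε i, fun T hT => hT.eq⟩,
    fun ε => ?_, ?_⟩
  · obtain ⟨m, hm⟩ := squareFunctor.exists_sqTwo_ne_zero ε
    exact ⟨2, _, 0, _, SignedCubeFunctor.isSqTwo_sqTwo ε 0, hm⟩
  · exact ⟨2, _, 0, _, _, SignedCubeFunctor.isSqTwo_sqTwo 0 0, SignedCubeFunctor.isSqTwo_sqTwo 1 0,
      squareFunctor.sqTwo_ne_sqTwo (t := 1) (l := 1) (m := 0) (by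
        rw [squareFunctor.value_twisted]
        exact add_ne_left.2 one_ne_zero)⟩
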